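/- Write $S^1=\mathbb R/2\pi\mathbb Z$, $\mathbb R^2=\mathbb C$ and $\mathbb R^3_*=\mathbb R_{>0}\times S^1\times\mathbb R$. Let $\mathrm{Imm}(S^1,\mathbb R^2)$ be the set of smooth closed curves $c$ with $c'\neq 0$ everywhere, $\mathrm{Imm}(S^1,\mathbb R^2)/\mathrm{Tra}$ its quotient by translations, and let $$R:\mathrm{Imm}(S^1,\mathbb R^2)/\mathrm{Tra}\to C^\infty(S^1,\mathbb R^3_*),\qquad R(c)=\big(\sqrt{|c'|},\,\alpha,\,\kappa|c'|^2\big),$$ where $\alpha$ is the turning angle ($c'/|c'|=e^{i\alpha}$) and $\kappa$ the curvature of $c$. The space $C^\infty(S^1,\mathbb R^3_*)$ is a Fréchet manifold modelled on $C^\infty(S^1,\mathbb R)^3$, with charts inverse to $h\mapsto q+h$; its tangent spaces are identified with $C^\infty(S^1,\mathbb R)^3$. It carries the weak Riemannian metric $$G_q(h,k)=\int_{S^1}4h_1k_1+q_1^2h_2k_2+q_1^{-6}h_3k_3\,d\theta .$$ Smoothness is understood in the sense of convenient calculus (smooth curves are mapped to smooth curves). **(a)** The image of $R$ is $$\mathrm{im}(R)=\Big\{q:\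 q_2'=q_1^{-2}q_3,\ \int_{S^1}q_1^2e^{iq_2}\,d\theta=0\Big\},$$ and the inverse $R^{-1}:\mathrm{im}(R)\to \mathrm{Imm}(S^1,\mathbb R^2)/\mathrm{Tra}$ sends $q$ to the class of the closed curve $\theta\mapsto\int_0^\theta q_1^2e^{iq_2}\,d\sigma$. **(b)** $\mathrm{im}(R)$ is a splitting submanifold of $C^\infty(S^1,\mathbb R^3_*)$ of infinite codimension. **(c)** Let $\mathrm{im}(R)_{\rm op}=\{q: q_2'=q_1^{-2}q_3\}$. For $q\in \mathrm{im}(R)_{\rm op}$ and $q\in\mathrm{im}(R)$ respectively, the tangent spaces $T_q\mathrm{im}(R)_{\rm op}$ and $T_q\mathrm{im}(R)$ (velocities at $q$ of smooth curves in the set) are linear subspaces. For $q\in \mathrm{im}(R)_{\rm op}$ every $h$ has a $G_q$-orthogonal projection $k=\mathrm{Proj}_{\rm op}(q).h$ to $T_q\mathrm{im}(R)_{\rm op}$. Its component $k_2$ is the unique solution in $C^\infty(S^1,\mathbb R)$ of the elliptic equation $$q_1^2k_2-(Ak_2')'=B,\qquad A=\frac{q_1^6}{q_1^8+q_3^2},\qquad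 B=q_1^2h_2+\Big(\frac{2q_1^3q_3h_1-q_1^4h_3}{q_1^8+q_3^2}\Big)',$$ and $$k_1=\frac{2q_1^8h_1+q_1q_3h_3-q_1^3q_3k_2'}{2(q_1^8+q_3^2)},\qquad k_3=2q_1q_2'k_1+q_1^2k_2'.$$ The map $\mathrm{Proj}_{\rm op}$ is smooth. **(d)** The components of $H_{\rm cl}(q)=\int_{S^1}q_1^2e^{iq_2}\,d\theta$ have the $G$-gradients $g^1(q)=(\tfrac12q_1\cos q_2,-\sin q_2,0)$ and $g^2(q)=(\tfrac12q_1\sin q_2,\cos q_2,0)$. For $q\in\mathrm{im}(R)$ the vectors $v^i=\mathrm{Proj}_{\rm op}(q).g^i(q)$, $i=1,2$, are linearly independent. If $T(q)$ denotes the projection to the $G_q$-orthogonal complement of $\mathrm{span}\{v^1,v^2\}$, then every $h$ has a $G_q$-orthogonal projection $\mathrm{Proj}(q).h$ to $T_q\mathrm{im}(R)$, $$\mathrm{Proj}(q)=T(q)\circ\mathrm{Proj}_{\rm op}(q),$$ and $\mathrm{Proj}$ is smooth on the restriction to $\mathrm{im}(R)$ of the tangent bundle of $C^\infty(S^1,\mathbb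 R^3_*)$. -/

import Mathlib

open scoped ContDiff Topology

noncomputable section

namespace RTransform

/-! ### The Fréchet space of smooth functions on the circle

The circle is `ℝ / 2πℤ`; functions on it are `2π`-periodic functions of `θ : ℝ`. -/

/-- Smooth real functions on the circle, as a linear subspace of all functions `ℝ → ℝ`. -/
def smoothPeriodic : Submodule ℝ (ℝ → ℝ) where
  carrier := {f | ContDiff ℝ ∞ f ∧ Function.Periodic f (2 * Real.pi)}
  add_mem' := fun ha hb => ⟨ha.1.add hb.1, ha.2.add hb.2⟩
  zero_mem' := ⟨contDiff_const, fun _ => rfl⟩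
  smul_mem' := fun r _ ha => ⟨contDiff_const.smul ha.1, fun x => by
    simp only [Pi.smul_apply, ha.2 x]⟩

/-- The space `C^∞(S¹, ℝ)`. It is a type of its own, so that it carries the `C^∞`-topology below and
not the topology of pointwise convergence. -/
def SmoothFun : Type := ↥smoothPeriodic

namespace SmoothFun

instance : AddCommGroup SmoothFun := inferInstanceAs (AddCommGroup ↥smoothPeriodic)

instance : Module ℝ SmoothFun := inferInstanceAs (Module ℝ ↥smoothPeriodic)

instance : CoeFun SmoothFun (fun _ => ℝ → ℝ) := ⟨fun f => f.1⟩

/-- The Fréchet topology of `C^∞(S¹, ℝ)`: uniform convergence of all derivatives. -/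
instance : TopologicalSpace SmoothFun :=
  ⨅ n : ℕ, TopologicalSpace.induced
    (fun f : SmoothFun => UniformFun.ofFun (iteratedDeriv n (f : ℝ → ℝ)))
    (inferInstance : TopologicalSpace (UniformFun ℝ ℝ))

/-- Bundling a smooth periodic function. -/
def mk (f : ℝ → ℝ) (hf : ContDiff ℝ ∞ f) (hp : Function.Periodic f (2 * Real.pi)) : SmoothFun :=
  ⟨f, hf, hp⟩

theorem contDiff (f : SmoothFun) : ContDiff ℝ ∞ (f : ℝ → ℝ) := f.2.1

theorem periodic (f : SmoothFun) : Function.Periodic (f : ℝ → ℝ) (2 * Real.pi) := f.2.2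

end SmoothFun

/-- The Fréchet space `C^∞(S¹, ℝ³)`. It is the model space of the manifold `C^∞(S¹, ℝ³_*)` and each
of its tangent spaces. -/
abbrev Model : Type := SmoothFun × SmoothFun × SmoothFun

/-! ### Convenient calculus -/

section Calculus

variable {E F : Type*} [AddCommGroup E] [Module ℝ E] [TopologicalSpace E]
  [AddCommGroup F] [Module ℝ F] [TopologicalSpace F]

/-- `h` is the derivative of the curve `c` at time `t`, as the limit of difference quotients. -/
def HasCurveDeriv (c : ℝ → E) (h : E) (t : ℝ) : Prop :=
  Filter.Tendsto (fun s : ℝ => s⁻¹ • (c (t + s) - c t)) (𝓝[≠] 0) (𝓝 h)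

/-- A smooth curve in a topological vector space: all iterated derivatives exist. -/
def IsSmoothCurve (c : ℝ → E) : Prop :=
  ∃ C : ℕ → ℝ → E, C 0 = c ∧ ∀ n t, HasCurveDeriv (C n) (C (n + 1) t) t

/-- Smooth maps on `V` in the sense of convenient calculus: smooth curves in `V` go to smooth
curves. -/
def ConvSmoothOn (f : E → F) (V : Set E) : Prop :=
  ∀ c : ℝ → E, IsSmoothCurve c → (∀ t, c t ∈ V) → IsSmoothCurve (fun t => f (c t))

end Calculus

/-! ### The manifold `C^∞(S¹, ℝ³_*)`, where `ℝ³_* = ℝ_{>0} × S¹ × ℝ` -/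

/-- Smooth maps from the circle to the circle `ℝ / 2πℤ = Real.Angle`; smoothness is that of
`θ ↦ (cos α(θ), sin α(θ))`. -/
structure SmoothAngleFun where
  toFun : ℝ → Real.Angle
  periodic : Function.Periodic toFun (2 * Real.pi)
  smooth_cos : ContDiff ℝ ∞ (fun θ => (toFun θ).cos)
  smooth_sin : ContDiff ℝ ∞ (fun θ => (toFun θ).sin)

namespace SmoothAngleFun

instance : CoeFun SmoothAngleFun (fun _ => ℝ → Real.Angle) := ⟨SmoothAngleFun.toFun⟩

/-- The derivative `α'` of a circle valued map, a real function: `cos α (sin α)' - sin α (cos α)'`,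
that is, the derivative of any local lift of `α` to `ℝ`. -/
def angDeriv (α : SmoothAngleFun) (θ : ℝ) : ℝ :=
  (α θ).cos * deriv (fun x => (α x).sin) θ - (α θ).sin * deriv (fun x => (α x).cos) θ

theorem angDeriv_of_lift (α : SmoothAngleFun) (a : ℝ → ℝ) (a' θ : ℝ) (ha : HasDerivAt a a' θ)
    (h : ∀ᶠ x in 𝓝 θ, α x = (a x : Real.Angle)) : α.angDeriv θ = a' := by
  have h1 : deriv (fun x => (α x).sin) θ = Real.cos (a θ) * a' := by
    have e : (fun x => (α x).sin) =ᶠ[𝓝 θ] fun x => Real.sin (a x) := by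
      filter_upwards [h] with x hx
      rw [hx, Real.Angle.sin_coe]
    rw [e.deriv_eq]
    exact ha.sin.deriv
  have h2 : deriv (fun x => (α x).cos) θ = -Real.sin (a θ) * a' := by
    have e : (fun x => (α x).cos) =ᶠ[𝓝 θ] fun x => Real.cos (a x) := by
      filter_upwards [h] with x hx
      rw [hx, Real.Angle.cos_coe]
    rw [e.deriv_eq]
    exact ha.cos.deriv
  have h0 : α θ = (a θ : Real.Angle) := h.self_of_nhds
  rw [angDeriv, h1, h2, h0, Real.Angle.sin_coe, Real.Angle.cos_coe]
  linear_combination a' * Real.sin_sq_add_cos_sq (a θ)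

end SmoothAngleFun

/-- Points `q = (q₁, q₂, q₃)` of `C^∞(S¹, ℝ_{>0} × S¹ × ℝ)`. -/
structure Maps where
  q₁ : SmoothFun
  q₂ : SmoothAngleFun
  q₃ : SmoothFun
  pos : ∀ θ, 0 < q₁ θ

/-- `q = p + h` pointwise, the second coordinate being taken modulo `2π`. -/
def Shift (p : Maps) (h : Model) (q : Maps) : Prop :=
  ∀ θ, q.q₁ θ = p.q₁ θ + h.1 θ ∧ q.q₂ θ = p.q₂ θ + ((h.2.1 θ : ℝ) : Real.Angle) ∧
    q.q₃ θ = p.q₃ θ + h.2.2 θ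

/-- The open subset of the model space on which `h ↦ p + h` is the inverse of the standard chart
of `C^∞(S¹, ℝ³_*)` centred at `p`. -/
def chartDomain (p : Maps) : Set Model :=
  {h | ∀ θ, 0 < p.q₁ θ + h.1 θ ∧ |h.2.1 θ| < Real.pi}

/-- The set `N` read in the standard chart centred at `p`. -/
def chartTrace (N : Set Maps) (p : Maps) : Set Model :=
  {h | ∃ q ∈ N, Shift p h q}

/-- A smooth curve in the manifold `C^∞(S¹, ℝ³_*)`: near each time `t₀` it is a smooth curve in
the standard chart centred at `γ t₀`. -/
def IsSmoothCurveInMaps (γ : ℝ → Maps) : Prop :=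
  ∀ t₀, ∃ c : ℝ → Model, IsSmoothCurve c ∧ ∀ᶠ t in 𝓝 t₀, Shift (γ t₀) (c t) (γ t)

/-- `h` is the velocity of the curve `γ` at time `t₀`. -/
def HasVelocity (γ : ℝ → Maps) (t₀ : ℝ) (h : Model) : Prop :=
  ∃ c : ℝ → Model, IsSmoothCurve c ∧ (∀ᶠ t in 𝓝 t₀, Shift (γ t₀) (c t) (γ t)) ∧
    HasCurveDeriv c h t₀

/-- The chart of `C^∞(S¹, ℝ³_*)` around `p` which is the standard chart followed by the
diffeomorphism `e` between open subsets of the model space is a splitting submanifold chart for `N`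
with (closed, complemented) linear subspace `F`. -/
structure IsSplittingChart (N : Set Maps) (p : Maps) (e : PartialEquiv Model Model)
    (F : Submodule ℝ Model) : Prop where
  open_source : IsOpen e.source
  open_target : IsOpen e.target
  zero_mem : (0 : Model) ∈ e.source
  source_subset : e.source ⊆ chartDomain p
  smooth : ConvSmoothOn e e.source
  smooth_symm : ConvSmoothOn e.symm e.target
  closed : IsClosed (F : Set Model)
  complemented : F.ClosedComplemented
  image_eq : e '' (e.source ∩ chartTrace N p) = e.target ∩ (F : Set Model)

/-- `N` is a splitting submanifold of `C^∞(S¹, ℝ³_*)`, of infinite codimension at each point. -/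
def IsSplittingSubmanifoldOfInfiniteCodim (N : Set Maps) : Prop :=
  ∀ p ∈ N, ∃ (e : PartialEquiv Model Model) (F : Submodule ℝ Model),
    IsSplittingChart N p e F ∧ ¬ FiniteDimensional ℝ (Model ⧸ F)

/-- The tangent space at `q` of a submanifold `N`: velocities of smooth curves in `N`. -/
def tangentSet (N : Set Maps) (q : Maps) : Set Model :=
  {h | ∃ γ : ℝ → Maps, IsSmoothCurveInMaps γ ∧ (∀ t, γ t ∈ N) ∧ γ 0 = q ∧ HasVelocity γ 0 h}

/-- Smoothness of a fibrewise map `P`, `(q, h) ↦ P(q).h`, defined on the restriction to `N` of the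
tangent bundle of `C^∞(S¹, ℝ³_*)`. -/
def IsSmoothBundleMapOn (P : Maps → Model →ₗ[ℝ] Model) (N : Set Maps) : Prop :=
  ∀ (γ : ℝ → Maps) (h : ℝ → Model), IsSmoothCurveInMaps γ → (∀ t, γ t ∈ N) → IsSmoothCurve h →
    IsSmoothCurve (fun t => P (γ t) (h t))

/-! ### The weak Riemannian metric and orthogonal projections -/

/-- The metric `G^{L²}` induced by `g = diag(4, q₁², q₁⁻⁶)` on `ℝ³_*`. -/
def GL2 (q : Maps) (h k : Model) : ℝ :=
  ∫ θ in (0 : ℝ)..2 * Real.pi,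
    (4 * h.1 θ * k.1 θ + (q.q₁ θ) ^ 2 * h.2.1 θ * k.2.1 θ
      + ((q.q₁ θ) ^ 6)⁻¹ * h.2.2 θ * k.2.2 θ)

/-- `k` is the `G^{L²}`-orthogonal projection of `h` to the linear subspace `S`. -/
def IsOrthProj (q : Maps) (S : Submodule ℝ Model) (h k : Model) : Prop :=
  k ∈ S ∧ ∀ a ∈ S, GL2 q (h - k) a = 0

/-- `k` is the projection of `h` to the `G^{L²}`-orthogonal complement of the span of `v¹, v²`. -/
def IsProjToComplement (q : Maps) (v : Fin 2 → Model) (h k : Model) : Prop :=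
  (∀ a ∈ Submodule.span ℝ (Set.range v), GL2 q k a = 0) ∧
    h - k ∈ Submodule.span ℝ (Set.range v)

/-! ### Closed immersed plane curves and the `R`-transform -/

/-- Closed immersed plane curves, `Imm(S¹, ℝ²)`, with `ℝ² = ℂ`. -/
structure Imm where
  toFun : ℝ → ℂ
  smooth : ContDiff ℝ ∞ toFun
  periodic : Function.Periodic toFun (2 * Real.pi)
  immersed : ∀ θ, deriv toFun θ ≠ 0

namespace Imm

instance : CoeFun Imm (fun _ => ℝ → ℂ) := ⟨Imm.toFun⟩

/-- The arc length derivative `D_s f = f' / |c'|`. -/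
def Ds (c : Imm) (f : ℝ → ℂ) (θ : ℝ) : ℂ := ‖deriv c θ‖⁻¹ • deriv f θ

/-- The unit tangent vector. -/
def tangent (c : Imm) : ℝ → ℂ := c.Ds c

/-- The unit normal vector: the tangent vector rotated by `π/2`. -/
def normal (c : Imm) (θ : ℝ) : ℂ := Complex.I * c.tangent θ

/-- The curvature `κ = ⟨D_s v, n⟩`. -/
def curvature (c : Imm) (θ : ℝ) : ℝ := inner ℝ (c.Ds c.tangent θ) (c.normal θ)

/-- The turning angle `α`, with values in `ℝ / 2πℤ`; it is given by `v = exp(iα)`. -/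
def turningAngle (c : Imm) (θ : ℝ) : Real.Angle := (Complex.arg (c.tangent θ) : Real.Angle)

theorem norm_deriv_pos (c : Imm) (θ : ℝ) : 0 < ‖deriv c θ‖ := norm_pos_iff.mpr (c.immersed θ)

theorem deriv_periodic {f : ℝ → ℂ} {T : ℝ} (hf : Function.Periodic f T) :
    Function.Periodic (deriv f) T := fun x => by
  rw [← deriv_comp_add_const]
  congr 1
  exact funext hf

theorem contDiff_deriv (c : Imm) : ContDiff ℝ ∞ (deriv c) := (contDiff_infty_iff_deriv.mp c.smooth).2

theorem contDiff_norm (c : Imm) : ContDiff ℝ ∞ (fun θ => ‖deriv c θ‖) :=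
  c.contDiff_deriv.norm ℝ c.immersed

theorem contDiff_Ds (c : Imm) {f : ℝ → ℂ} (hf : ContDiff ℝ ∞ f) : ContDiff ℝ ∞ (c.Ds f) :=
  (c.contDiff_norm.inv fun θ => (c.norm_deriv_pos θ).ne').smul (contDiff_infty_iff_deriv.mp hf).2

theorem periodic_Ds (c : Imm) {f : ℝ → ℂ} (hf : Function.Periodic f (2 * Real.pi)) :
    Function.Periodic (c.Ds f) (2 * Real.pi) := fun θ => by
  simp only [Ds, deriv_periodic hf θ, deriv_periodic c.periodic θ]

theorem contDiff_tangent (c : Imm) : ContDiff ℝ ∞ c.tangent := c.contDiff_Ds c.smooth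

theorem periodic_tangent (c : Imm) : Function.Periodic c.tangent (2 * Real.pi) :=
  c.periodic_Ds c.periodic

theorem norm_tangent (c : Imm) (θ : ℝ) : ‖c.tangent θ‖ = 1 := by
  have h := c.norm_deriv_pos θ
  simp [tangent, Ds, h.ne']

theorem cos_turningAngle (c : Imm) (θ : ℝ) : (c.turningAngle θ).cos = (c.tangent θ).re := by
  have h : c.tangent θ ≠ 0 := by
    rw [← norm_pos_iff, norm_tangent]
    exact one_pos
  rw [turningAngle, Real.Angle.cos_coe, Complex.cos_arg h, norm_tangent, div_one]

theorem sin_turningAngle (c : Imm) (θ : ℝ) : (c.turningAngle θ).sin = (c.tangent θ).im := by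
  rw [turningAngle, Real.Angle.sin_coe, Complex.sin_arg, norm_tangent, div_one]

/-- The `R`-transform of a curve, `R(c) = (√|c'|, α, κ|c'|²)`. -/
def rTransform (c : Imm) : Maps where
  q₁ := SmoothFun.mk (fun θ => Real.sqrt ‖deriv c θ‖)
    (c.contDiff_norm.sqrt fun θ => (c.norm_deriv_pos θ).ne')
    (fun θ => by simp only [deriv_periodic c.periodic θ])
  q₂ :=
    { toFun := c.turningAngle
      periodic := fun θ => by simp only [turningAngle, c.periodic_tangent θ]
      smooth_cos := by
        simp only [cos_turningAngle]
        exact Complex.reCLM.contDiff.comp c.contDiff_tangent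
      smooth_sin := by
        simp only [sin_turningAngle]
        exact Complex.imCLM.contDiff.comp c.contDiff_tangent }
  q₃ := SmoothFun.mk (fun θ => c.curvature θ * ‖deriv c θ‖ ^ 2)
    (((c.contDiff_Ds c.contDiff_tangent).inner ℝ
      (contDiff_const.mul c.contDiff_tangent)).mul (c.contDiff_norm.pow 2))
    (fun θ => by
      simp only [curvature, normal, deriv_periodic c.periodic θ, c.periodic_tangent θ,
        c.periodic_Ds c.periodic_tangent θ])
  pos := fun θ => Real.sqrt_pos.mpr (c.norm_deriv_pos θ)

/-- Two curves are equivalent if they differ by a translation. -/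
instance translationSetoid : Setoid Imm where
  r c d := ∃ a : ℂ, ∀ θ, d θ = c θ + a
  iseqv :=
    { refl := fun _ => ⟨0, fun _ => (add_zero _).symm⟩
      symm := fun ⟨a, h⟩ => ⟨-a, fun θ => by rw [h θ]; ring⟩
      trans := fun ⟨a, h⟩ ⟨b, k⟩ => ⟨a + b, fun θ => by rw [k θ, h θ]; ring⟩ }

theorem rTransform_eq_of_translate (c d : Imm) (h : ∃ a : ℂ, ∀ θ, d θ = c θ + a) :
    c.rTransform = d.rTransform := by
  obtain ⟨a, h⟩ := h
  have hd : deriv d.toFun = deriv c.toFun := by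
    have e : d.toFun = fun θ => c.toFun θ + a := funext h
    rw [e]
    funext θ
    exact deriv_add_const a
  have hDs : d.Ds = c.Ds := by
    funext f θ
    simp only [Ds, hd]
  have ht : d.tangent = c.tangent := by
    funext θ
    simp only [tangent, Ds, hd]
  have ha : d.turningAngle = c.turningAngle := by
    funext θ
    simp only [turningAngle, ht]
  simp only [rTransform, curvature, normal, hd, ht, hDs, ha]

end Imm

/-- The space `Imm(S¹, ℝ²)/Tra` of closed curves modulo translations. -/
abbrev ImmModTra : Type := Quotient Imm.translationSetoid

/-- The `R`-transform `Imm(S¹, ℝ²)/Tra → C^∞(S¹, ℝ³_*)`. -/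
def R : ImmModTra → Maps := Quotient.lift Imm.rTransform Imm.rTransform_eq_of_translate

/-! ### The constraint sets and the maps in the projection formula -/

/-- `H_cl(q) = ∫ q₁² exp(iq₂) dθ`, with values in `ℝ² = ℂ`. -/
def Hcl (q : Maps) : ℂ :=
  ∫ θ in (0 : ℝ)..2 * Real.pi, ((q.q₁ θ : ℝ) : ℂ) ^ 2 * ((q.q₂ θ).toCircle : ℂ)

/-- The set of `q` with `q₂' = q₁⁻² q₃`. -/
def imOp : Set Maps := {q | ∀ θ, q.q₂.angDeriv θ = ((q.q₁ θ) ^ 2)⁻¹ * q.q₃ θ}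

/-- The set of `q` with `q₂' = q₁⁻² q₃` and `∫ q₁² exp(iq₂) dθ = 0`. -/
def imCl : Set Maps := {q | q ∈ imOp ∧ Hcl q = 0}

/-- The components of `H_cl`. -/
def HclComp (i : Fin 2) (q : Maps) : ℝ := ![(Hcl q).re, (Hcl q).im] i

/-- The vectors `(½ q₁ cos q₂, -sin q₂, 0)` and `(½ q₁ sin q₂, cos q₂, 0)`. -/
def gradHcl (q : Maps) : Fin 2 → Model :=
  ![(SmoothFun.mk (fun θ => 1 / 2 * q.q₁ θ * (q.q₂ θ).cos)
        ((contDiff_const.mul q.q₁.contDiff).mul q.q₂.smooth_cos)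
        (fun θ => by simp only [q.q₁.periodic θ, q.q₂.periodic θ]),
      SmoothFun.mk (fun θ => -(q.q₂ θ).sin) q.q₂.smooth_sin.neg
        (fun θ => by simp only [q.q₂.periodic θ]), 0),
    (SmoothFun.mk (fun θ => 1 / 2 * q.q₁ θ * (q.q₂ θ).sin)
        ((contDiff_const.mul q.q₁.contDiff).mul q.q₂.smooth_sin)
        (fun θ => by simp only [q.q₁.periodic θ, q.q₂.periodic θ]),
      SmoothFun.mk (fun θ => (q.q₂ θ).cos) q.q₂.smooth_cos
        (fun θ => by simp only [q.q₂.periodic θ]), 0)]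

/-- `g` is the `G^{L²}`-gradient at `q` of the function `f`: along every smooth curve through `q`
with velocity `h`, the function has derivative `G^{L²}_q(g, h)`. -/
def IsGradientAt (f : Maps → ℝ) (q : Maps) (g : Model) : Prop :=
  ∀ (γ : ℝ → Maps) (h : Model), IsSmoothCurveInMaps γ → γ 0 = q → HasVelocity γ 0 h →
    HasDerivAt (fun t => f (γ t)) (GL2 q g h) 0

/-- The leading coefficient `A = q₁⁶ / (q₁⁸ + q₃²)` of the elliptic equation. -/
def coeffA (q : Maps) (θ : ℝ) : ℝ := (q.q₁ θ) ^ 6 / ((q.q₁ θ) ^ 8 + (q.q₃ θ) ^ 2)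

/-- The right hand side
`B = q₁² h₂ + ((2 q₁³ q₃ h₁ - q₁⁴ h₃) / (q₁⁸ + q₃²))'` of the elliptic equation. -/
def coeffB (q : Maps) (h : Model) (θ : ℝ) : ℝ :=
  (q.q₁ θ) ^ 2 * h.2.1 θ +
    deriv (fun x => (2 * (q.q₁ x) ^ 3 * q.q₃ x * h.1 x - (q.q₁ x) ^ 4 * h.2.2 x) /
      ((q.q₁ x) ^ 8 + (q.q₃ x) ^ 2)) θ

/-- `u` solves the elliptic equation `q₁² u - (A u')' = B` on the circle. -/
def SolvesElliptic (q : Maps) (h : Model) (u : SmoothFun) : Prop :=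
  ∀ θ, (q.q₁ θ) ^ 2 * u θ - deriv (fun x => coeffA q x * deriv u x) θ = coeffB q h θ

/-- The formula for `k = Proj_op(q).h`: `k₂` is the unique solution of the elliptic equation, and
`k₁`, `k₃` are computed from it. -/
def IsGivenByElliptic (q : Maps) (h k : Model) : Prop :=
  SolvesElliptic q h k.2.1 ∧ (∀ u : SmoothFun, SolvesElliptic q h u → u = k.2.1) ∧
  (∀ θ, k.1 θ = (2 * (q.q₁ θ) ^ 8 * h.1 θ + q.q₁ θ * q.q₃ θ * h.2.2 θ
      - (q.q₁ θ) ^ 3 * q.q₃ θ * deriv k.2.1 θ) / (2 * ((q.q₁ θ) ^ 8 + (q.q₃ θ) ^ 2))) ∧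
  (∀ θ, k.2.2 θ = 2 * q.q₁ θ * q.q₂.angDeriv θ * k.1 θ + (q.q₁ θ) ^ 2 * deriv k.2.1 θ)

end RTransform

end

open RTransform

/-! The foundation is the exponential law `isSmoothCurve_iff`: a curve in C^∞(S¹, ℝ) is smooth
exactly when it is jointly smooth in (t, θ). Smoothness in the Fréchet space thus becomes ordinary
calculus in two variables for every operation used here except solving the elliptic equation.

Image of R. Since √|c'|² e^{iα} = c' (`speed_rTransform`), a curve is recovered from its transform
by integration, up to translation. It closes when the integral of q₁² e^{iq₂} vanishes, and the
constraint determines q₃ from q₁ and q₂.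

Projection without closing. The constraint q₃ = q₁² q₂' linearizes to a₃ = 2q₁q₂'a₁ + q₁²a₂' with
a₁, a₂ free. Orthogonality of h - k to all such a gives an algebraic equation for k₁ when a₁ varies
and, after integration by parts, the elliptic equation for k₂ when a₂ varies. Conversely, for the k
so obtained the integrand of G(h - k, a) is an exact derivative (`GDensity_sub_Pop`). The elliptic
operator is injective by the maximum principle. It is surjective because a constant-coefficient
model factors into two first-order equations and the rest is absorbed by a contraction
(`exists_ellOp_eq`). Solutions depend smoothly on the data because difference quotients solve
equations of the same kind (`isSmoothCurve_of_ellOp`).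

Closing condition. The tangent of a closed curve is not confined to one line, so cos q₂ and sin q₂
are linearly independent (`not_lincomb_eq_zero`) and their Gram determinant is nonzero. For f near
0, any u can therefore be corrected by a unique combination of them so that ∫ u e^{i(q₂+f)} takes a
prescribed value. This explicit 2×2 linear solve, `closeCorr`, takes the place of an implicit
function theorem. It yields curves in the image with a given tangent vector (`exists_closing_curve`)
and the straightening chart (`chartEquiv`). The codimension is infinite because the chart sends the
whole third coordinate to zero.

The vectors vⁱ are independent because a combination with coefficients s, t pairs with a suitable
tangent vector to (s² + t²)∫q₁² (`linearIndependent_Pop_grad`). Gram–Schmidt applied to them gives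
T, with smooth coefficients. -/

noncomputable section

namespace RTransform

/-! ### The algebra of smooth periodic functions -/

namespace SmoothFun

@[ext]
theorem ext {f g : SmoothFun} (h : ∀ θ, f θ = g θ) : f = g := Subtype.ext (funext h)

@[simp] theorem mk_apply (f : ℝ → ℝ) (hf hp) (θ : ℝ) : mk f hf hp θ = f θ := rfl
@[simp] theorem add_apply (f g : SmoothFun) (θ : ℝ) : (f + g) θ = f θ + g θ := rfl
@[simp] theorem sub_apply (f g : SmoothFun) (θ : ℝ) : (f - g) θ = f θ - g θ := rfl
@[simp] theorem neg_apply (f : SmoothFun) (θ : ℝ) : (-f) θ = -f θ := rfl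
@[simp] theorem smul_apply (r : ℝ) (f : SmoothFun) (θ : ℝ) : (r • f) θ = r * f θ := rfl
@[simp] theorem zero_apply (θ : ℝ) : (0 : SmoothFun) θ = 0 := rfl

instance : Mul SmoothFun :=
  ⟨fun f g => mk (fun θ => f θ * g θ) (f.contDiff.mul g.contDiff)
    (fun θ => by simp only [f.periodic θ, g.periodic θ])⟩

instance : One SmoothFun := ⟨mk (fun _ => 1) contDiff_const (fun _ => rfl)⟩

@[simp] theorem mul_apply (f g : SmoothFun) (θ : ℝ) : (f * g) θ = f θ * g θ := rfl
@[simp] theorem one_apply (θ : ℝ) : (1 : SmoothFun) θ = 1 := rfl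

-- With this structure `ring` and `linear_combination` apply to functions as elements, and most
-- identities below need no evaluation at points.
scoped instance : CommRing SmoothFun :=
  { (inferInstance : AddCommGroup SmoothFun) with
    mul := (· * ·)
    one := 1
    left_distrib := fun f g h => by ext θ; simp [mul_add]
    right_distrib := fun f g h => by ext θ; simp [add_mul]
    zero_mul := fun f => by ext θ; simp
    mul_zero := fun f => by ext θ; simp
    mul_assoc := fun f g h => by ext θ; simp [mul_assoc]
    one_mul := fun f => by ext θ; simp
    mul_one := fun f => by ext θ; simp
    mul_comm := fun f g => by ext θ; simp [mul_comm] }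

@[simp] theorem pow_apply (f : SmoothFun) (n : ℕ) (θ : ℝ) : (f ^ n) θ = f θ ^ n := by
  induction n with
  | zero => simp
  | succ n ih => rw [pow_succ, mul_apply, ih, pow_succ]

/-- Constant functions. -/
def const (r : ℝ) : SmoothFun := mk (fun _ => r) contDiff_const (fun _ => rfl)

@[simp] theorem const_apply (r θ : ℝ) : const r θ = r := rfl

scoped instance : Algebra ℝ SmoothFun :=
  Algebra.ofModule (fun r f g => by ext θ; simp [mul_assoc])
    (fun r f g => by ext θ; simp; ring)

theorem differentiable (f : SmoothFun) : Differentiable ℝ (f : ℝ → ℝ) :=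
  f.contDiff.differentiable (by simp)

theorem continuous (f : SmoothFun) : Continuous (f : ℝ → ℝ) := f.contDiff.continuous

theorem periodic_deriv {f : ℝ → ℝ} {T : ℝ} (hf : Function.Periodic f T) :
    Function.Periodic (deriv f) T := fun x => by
  rw [← deriv_comp_add_const]
  congr 1
  exact funext hf

/-- The derivative as a linear endomorphism of `C^∞(S¹, ℝ)`. -/
def D : SmoothFun →ₗ[ℝ] SmoothFun where
  toFun f := mk (deriv f) (contDiff_infty_iff_deriv.mp f.contDiff).2 (periodic_deriv f.periodic)
  map_add' f g := by
    ext θ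
    exact deriv_add (f.differentiable θ) (g.differentiable θ)
  map_smul' r f := by
    ext θ
    exact deriv_const_mul r (f.differentiable θ)

@[simp] theorem D_apply (f : SmoothFun) (θ : ℝ) : D f θ = deriv f θ := rfl

theorem hasDerivAt (f : SmoothFun) (θ : ℝ) : HasDerivAt f (D f θ) θ :=
  (f.differentiable θ).hasDerivAt

theorem D_eq {f g : SmoothFun} (h : ∀ θ, HasDerivAt f (g θ) θ) : D f = g := by
  ext θ
  exact (h θ).deriv

theorem D_mul (f g : SmoothFun) : D (f * g) = D f * g + f * D g :=
  D_eq fun θ => (f.hasDerivAt θ).mul (g.hasDerivAt θ)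

@[simp] theorem D_const (r : ℝ) : D (const r) = 0 := D_eq fun θ => hasDerivAt_const θ r

theorem coe_D (f : SmoothFun) : ((D f : SmoothFun) : ℝ → ℝ) = deriv f := rfl

theorem iteratedDeriv_D (f : SmoothFun) (n : ℕ) :
    iteratedDeriv n (D f) = iteratedDeriv (n + 1) f := by
  rw [iteratedDeriv_succ', coe_D]

/-! ### The topology -/

variable {ι : Type*} {l : Filter ι} {F G : ι → SmoothFun} {f g : SmoothFun}

/-- Uniform convergence of all derivatives up to order `k`. -/
def TendstoUpTo (k : ℕ) (F : ι → SmoothFun) (l : Filter ι) (f : SmoothFun) : Prop :=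
  ∀ n ≤ k, TendstoUniformly (fun i => iteratedDeriv n (F i)) (iteratedDeriv n f) l

theorem tendsto_iff : Filter.Tendsto F l (𝓝 f) ↔
    ∀ n, TendstoUniformly (fun i => iteratedDeriv n (F i)) (iteratedDeriv n f) l := by
  have : 𝓝 f = ⨅ n : ℕ, Filter.comap
      (fun f : SmoothFun => UniformFun.ofFun (iteratedDeriv n (f : ℝ → ℝ)))
      (𝓝 (UniformFun.ofFun (iteratedDeriv n (f : ℝ → ℝ)))) := by
    simp only [← nhds_induced]
    exact nhds_iInf
  rw [this]
  simp only [Filter.tendsto_iInf, Filter.tendsto_comap_iff]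
  refine forall_congr' fun n => ?_
  rw [UniformFun.tendsto_iff_tendstoUniformly]
  rfl

theorem tendsto_iff_upTo : Filter.Tendsto F l (𝓝 f) ↔ ∀ k, TendstoUpTo k F l f := by
  rw [tendsto_iff]
  exact ⟨fun h k n _ => h n, fun h n => h n n le_rfl⟩

theorem tendstoUpTo_zero : TendstoUpTo 0 F l f ↔ TendstoUniformly (fun i => F i) f l := by
  simp [TendstoUpTo]

/-- The recursion behind the inductions on the order of differentiability: any rule expressing `D`
of an operation through lower data lifts uniform convergence to all orders. -/
theorem tendstoUpTo_succ (k : ℕ) : TendstoUpTo (k + 1) F l f ↔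
    TendstoUniformly (fun i => F i) f l ∧ TendstoUpTo k (fun i => D (F i)) l (D f) := by
  constructor
  · intro h
    refine ⟨by simpa using h 0 (by simp), fun n hn => ?_⟩
    simp only [iteratedDeriv_D]
    exact h (n + 1) (by omega)
  · rintro ⟨h0, h⟩ n hn
    cases n with
    | zero => simpa using h0
    | succ n =>
      have := h n (by omega)
      simpa only [iteratedDeriv_D] using this

theorem TendstoUpTo.mono {j k : ℕ} (h : TendstoUpTo k F l f) (hjk : j ≤ k) : TendstoUpTo j F l f :=
  fun n hn => h n (hn.trans hjk)

theorem TendstoUpTo.uniform {k : ℕ} (h : TendstoUpTo k F l f) :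
    TendstoUniformly (fun i => F i) f l := tendstoUpTo_zero.1 (h.mono (Nat.zero_le k))

theorem exists_bound (f : SmoothFun) : ∃ C : ℝ, 0 < C ∧ ∀ θ, |f θ| ≤ C := by
  obtain ⟨C, hC⟩ := f.periodic.compact_of_continuous Real.two_pi_pos.ne' f.continuous
    |>.isBounded.exists_norm_le
  refine ⟨max C 1, by positivity, fun θ => le_max_of_le_left ?_⟩
  exact hC _ ⟨θ, rfl⟩

theorem TendstoUpTo.add {k : ℕ} (hF : TendstoUpTo k F l f) (hG : TendstoUpTo k G l g) :
    TendstoUpTo k (fun i => F i + G i) l (f + g) := by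
  induction k generalizing F G f g with
  | zero =>
    rw [tendstoUpTo_zero] at *
    exact hF.add hG
  | succ k ih =>
    rw [tendstoUpTo_succ] at *
    simp only [map_add]
    exact ⟨hF.1.add hG.1, ih hF.2 hG.2⟩

theorem tendstoUniformly_mul (hF : TendstoUniformly (fun i => F i) f l)
    (hG : TendstoUniformly (fun i => G i) g l) :
    TendstoUniformly (fun i => (F i * G i : SmoothFun)) (f * g : SmoothFun) l := by
  rw [Metric.tendstoUniformly_iff] at *
  intro ε hε
  obtain ⟨A, hA, hfA⟩ := f.exists_bound
  obtain ⟨B, hB, hgB⟩ := g.exists_bound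
  -- With both errors below δ ≤ 1, the three terms of the expansion are at most δB, Aδ and δ; their
  -- sum is δ(A + B + 1).
  have h1 : 0 < min 1 (ε / (A + B + 1)) := by positivity
  filter_upwards [hF _ h1, hG _ h1] with i hi hj θ
  have a := hi θ
  have b := hj θ
  simp only [Real.dist_eq, mul_apply] at *
  set δ := min 1 (ε / (A + B + 1))
  have hδ1 : δ ≤ 1 := min_le_left _ _
  have hδ : δ * (A + B + 1) ≤ ε := by
    rw [← le_div_iff₀ (by positivity)]
    exact min_le_right _ _
  have e : f θ * g θ - F i θ * G i θ =
      (f θ - F i θ) * g θ + f θ * (g θ - G i θ) - (f θ - F i θ) * (g θ - G i θ) := by ring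
  rw [e]
  calc _ ≤ |f θ - F i θ| * |g θ| + |f θ| * |g θ - G i θ| + |f θ - F i θ| * |g θ - G i θ| := by
        rw [← abs_mul, ← abs_mul, ← abs_mul]
        exact (abs_sub _ _).trans (add_le_add_left (abs_add_le _ _) _)
    _ < δ * (A + B + 1) := by
        have := mul_le_mul a.le (hgB θ) (abs_nonneg _) h1.le
        have := mul_le_mul (hfA θ) b.le (abs_nonneg _) hA.le
        have : |f θ - F i θ| * |g θ - G i θ| < δ * 1 :=
          mul_lt_mul'' a (b.trans_le hδ1) (abs_nonneg _) (abs_nonneg _)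
        nlinarith
    _ ≤ ε := hδ

/-- The Leibniz rule expresses the derivative of a product through products to which the induction
hypothesis applies. -/
theorem TendstoUpTo.mul {k : ℕ} (hF : TendstoUpTo k F l f) (hG : TendstoUpTo k G l g) :
    TendstoUpTo k (fun i => F i * G i) l (f * g) := by
  induction k generalizing F G f g with
  | zero =>
    rw [tendstoUpTo_zero] at *
    exact tendstoUniformly_mul hF hG
  | succ k ih =>
    have hF' := hF.mono k.le_succ
    have hG' := hG.mono k.le_succ
    rw [tendstoUpTo_succ] at hF hG ⊢
    simp only [D_mul]
    exact ⟨tendstoUniformly_mul hF.1 hG.1, (ih hF.2 hG').add (ih hF' hG.2)⟩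

instance : ContinuousAdd SmoothFun :=
  ⟨continuous_iff_continuousAt.2 fun _ => tendsto_iff_upTo.2 fun k =>
    (tendsto_iff_upTo.1 continuous_fst.continuousAt k).add
      (tendsto_iff_upTo.1 continuous_snd.continuousAt k)⟩

instance : ContinuousMul SmoothFun :=
  ⟨continuous_iff_continuousAt.2 fun _ => tendsto_iff_upTo.2 fun k =>
    (tendsto_iff_upTo.1 continuous_fst.continuousAt k).mul
      (tendsto_iff_upTo.1 continuous_snd.continuousAt k)⟩

/-- Scaling by r is multiplication by `const r`, so joint continuity of scalar multiplication
follows from this and continuity of the product. -/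
theorem continuous_const_map : Continuous const := by
  refine continuous_iff_continuousAt.2 fun r => tendsto_iff_upTo.2 fun k => ?_
  have h0 : TendstoUniformly (fun s : ℝ => (const s : ℝ → ℝ)) (const r) (𝓝 r) := by
    rw [Metric.tendstoUniformly_iff]
    intro ε hε
    filter_upwards [Metric.ball_mem_nhds r hε] with s hs _
    rwa [dist_comm]
  have h1 : ∀ k, TendstoUpTo k (fun _ : ℝ => (0 : SmoothFun)) (𝓝 r) 0 := fun k n _ => by
    rw [Metric.tendstoUniformly_iff]
    intro ε hε
    simp [hε]
  cases k with
  | zero => rwa [tendstoUpTo_zero]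
  | succ k =>
    rw [tendstoUpTo_succ]
    simp only [D_const]
    exact ⟨h0, h1 k⟩

instance : ContinuousSMul ℝ SmoothFun :=
  ⟨((continuous_const_map.comp continuous_fst).mul continuous_snd)⟩

instance : IsTopologicalAddGroup SmoothFun where
  continuous_neg := by
    have : (fun f : SmoothFun => -f) = fun f => (-1 : ℝ) • f := by
      funext f
      simp
    rw [this]
    exact continuous_const_smul _

instance : IsTopologicalRing SmoothFun where

theorem continuous_D : Continuous (D : SmoothFun → SmoothFun) := by
  refine continuous_iff_continuousAt.2 fun f => tendsto_iff.2 fun n => ?_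
  simp only [iteratedDeriv_D]
  exact tendsto_iff.1 (Filter.tendsto_id (α := SmoothFun) (x := 𝓝 f)) (n + 1)

/-- Evaluation at a point. -/
def eval (θ : ℝ) : SmoothFun →L[ℝ] ℝ where
  toFun f := f θ
  map_add' _ _ := rfl
  map_smul' _ _ := rfl
  cont := continuous_iff_continuousAt.2 fun f => by
    have := tendsto_iff.1 (Filter.tendsto_id (α := SmoothFun) (x := 𝓝 f)) 0
    simp only [iteratedDeriv_zero] at this
    exact this.tendsto_at θ

instance : T2Space SmoothFun :=
  T2Space.of_injective_continuous (f := fun (f : SmoothFun) (θ : ℝ) => f θ)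
    (fun _ _ h => ext fun θ => congrFun h θ) (continuous_pi fun θ => (eval θ).continuous)

theorem _root_.Filter.Tendsto.uniform_smoothFun (h : Filter.Tendsto F l (𝓝 f)) :
    TendstoUniformly (fun i => F i) f l := by
  simpa using tendsto_iff.1 h 0

/-- The integral over the circle. -/
def integral : SmoothFun →L[ℝ] ℝ where
  toFun f := ∫ θ in (0 : ℝ)..2 * Real.pi, f θ
  map_add' f g := intervalIntegral.integral_add (f.continuous.intervalIntegrable _ _)
    (g.continuous.intervalIntegrable _ _)
  map_smul' r f := intervalIntegral.integral_const_mul r _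
  cont := continuous_iff_continuousAt.2 fun f => by
    have := (Filter.tendsto_id (α := SmoothFun) (x := 𝓝 f)).uniform_smoothFun
    rw [Metric.tendstoUniformly_iff] at this
    refine Metric.tendsto_nhds.2 fun ε hε => ?_
    have hp := Real.pi_pos
    -- The interval has length 2π; the extra 1 makes the final inequality strict.
    filter_upwards [this (ε / (2 * Real.pi + 1)) (by positivity)] with g hg
    rw [dist_eq_norm, ← intervalIntegral.integral_sub (g.continuous.intervalIntegrable _ _)
      (f.continuous.intervalIntegrable _ _)]
    refine (intervalIntegral.norm_integral_le_of_norm_le_const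
      (C := ε / (2 * Real.pi + 1)) fun θ _ => ?_).trans_lt ?_
    · rw [← dist_eq_norm, dist_comm]
      exact (hg θ).le
    · rw [sub_zero, abs_of_pos Real.two_pi_pos, div_mul_eq_mul_div, div_lt_iff₀ (by positivity)]
      nlinarith

theorem integral_def (f : SmoothFun) : integral f = ∫ θ in (0 : ℝ)..2 * Real.pi, f θ := rfl

theorem integral_D (f : SmoothFun) : integral (D f) = 0 := by
  rw [integral_def, intervalIntegral.integral_eq_sub_of_hasDerivAt (fun θ _ => f.hasDerivAt θ)
    ((D f).continuous.intervalIntegrable _ _)]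
  have := f.periodic 0
  rw [zero_add] at this
  rw [this, sub_self]

theorem integral_pos {f : SmoothFun} (hf : ∀ θ, 0 < f θ) : 0 < integral f :=
  intervalIntegral.intervalIntegral_pos_of_pos (f.continuous.intervalIntegrable _ _) hf
    Real.two_pi_pos

theorem eq_zero_of_integral_eq_zero {f : SmoothFun} (hf : ∀ θ, 0 ≤ f θ) (h : integral f = 0) :
    f = 0 := by
  by_contra hne
  obtain ⟨x, hx⟩ : ∃ x, f x ≠ 0 := by
    by_contra! hc
    exact hne (ext hc)
  -- Periodicity moves the point where f does not vanish into the interval of integration.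
  obtain ⟨y, hy, hxy⟩ := f.periodic.exists_mem_Ico₀ Real.two_pi_pos x
  rw [hxy] at hx
  have := intervalIntegral.integral_pos Real.two_pi_pos f.continuous.continuousOn
    (fun z _ => hf z) ⟨y, ⟨hy.1, hy.2.le⟩, (hf y).lt_of_ne' hx⟩
  rw [integral_def] at h
  linarith

end SmoothFun

/-! ### Differentiable and smooth curves in topological vector spaces -/

section Calculus

variable {E F : Type*} [AddCommGroup E] [Module ℝ E] [TopologicalSpace E]
  [AddCommGroup F] [Module ℝ F] [TopologicalSpace F]

theorem HasCurveDeriv.unique [T2Space E] {c : ℝ → E} {h k : E} {t : ℝ} (hh : HasCurveDeriv c h t)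
    (hk : HasCurveDeriv c k t) : h = k := tendsto_nhds_unique hh hk

theorem HasCurveDeriv.clm {c : ℝ → E} {h : E} {t : ℝ} (hc : HasCurveDeriv c h t) (L : E →ₗ[ℝ] F)
    (hL : Continuous L) : HasCurveDeriv (fun t => L (c t)) (L h) t := by
  refine (hL.continuousAt.tendsto.comp hc).congr fun s => ?_
  simp

/-- c(t + s) is s times the difference quotient plus c(t), and the first summand tends to 0 • h. -/
theorem HasCurveDeriv.tendsto [IsTopologicalAddGroup E] [ContinuousSMul ℝ E] {c : ℝ → E} {h : E}
    {t : ℝ} (hc : HasCurveDeriv c h t) :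
    Filter.Tendsto (fun s => c (t + s)) (𝓝[≠] 0) (𝓝 (c t)) := by
  have h1 : Filter.Tendsto (fun s : ℝ => s • (s⁻¹ • (c (t + s) - c t)) + c t) (𝓝[≠] 0)
      (𝓝 ((0 : ℝ) • h + c t)) :=
    ((Filter.tendsto_id.mono_left nhdsWithin_le_nhds).smul hc).add tendsto_const_nhds
  rw [zero_smul, zero_add] at h1
  refine h1.congr' ?_
  filter_upwards [self_mem_nhdsWithin] with s hs
  rw [smul_inv_smul₀ hs, sub_add_cancel]

theorem HasCurveDeriv.continuousAt [IsTopologicalAddGroup E] [ContinuousSMul ℝ E] {c : ℝ → E}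
    {h : E} {t : ℝ} (hc : HasCurveDeriv c h t) : ContinuousAt c t := by
  have h2 : Filter.Tendsto (fun s => c (t + s)) (𝓝 0) (𝓝 (c t)) := by
    rw [← nhdsNE_sup_pure, Filter.tendsto_sup]
    refine ⟨hc.tendsto, ?_⟩
    rw [Filter.tendsto_pure_left]
    intro s hs
    rw [add_zero]
    exact mem_of_mem_nhds hs
  have h3 : Filter.Tendsto (fun s : ℝ => s - t) (𝓝 t) (𝓝 0) := by
    have : Filter.Tendsto (fun s : ℝ => s - t) (𝓝 t) (𝓝 (t - t)) :=
      (continuous_id.sub continuous_const).tendsto t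
    rwa [sub_self] at this
  refine (h2.comp h3).congr fun s => ?_
  simp

theorem HasCurveDeriv.prodMk {c : ℝ → E} {d : ℝ → F} {h : E} {k : F} {t : ℝ}
    (hc : HasCurveDeriv c h t) (hd : HasCurveDeriv d k t) :
    HasCurveDeriv (fun t => (c t, d t)) (h, k) t :=
  Filter.Tendsto.prodMk_nhds hc hd

theorem HasCurveDeriv.fst {c : ℝ → E × F} {h : E × F} {t : ℝ} (hc : HasCurveDeriv c h t) :
    HasCurveDeriv (fun t => (c t).1) h.1 t :=
  hc.clm (LinearMap.fst ℝ E F) continuous_fst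

theorem HasCurveDeriv.snd {c : ℝ → E × F} {h : E × F} {t : ℝ} (hc : HasCurveDeriv c h t) :
    HasCurveDeriv (fun t => (c t).2) h.2 t :=
  hc.clm (LinearMap.snd ℝ E F) continuous_snd

theorem HasCurveDeriv.add [ContinuousAdd E] {c d : ℝ → E} {h k : E} {t : ℝ}
    (hc : HasCurveDeriv c h t) (hd : HasCurveDeriv d k t) :
    HasCurveDeriv (fun t => c t + d t) (h + k) t := by
  refine (Filter.Tendsto.add hc hd).congr fun s => ?_
  rw [← smul_add]
  congr 1
  rw [add_sub_add_comm]

theorem hasCurveDeriv_real {c : ℝ → ℝ} {h t : ℝ} : HasCurveDeriv c h t ↔ HasDerivAt c h t :=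
  hasDerivAt_iff_tendsto_slope_zero.symm

theorem IsSmoothCurve.clm {c : ℝ → E} (hc : IsSmoothCurve c) (L : E →ₗ[ℝ] F)
    (hL : Continuous L) : IsSmoothCurve (fun t => L (c t)) := by
  obtain ⟨C, rfl, h⟩ := hc
  exact ⟨fun n t => L (C n t), rfl, fun n t => (h n t).clm L hL⟩

theorem IsSmoothCurve.fst {c : ℝ → E × F} (hc : IsSmoothCurve c) :
    IsSmoothCurve (fun t => (c t).1) := hc.clm (LinearMap.fst ℝ E F) continuous_fst

theorem IsSmoothCurve.snd {c : ℝ → E × F} (hc : IsSmoothCurve c) :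
    IsSmoothCurve (fun t => (c t).2) := hc.clm (LinearMap.snd ℝ E F) continuous_snd

theorem IsSmoothCurve.prodMk {c : ℝ → E} {d : ℝ → F} (hc : IsSmoothCurve c)
    (hd : IsSmoothCurve d) : IsSmoothCurve (fun t => (c t, d t)) := by
  obtain ⟨C, rfl, h⟩ := hc
  obtain ⟨C', rfl, h'⟩ := hd
  exact ⟨fun n t => (C n t, C' n t), rfl, fun n t => (h n t).prodMk (h' n t)⟩

theorem IsSmoothCurve.hasCurveDeriv {c : ℝ → E} (hc : IsSmoothCurve c) (t : ℝ) :
    ∃ h, HasCurveDeriv c h t := by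
  obtain ⟨C, rfl, h⟩ := hc
  exact ⟨_, h 0 t⟩

/-- A curve in a topological vector space with `n` continuous derivatives. -/
def CurveDiff : ℕ → (ℝ → E) → Prop
  | 0, c => Continuous c
  | n + 1, c => ∃ c' : ℝ → E, (∀ t, HasCurveDeriv c (c' t) t) ∧ CurveDiff n c'

theorem IsSmoothCurve.curveDiff [IsTopologicalAddGroup E] [ContinuousSMul ℝ E] {c : ℝ → E}
    (hc : IsSmoothCurve c) (n : ℕ) : CurveDiff n c := by
  obtain ⟨C, rfl, h⟩ := hc
  suffices ∀ k, CurveDiff n (C k) from this 0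
  induction n with
  | zero => exact fun k => continuous_iff_continuousAt.2 fun t => (h k t).continuousAt
  | succ n ih => exact fun k => ⟨C (k + 1), h k, ih (k + 1)⟩

/-- For each order a different derivative might be supplied, but limits in a Hausdorff space are
unique, so the first derivative again has all orders. Iterating this choice produces the tower of
derivatives. -/
theorem isSmoothCurve_of_curveDiff [T2Space E] {c : ℝ → E} (hc : ∀ n, CurveDiff n c) :
    IsSmoothCurve c := by
  have step : ∀ d : {d : ℝ → E // ∀ n, CurveDiff n d}, ∃ d' : {d : ℝ → E // ∀ n, CurveDiff n d},
      ∀ t, HasCurveDeriv d.1 (d'.1 t) t := by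
    rintro ⟨d, hd⟩
    obtain ⟨d', h', -⟩ := hd 1
    refine ⟨⟨d', fun n => ?_⟩, h'⟩
    obtain ⟨e, he, hen⟩ := hd (n + 1)
    rwa [show d' = e from funext fun t => (h' t).unique (he t)]
  choose S hS using step
  refine ⟨fun n => (S^[n] ⟨c, hc⟩).1, rfl, fun n t => ?_⟩
  simp only [Function.iterate_succ_apply']
  exact hS _ t

theorem CurveDiff.of_succ [IsTopologicalAddGroup E] [ContinuousSMul ℝ E] {n : ℕ} {c : ℝ → E}
    (hc : CurveDiff (n + 1) c) : CurveDiff n c := by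
  induction n generalizing c with
  | zero =>
    obtain ⟨c', h, -⟩ := hc
    exact continuous_iff_continuousAt.2 fun t => (h t).continuousAt
  | succ n ih =>
    obtain ⟨c', h, h'⟩ := hc
    exact ⟨c', h, ih h'⟩

theorem CurveDiff.add [ContinuousAdd E] {n : ℕ} {c d : ℝ → E}
    (hc : CurveDiff n c) (hd : CurveDiff n d) : CurveDiff n (fun t => c t + d t) := by
  induction n generalizing c d with
  | zero => exact Continuous.add hc hd
  | succ n ih =>
    obtain ⟨c', h, h'⟩ := hc
    obtain ⟨d', k, k'⟩ := hd
    exact ⟨_, fun t => (h t).add (k t), ih h' k'⟩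

theorem CurveDiff.clm {n : ℕ} {c : ℝ → E} (hc : CurveDiff n c) (L : E →ₗ[ℝ] F)
    (hL : Continuous L) : CurveDiff n (fun t => L (c t)) := by
  induction n generalizing c with
  | zero => exact hL.comp hc
  | succ n ih =>
    obtain ⟨c', h, h'⟩ := hc
    exact ⟨_, fun t => (h t).clm L hL, ih h'⟩

theorem CurveDiff.neg [IsTopologicalAddGroup E] {n : ℕ} {c : ℝ → E}
    (hc : CurveDiff n c) : CurveDiff n (fun t => -c t) :=
  hc.clm (-LinearMap.id) continuous_neg

theorem CurveDiff.sub [IsTopologicalAddGroup E] {n : ℕ} {c d : ℝ → E}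
    (hc : CurveDiff n c) (hd : CurveDiff n d) : CurveDiff n (fun t => c t - d t) := by
  simpa only [sub_eq_add_neg] using hc.add hd.neg

theorem isSmoothCurve_real {c : ℝ → ℝ} : IsSmoothCurve c ↔ ContDiff ℝ ∞ c := by
  constructor
  · rintro ⟨C, rfl, h⟩
    rw [contDiff_infty]
    intro n
    suffices ∀ k, ContDiff ℝ n (C k) from this 0
    simp only [hasCurveDeriv_real] at h
    induction n with
    | zero =>
      exact fun k => contDiff_zero.2
        (continuous_iff_continuousAt.2 fun t => (h k t).continuousAt)
    | succ n ih =>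
      intro k
      push_cast
      refine contDiff_succ_iff_deriv.2 ⟨fun t => (h k t).differentiableAt, by simp, ?_⟩
      rw [show deriv (C k) = C (k + 1) from funext fun t => (h k t).deriv]
      exact ih _
  · intro hc
    refine ⟨fun n => iteratedDeriv n c, iteratedDeriv_zero, fun n t => ?_⟩
    simp only [hasCurveDeriv_real, iteratedDeriv_succ]
    exact (hc.differentiable_iteratedDeriv n (by exact_mod_cast WithTop.coe_lt_top _) t).hasDerivAt

end Calculus

/-! ### Products of differentiable curves of functions -/

namespace SmoothFun

theorem hasCurveDeriv_mul {c d : ℝ → SmoothFun} {h k : SmoothFun} {t : ℝ}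
    (hc : HasCurveDeriv c h t) (hd : HasCurveDeriv d k t) :
    HasCurveDeriv (fun t => c t * d t) (h * d t + c t * k) t := by
  have h1 : Filter.Tendsto (fun s => (s⁻¹ • (c (t + s) - c t)) * d (t + s) +
      c t * (s⁻¹ • (d (t + s) - d t))) (𝓝[≠] 0) (𝓝 (h * d t + c t * k)) :=
    (Filter.Tendsto.mul hc hd.tendsto).add (tendsto_const_nhds.mul hd)
  refine h1.congr fun s => ?_
  rw [smul_mul_assoc, mul_smul_comm, ← smul_add]
  congr 1
  ring

theorem curveDiff_mul {n : ℕ} {c d : ℝ → SmoothFun} (hc : CurveDiff n c) (hd : CurveDiff n d) :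
    CurveDiff n (fun t => c t * d t) := by
  induction n generalizing c d with
  | zero => exact Continuous.mul hc hd
  | succ n ih =>
    have hc0 := hc.of_succ
    have hd0 := hd.of_succ
    obtain ⟨c', h, h'⟩ := hc
    obtain ⟨d', k, k'⟩ := hd
    exact ⟨_, fun t => hasCurveDeriv_mul (h t) (k t), (ih h' hd0).add (ih hc0 k')⟩

/-! ### The exponential law -/

/-- A function of two variables that is periodic in the second one. -/
def Periodic₂ (f : ℝ × ℝ → ℝ) : Prop := ∀ t θ, f (t, θ + 2 * Real.pi) = f (t, θ)

/-- Joint continuity gives uniformity over the compact period interval, and periodicity carries it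
to the whole line. -/
theorem tendstoUniformly_of_periodic₂ {g : ℝ × ℝ → ℝ} (hg : Continuous g) (hp : Periodic₂ g)
    (t : ℝ) : TendstoUniformly (fun s θ => g (s, θ)) (fun θ => g (t, θ)) (𝓝 t) := by
  have hK : CompactSpace (Set.Icc 0 (2 * Real.pi)) := isCompact_iff_compactSpace.1 isCompact_Icc
  have := Continuous.tendstoUniformly
    (fun (s : ℝ) (θ : Set.Icc 0 (2 * Real.pi)) => g (s, (θ : ℝ))) (by fun_prop) t
  rw [Metric.tendstoUniformly_iff] at *
  intro ε hε
  filter_upwards [this ε hε] with s hs θ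
  -- Pairing the two functions lets one representative y of θ serve for both values.
  have hq : Function.Periodic (fun θ => (g (t, θ), g (s, θ))) (2 * Real.pi) := fun x => by
    simp only [hp _ x]
  obtain ⟨y, hy, hxy⟩ := hq.exists_mem_Ico₀ Real.two_pi_pos θ
  have h1 := congrArg Prod.fst hxy
  have h2 := congrArg Prod.snd hxy
  simp only at h1 h2
  rw [h1, h2]
  exact hs ⟨y, hy.1, hy.2.le⟩

/-- The curve `t ↦ f (t, ·)` of periodic functions. -/
def slice (f : ℝ × ℝ → ℝ) (hf : ContDiff ℝ ∞ f) (hp : Periodic₂ f) (t : ℝ) : SmoothFun :=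
  mk (fun θ => f (t, θ)) (hf.comp (contDiff_const.prodMk contDiff_id)) (hp t)

theorem contDiff_fderiv_apply {f : ℝ × ℝ → ℝ} (hf : ContDiff ℝ ∞ f) (v : ℝ × ℝ) :
    ContDiff ℝ ∞ (fun p => fderiv ℝ f p v) :=
  (contDiff_infty_iff_fderiv.1 hf).2.clm_apply contDiff_const

theorem periodic₂_fderiv {f : ℝ × ℝ → ℝ} (hp : Periodic₂ f) (v : ℝ × ℝ) :
    Periodic₂ (fun p => fderiv ℝ f p v) := fun t θ => by
  have h : (fun p : ℝ × ℝ => f (p + (0, 2 * Real.pi))) = f := by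
    funext p
    rw [show p + (0, 2 * Real.pi) = (p.1, p.2 + 2 * Real.pi) by ext <;> simp]
    exact hp p.1 p.2
  have := fderiv_comp_add_right (𝕜 := ℝ) (f := f) (x := (t, θ)) (0, 2 * Real.pi)
  rw [h] at this
  simp only [this]
  simp

theorem hasDerivAt_fst {f : ℝ × ℝ → ℝ} (hf : ContDiff ℝ ∞ f) (t θ : ℝ) :
    HasDerivAt (fun t => f (t, θ)) (fderiv ℝ f (t, θ) (1, 0)) t := by
  have h := (hf.differentiable (by simp) (t, θ)).hasFDerivAt
  exact h.comp_hasDerivAt t ((hasDerivAt_id t).prodMk (hasDerivAt_const t θ))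

theorem hasDerivAt_snd {f : ℝ × ℝ → ℝ} (hf : ContDiff ℝ ∞ f) (t θ : ℝ) :
    HasDerivAt (fun θ => f (t, θ)) (fderiv ℝ f (t, θ) (0, 1)) θ := by
  have h := (hf.differentiable (by simp) (t, θ)).hasFDerivAt
  exact h.comp_hasDerivAt θ ((hasDerivAt_const θ t).prodMk (hasDerivAt_id θ))

/-- Symmetry of the second derivative; it makes the time derivative of a slice commute with `D`. -/
theorem fderiv_fderiv_comm {f : ℝ × ℝ → ℝ} (hf : ContDiff ℝ ∞ f) (p v w : ℝ × ℝ) :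
    fderiv ℝ (fun p => fderiv ℝ f p v) p w = fderiv ℝ (fun p => fderiv ℝ f p w) p v := by
  have h1 := contDiff_infty_iff_fderiv.1 hf
  have h2 := (h1.2.differentiable (by simp) p).hasFDerivAt
  have e : ∀ v w, fderiv ℝ (fun p => fderiv ℝ f p v) p w = fderiv ℝ (fderiv ℝ f) p w v := by
    intro v w
    rw [(h2.clm_apply (hasFDerivAt_const v p)).fderiv]
    simp
  rw [e, e]
  exact second_derivative_symmetric (fun y => (h1.1 y).hasFDerivAt) h2 w v

theorem D_slice (f : ℝ × ℝ → ℝ) (hf : ContDiff ℝ ∞ f) (hp : Periodic₂ f) (t : ℝ) :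
    D (slice f hf hp t) = slice (fun p => fderiv ℝ f p (0, 1)) (contDiff_fderiv_apply hf _)
      (periodic₂_fderiv hp _) t :=
  D_eq fun θ => hasDerivAt_snd hf t θ

/-- The mean value inequality for x ↦ f(x, θ) - xL on a ball where the time derivative stays within
ε/2 of its value L at t; the radius of that ball does not depend on θ. -/
theorem tendstoUniformly_slope (f : ℝ × ℝ → ℝ) (hf : ContDiff ℝ ∞ f) (hp : Periodic₂ f) (t : ℝ) :
    TendstoUniformly (fun (s : ℝ) θ => s⁻¹ * (f (t + s, θ) - f (t, θ)))
      (fun θ => fderiv ℝ f (t, θ) (1, 0)) (𝓝[≠] 0) := by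
  have h := tendstoUniformly_of_periodic₂ (contDiff_fderiv_apply hf (1, 0)).continuous
    (periodic₂_fderiv hp _) t
  rw [Metric.tendstoUniformly_iff] at *
  intro ε hε
  obtain ⟨δ, hδ, hball⟩ := Metric.eventually_nhds_iff_ball.1 (h (ε / 2) (by positivity))
  filter_upwards [self_mem_nhdsWithin, nhdsWithin_le_nhds (Metric.ball_mem_nhds (0 : ℝ) hδ)]
    with s hs0 hs θ
  set L := fderiv ℝ f (t, θ) (1, 0) with hL
  have hd : ∀ x ∈ Metric.ball t δ, HasDerivWithinAt (fun x => f (x, θ) - x * L)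
      (fderiv ℝ f (x, θ) (1, 0) - 1 * L) (Metric.ball t δ) x := fun x _ =>
    ((hasDerivAt_fst hf x θ).sub ((hasDerivAt_id x).mul_const L)).hasDerivWithinAt
  have hb : ∀ x ∈ Metric.ball t δ, ‖fderiv ℝ f (x, θ) (1, 0) - 1 * L‖ ≤ ε / 2 := fun x hx => by
    have := hball x hx θ
    rw [dist_comm, dist_eq_norm] at this
    rw [one_mul]
    exact this.le
  have hmem : t + s ∈ Metric.ball t δ := by simpa using hs
  have := Convex.norm_image_sub_le_of_norm_hasDerivWithin_le hd hb (convex_ball t δ)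
    (Metric.mem_ball_self hδ) hmem
  have hs0 : s ≠ 0 := hs0
  have e : L - s⁻¹ * (f (t + s, θ) - f (t, θ)) =
      -s⁻¹ * (f (t + s, θ) - (t + s) * L - (f (t, θ) - t * L)) := by
    field_simp
    ring
  rw [Real.dist_eq, e, abs_mul, abs_neg, abs_inv]
  rw [add_sub_cancel_left, Real.norm_eq_abs, Real.norm_eq_abs] at this
  have hpos : 0 < |s| := abs_pos.2 hs0
  calc _ ≤ |s|⁻¹ * (ε / 2 * |s|) := by gcongr
    _ = ε / 2 := by field_simp
    _ < ε := by linarith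

/-- Induction on the number of θ-derivatives: `D` of a slice is the slice of the θ-derivative, again
a smooth periodic function, and mixed partial derivatives agree. -/
theorem hasCurveDeriv_slice (f : ℝ × ℝ → ℝ) (hf : ContDiff ℝ ∞ f) (hp : Periodic₂ f) (t : ℝ) :
    HasCurveDeriv (slice f hf hp) (slice (fun p => fderiv ℝ f p (1, 0))
      (contDiff_fderiv_apply hf _) (periodic₂_fderiv hp _) t) t := by
  refine tendsto_iff_upTo.2 fun k => ?_
  induction k generalizing f with
  | zero =>
    rw [tendstoUpTo_zero]
    exact tendstoUniformly_slope f hf hp t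
  | succ k ih =>
    rw [tendstoUpTo_succ]
    refine ⟨tendstoUniformly_slope f hf hp t, ?_⟩
    have := ih (fun p => fderiv ℝ f p (0, 1)) (contDiff_fderiv_apply hf _) (periodic₂_fderiv hp _)
    simp only [map_smul, map_sub, D_slice]
    convert this using 3
    exact fderiv_fderiv_comm hf _ _ _

theorem isSmoothCurve_slice (f : ℝ × ℝ → ℝ) (hf : ContDiff ℝ ∞ f) (hp : Periodic₂ f) :
    IsSmoothCurve (slice f hf hp) := by
  let S : {f : ℝ × ℝ → ℝ // ContDiff ℝ ∞ f ∧ Periodic₂ f} →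
      {f : ℝ × ℝ → ℝ // ContDiff ℝ ∞ f ∧ Periodic₂ f} := fun g =>
    ⟨fun p => fderiv ℝ g.1 p (1, 0), contDiff_fderiv_apply g.2.1 _, periodic₂_fderiv g.2.2 _⟩
  let g : ℕ → {f : ℝ × ℝ → ℝ // ContDiff ℝ ∞ f ∧ Periodic₂ f} := fun n => S^[n] ⟨f, hf, hp⟩
  have hg : ∀ n, g (n + 1) = S (g n) := fun n => Function.iterate_succ_apply' _ _ _
  refine ⟨fun n => slice (g n).1 (g n).2.1 (g n).2.2, rfl, fun n t => ?_⟩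
  simp only [hg]
  exact hasCurveDeriv_slice _ _ _ t

theorem continuous_uncurry_of_continuous {c : ℝ → SmoothFun} (hc : Continuous c) :
    Continuous (fun p : ℝ × ℝ => c p.1 p.2) := by
  rw [continuous_iff_continuousAt]
  rintro ⟨t, θ⟩
  have h := (hc.tendsto t).uniform_smoothFun
  rw [Metric.tendstoUniformly_iff] at h
  rw [Metric.continuousAt_iff']
  intro ε hε
  have h1 := (continuous_fst (X := ℝ) (Y := ℝ)).tendsto (t, θ) |>.eventually (h (ε / 2) (by positivity))
  have h2 := (((c t).continuous.comp continuous_snd).tendsto (t, θ)).eventually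
    (Metric.ball_mem_nhds _ (half_pos hε))
  filter_upwards [h1, h2] with p hp1 hp2
  have := hp1 p.2
  rw [dist_comm] at this
  have h3 : dist (c t p.2) (c t θ) < ε / 2 := hp2
  linarith [dist_triangle (c p.1 p.2) (c t p.2) (c t θ)]

/-- The exponential law: smooth curves of functions are smooth functions of two variables. -/
theorem isSmoothCurve_iff {c : ℝ → SmoothFun} :
    IsSmoothCurve c ↔ ContDiff ℝ ∞ (fun p : ℝ × ℝ => c p.1 p.2) := by
  constructor
  · rintro ⟨C, rfl, h⟩
    rw [contDiff_infty]
    -- These are the mixed partials, n times in t and m times in θ. The induction below treats all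
    -- of them together, since each differentiation raises n or m.
    have hC : ∀ n m, Continuous (fun p : ℝ × ℝ => (D^[m] (C n p.1)) p.2) := fun n m =>
      continuous_uncurry_of_continuous (c := fun t => D^[m] (C n t))
        ((continuous_D.iterate m).comp
          (continuous_iff_continuousAt.2 fun t => (h n t).continuousAt))
    suffices ∀ k : ℕ, ∀ n m, ContDiff ℝ k (fun p : ℝ × ℝ => (D^[m] (C n p.1)) p.2) from
      fun k => this k 0 0
    intro k
    induction k with
    | zero => exact fun n m => contDiff_zero.2 (hC n m)
    | succ k ih =>
      intro n m
      let L : ℝ → ℝ →L[ℝ] ℝ := ContinuousLinearMap.toSpanSingleton ℝ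
      have hL : ContDiff ℝ k L := by
        have : L = ContinuousLinearMap.toSpanSingletonCLE (𝕜 := ℝ) (E := ℝ) := by
          funext r; rfl
        rw [this]
        exact ContinuousLinearEquiv.contDiff _
      have hLc : Continuous L := hL.continuous
      refine contDiff_succ_iff_hasFDerivAt.2
        ⟨fun p => (L ((D^[m] (C (n + 1) p.1)) p.2)).coprod (L ((D^[m + 1] (C n p.1)) p.2)), ?_, ?_⟩
      · have h1 := hL.comp (ih (n + 1) m)
        have h2 := hL.comp (ih n (m + 1))
        have e : ∀ A B : ℝ →L[ℝ] ℝ, A.coprod B =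
            A.comp (ContinuousLinearMap.fst ℝ ℝ ℝ) + B.comp (ContinuousLinearMap.snd ℝ ℝ ℝ) := by
          intro A B
          ext <;> simp
        simp only [e]
        exact (h1.clm_comp contDiff_const).add (h2.clm_comp contDiff_const)
      · intro p
        -- Two continuous partial derivatives assemble to a total derivative.
        have := hasStrictFDerivAt_uncurry_coprod (𝕜 := ℝ) (u := p)
          (f := fun t θ => (D^[m] (C n t)) θ)
          (f₁ := fun t θ => L ((D^[m] (C (n + 1) t)) θ))
          (f₂ := fun t θ => L ((D^[m + 1] (C n t)) θ))
          (Filter.Eventually.of_forall fun v => ?_) (Filter.Eventually.of_forall fun v => ?_)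
          (hLc.comp (hC (n + 1) m)).continuousAt (hLc.comp (hC n (m + 1))).continuousAt
        · exact this.hasFDerivAt
        · have h1 := (h n v.1).clm (eval v.2 ∘ₗ (D ^ m) : SmoothFun →ₗ[ℝ] ℝ)
            ((eval v.2).continuous.comp (by
              rw [Module.End.coe_pow]
              exact continuous_D.iterate m))
          rw [hasCurveDeriv_real] at h1
          simp only [LinearMap.comp_apply, Module.End.coe_pow] at h1
          exact h1.hasFDerivAt
        · have h1 := (D^[m] (C n v.1)).hasDerivAt v.2
          simp only [Function.iterate_succ_apply']
          exact h1.hasFDerivAt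
  · intro h
    exact isSmoothCurve_slice _ h fun t θ => (c t).periodic θ

end SmoothFun

namespace SmoothFun

/-! ### The elliptic operator: uniqueness and estimates -/

/-- The elliptic operator `u ↦ m u - (a u')'` on the circle. -/
def ellOp (m a : SmoothFun) : SmoothFun →ₗ[ℝ] SmoothFun where
  toFun u := m * u - D (a * D u)
  map_add' u v := by
    rw [map_add, mul_add, mul_add, map_add]
    ring
  map_smul' r u := by
    rw [map_smul, mul_smul_comm, mul_smul_comm, map_smul, RingHom.id_apply, smul_sub]

theorem ellOp_apply (m a u : SmoothFun) : ellOp m a u = m * u - D (a * D u) := rfl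

theorem exists_forall_le_of_periodic {f : ℝ → ℝ} (hf : Continuous f)
    (hp : Function.Periodic f (2 * Real.pi)) : ∃ x, ∀ y, f y ≤ f x := by
  obtain ⟨M, ⟨x, rfl⟩, hM⟩ := (hp.compact_of_continuous Real.two_pi_pos.ne' hf).exists_isGreatest
    (Set.range_nonempty f)
  exact ⟨x, fun y => hM ⟨y, rfl⟩⟩

theorem exists_isMax (u : SmoothFun) : ∃ x, (∀ y, u y ≤ u x) ∧ D u x = 0 := by
  obtain ⟨x, hx⟩ := exists_forall_le_of_periodic u.continuous u.periodic
  have : IsLocalMax (u : ℝ → ℝ) x := Filter.Eventually.of_forall hx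
  exact ⟨x, hx, this.deriv_eq_zero⟩

theorem exists_lower_bound {f : SmoothFun} (hf : ∀ θ, 0 < f θ) : ∃ c, 0 < c ∧ ∀ θ, c ≤ f θ := by
  obtain ⟨x, hx, -⟩ := exists_isMax (-f)
  exact ⟨f x, hf x, fun θ => neg_le_neg_iff.1 (hx θ)⟩

/-- A positive second derivative would make x a local minimum too; then u is constant near x and its
second derivative vanishes there. -/
theorem D_D_nonpos_of_isMax {u : SmoothFun} {x : ℝ} (hx : ∀ y, u y ≤ u x) : D (D u) x ≤ 0 := by
  by_contra! h
  have hmax : IsLocalMax (u : ℝ → ℝ) x := Filter.Eventually.of_forall hx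
  have hmin : IsLocalMin (u : ℝ → ℝ) x :=
    isLocalMin_of_deriv_deriv_pos h hmax.deriv_eq_zero u.continuous.continuousAt
  have e : (u : ℝ → ℝ) =ᶠ[𝓝 x] fun _ => u x := by
    filter_upwards [hmin] with y hy
    exact le_antisymm (hx y) hy
  have e1 : deriv (u : ℝ → ℝ) =ᶠ[𝓝 x] deriv fun _ => u x := e.deriv
  have e2 := e1.deriv_eq
  have e3 : deriv (fun _ : ℝ => u x) = fun _ => 0 := deriv_const' _
  rw [e3, deriv_const] at e2
  rw [D_apply, coe_D, e2] at h
  exact lt_irrefl _ h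

/-- Maximum principle: where u is largest, u' = 0 and (au')' = au'' ≤ 0, so mu is bounded there by
the value of the operator. -/
theorem le_of_ellOp_le {m a u : SmoothFun} {c C : ℝ} (hc : 0 < c) (hm : ∀ θ, c ≤ m θ)
    (ha : ∀ θ, 0 < a θ) (hC : 0 ≤ C) (h : ∀ θ, ellOp m a u θ ≤ C) (θ : ℝ) : u θ ≤ C / c := by
  obtain ⟨x, hx, hx0⟩ := exists_isMax u
  refine (hx θ).trans ?_
  have h1 := D_D_nonpos_of_isMax hx
  have h2 := h x
  rw [ellOp_apply, D_mul, sub_apply, add_apply, mul_apply, mul_apply, mul_apply, hx0, mul_zero,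
    zero_add] at h2
  have h3 := mul_nonpos_of_nonneg_of_nonpos (ha x).le h1
  by_contra! h4
  rw [div_lt_iff₀ hc] at h4
  have h5 : 0 < u x := pos_of_mul_pos_left (hC.trans_lt h4) hc.le
  have h6 := mul_le_mul_of_nonneg_right (hm x) h5.le
  linarith

theorem abs_le_of_abs_ellOp_le {m a u : SmoothFun} {c C : ℝ} (hc : 0 < c) (hm : ∀ θ, c ≤ m θ)
    (ha : ∀ θ, 0 < a θ) (h : ∀ θ, |ellOp m a u θ| ≤ C) (θ : ℝ) : |u θ| ≤ C / c := by
  have hC : 0 ≤ C := (abs_nonneg _).trans (h 0)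
  refine abs_le'.2 ⟨le_of_ellOp_le hc hm ha hC (fun θ => (le_abs_self _).trans (h θ)) θ, ?_⟩
  refine le_of_ellOp_le (u := -u) hc hm ha hC (fun θ => ?_) θ
  rw [map_neg, neg_apply]
  exact (neg_le_abs _).trans (h θ)

theorem eq_zero_of_ellOp_eq_zero {m a u : SmoothFun} (hm : ∀ θ, 0 < m θ) (ha : ∀ θ, 0 < a θ)
    (h : ellOp m a u = 0) : u = 0 := by
  obtain ⟨c, hc, hcm⟩ := exists_lower_bound hm
  ext θ
  have := abs_le_of_abs_ellOp_le (u := u) (C := 0) hc hcm ha (fun θ => by simp [h]) θ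
  rw [zero_div] at this
  exact abs_nonpos_iff.1 this

/-- By periodicity every value of v is attained within one period after the zero x, so the mean
value inequality costs at most a factor 2π. -/
theorem abs_le_of_abs_D_le {v : SmoothFun} {x C : ℝ} (hx : v x = 0) (h : ∀ θ, |D v θ| ≤ C)
    (θ : ℝ) : |v θ| ≤ 2 * Real.pi * C := by
  obtain ⟨y, hy, hxy⟩ := v.periodic.exists_mem_Ico Real.two_pi_pos θ x
  rw [hxy]
  have := Convex.norm_image_sub_le_of_norm_hasDerivWithin_le
    (fun z _ => (v.hasDerivAt z).hasDerivWithinAt) (fun z _ => h z) convex_univ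
    (Set.mem_univ x) (Set.mem_univ y)
  rw [hx, sub_zero, Real.norm_eq_abs, Real.norm_eq_abs, abs_of_nonneg (sub_nonneg.2 hy.1)] at this
  have hC : 0 ≤ C := (abs_nonneg _).trans (h 0)
  nlinarith [hy.2]

section Convergence

variable {ι : Type*} {l : Filter ι} {M A R W : ι → SmoothFun} {m r : SmoothFun}

/-- Eventually Mᵢ ≥ c/2, so the maximum principle makes Wᵢ small. The flux AᵢWᵢ' has the small
derivative MᵢWᵢ - `ellOp` and a zero, hence is small as well. Of the Aᵢ only positivity is needed.
-/
theorem tendstoUniformly_of_ellOp (hM : Filter.Tendsto M l (𝓝 m)) (hm : ∀ θ, 0 < m θ)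
    (hA : ∀ i θ, 0 < A i θ)
    (hF : Filter.Tendsto (fun i => ellOp (M i) (A i) (W i)) l (𝓝 0)) :
    TendstoUniformly (fun i => W i) (0 : SmoothFun) l ∧
      TendstoUniformly (fun i => (A i * D (W i) : SmoothFun)) (0 : SmoothFun) l := by
  obtain ⟨c, hc, hcm⟩ := exists_lower_bound hm
  obtain ⟨K, hK, hmK⟩ := m.exists_bound
  have hM' := hM.uniform_smoothFun
  have hF' := hF.uniform_smoothFun
  rw [Metric.tendstoUniformly_iff] at hM' hF'
  have key : ∀ δ > 0, ∀ᶠ i in l, (∀ θ, |W i θ| ≤ δ / (c / 2)) ∧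
      ∀ θ, |(A i * D (W i)) θ| ≤ 2 * Real.pi * ((K + c / 2) * (δ / (c / 2)) + δ) := by
    intro δ hδ
    filter_upwards [hM' (c / 2) (by positivity), hF' δ hδ] with i hi hi'
    have h1 : ∀ θ, |ellOp (M i) (A i) (W i) θ| ≤ δ := fun θ => by
      have := hi' θ
      rw [Real.dist_eq, zero_apply, zero_sub, abs_neg] at this
      exact this.le
    have h2 : ∀ θ, c / 2 ≤ M i θ := fun θ => by
      have := (abs_lt.1 (hi θ)).2
      linarith [hcm θ]
    have h3 : ∀ θ, |M i θ| ≤ K + c / 2 := fun θ => by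
      have := hi θ
      rw [Real.dist_eq] at this
      have h5 := abs_sub_abs_le_abs_sub (M i θ) (m θ)
      rw [abs_sub_comm] at h5
      linarith [hmK θ]
    have h4 := abs_le_of_abs_ellOp_le (by positivity) h2 (hA i) h1
    refine ⟨h4, ?_⟩
    -- The flux vanishes at a maximum of Wᵢ, which provides the zero from which its derivative bound
    -- is integrated.
    obtain ⟨x, -, hx⟩ := exists_isMax (W i)
    refine abs_le_of_abs_D_le (x := x) (by rw [mul_apply, hx, mul_zero]) fun θ => ?_
    have e : D (A i * D (W i)) = M i * W i - ellOp (M i) (A i) (W i) := by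
      rw [ellOp_apply]
      ring
    rw [e, sub_apply, mul_apply]
    calc _ ≤ |M i θ| * |W i θ| + |ellOp (M i) (A i) (W i) θ| := by
          rw [← abs_mul]
          exact abs_sub _ _
      _ ≤ _ := add_le_add (mul_le_mul (h3 θ) (h4 θ) (abs_nonneg _) (by positivity)) (h1 θ)
  have hp := Real.pi_pos
  rw [Metric.tendstoUniformly_iff, Metric.tendstoUniformly_iff]
  constructor
  · intro ε hε
    filter_upwards [key (ε * (c / 2) / 2) (by positivity)] with i hi θ
    rw [Real.dist_eq, zero_apply, zero_sub, abs_neg]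
    refine (hi.1 θ).trans_lt ?_
    have : ε * (c / 2) / 2 / (c / 2) = ε / 2 := by field_simp
    linarith
  · intro ε hε
    -- The flux bound in `key` is linear in δ with coefficient Q, so δ = ε/(2Q) makes it ε/2.
    set Q := 2 * Real.pi * ((K + c / 2) * (1 / (c / 2)) + 1) with hQ
    have hQ0 : 0 < Q := by positivity
    filter_upwards [key (ε / Q / 2) (by positivity)] with i hi θ
    rw [Real.dist_eq, zero_apply, zero_sub, abs_neg]
    refine (hi.2 θ).trans_lt ?_
    have : 2 * Real.pi * ((K + c / 2) * (ε / Q / 2 / (c / 2)) + ε / Q / 2) = Q * (ε / Q / 2) := by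
      rw [hQ]
      ring
    rw [this]
    have : Q * (ε / Q / 2) = ε / 2 := by field_simp
    linarith

/-- Regularity by bootstrapping the first-order system W' = RV, V' = MW - `ellOp`, where V = AW' is
the flux and R = 1/A: convergence of W and V to order k gives order k + 1. Convergence of R enters
here. -/
theorem tendsto_zero_of_ellOp (hM : Filter.Tendsto M l (𝓝 m)) (hR : Filter.Tendsto R l (𝓝 r))
    (hAR : ∀ i, A i * R i = 1) (hm : ∀ θ, 0 < m θ) (hA : ∀ i θ, 0 < A i θ)
    (hF : Filter.Tendsto (fun i => ellOp (M i) (A i) (W i)) l (𝓝 0)) :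
    Filter.Tendsto W l (𝓝 0) := by
  obtain ⟨hW0, hV0⟩ := tendstoUniformly_of_ellOp hM hm hA hF
  set V : ι → SmoothFun := fun i => A i * D (W i) with hV
  have e1 : ∀ i, D (W i) = R i * V i := fun i => by
    rw [hV]
    linear_combination (-D (W i)) * hAR i
  have e2 : ∀ i, D (V i) = M i * W i + (-1 : SmoothFun) * ellOp (M i) (A i) (W i) := fun i => by
    rw [ellOp_apply]
    ring
  rw [tendsto_iff_upTo] at hM hR hF ⊢
  suffices ∀ k, TendstoUpTo k W l 0 ∧ TendstoUpTo k V l 0 from fun k => (this k).1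
  intro k
  induction k with
  | zero => exact ⟨tendstoUpTo_zero.2 hW0, tendstoUpTo_zero.2 hV0⟩
  | succ k ih =>
    refine ⟨(tendstoUpTo_succ k).2 ⟨hW0, ?_⟩, (tendstoUpTo_succ k).2 ⟨hV0, ?_⟩⟩
    · simpa only [e1, mul_zero, map_zero] using (hR k).mul ih.2
    · have h1 : TendstoUpTo k (fun _ : ι => (-1 : SmoothFun)) l (-1) :=
        tendsto_iff_upTo.1 tendsto_const_nhds k
      simpa only [e2, mul_zero, map_zero, add_zero] using ((hM k).mul ih.1).add (h1.mul (hF k))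

end Convergence

/-! ### The elliptic operator: existence -/

/-- Periodic solutions of the first order equation `y' = r (f - μ y)`. -/
theorem exists_firstOrder {r : SmoothFun} (hr : ∀ θ, 0 < r θ) {μ : ℝ} (hμ : μ ≠ 0) {f : ℝ → ℝ}
    (hf : Continuous f) (hp : Function.Periodic f (2 * Real.pi)) :
    ∃ y : ℝ → ℝ, Function.Periodic y (2 * Real.pi) ∧
      ∀ θ, HasDerivAt y (r θ * (f θ - μ * y θ)) θ := by
  have hrc := r.continuous
  let S : ℝ → ℝ := fun θ => ∫ x in (0 : ℝ)..θ, r x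
  have hS : ∀ θ, HasDerivAt S (r θ) θ := fun θ => hrc.integral_hasStrictDerivAt 0 θ |>.hasDerivAt
  have hSc : Continuous S := continuous_iff_continuousAt.2 fun θ => (hS θ).continuousAt
  have hS2 : ∀ θ, S (θ + 2 * Real.pi) = S θ + S (2 * Real.pi) := fun θ => by
    have := r.periodic.intervalIntegral_add_eq θ 0
    rw [zero_add] at this
    simp only [S]
    rw [← this, intervalIntegral.integral_add_adjacent_intervals] <;>
      exact hrc.intervalIntegrable _ _
  -- The integrating factor exp(μS), with S a primitive of r, turns the equation into (exp(μS) y)' =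
  -- g.
  let g : ℝ → ℝ := fun θ => Real.exp (μ * S θ) * f θ * r θ
  have hg : Continuous g := by fun_prop
  let H : ℝ → ℝ := fun θ => ∫ x in (0 : ℝ)..θ, g x
  have hH : ∀ θ, HasDerivAt H (g θ) θ := fun θ => hg.integral_hasStrictDerivAt 0 θ |>.hasDerivAt
  -- The factor gained by exp(μS) over one turn. It differs from 1 because μ ≠ 0 and r has positive
  -- integral; this non-resonance allows a periodic solution.
  set l := Real.exp (μ * S (2 * Real.pi)) with hl
  have hg2 : ∀ θ, g (θ + 2 * Real.pi) = l * g θ := fun θ => by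
    simp only [g, hS2, hp θ, r.periodic θ, mul_add, Real.exp_add, ← hl]
    ring
  have hl1 : l - 1 ≠ 0 := by
    rw [sub_ne_zero, hl, Ne, Real.exp_eq_one_iff]
    exact mul_ne_zero hμ (integral_pos hr).ne'
  have hH2 : ∀ θ, H (θ + 2 * Real.pi) = l * H θ + H (2 * Real.pi) := fun θ => by
    have hd : ∀ x, HasDerivAt (fun θ => H (θ + 2 * Real.pi) - l * H θ) 0 x := fun x => by
      have := ((hH (x + 2 * Real.pi)).comp_add_const x (2 * Real.pi)).sub ((hH x).const_mul l)
      rwa [hg2, sub_self] at this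
    have := is_const_of_deriv_eq_zero (fun x => (hd x).differentiableAt) (fun x => (hd x).deriv) θ 0
    simp only [zero_add] at this
    have h0 : H 0 = 0 := intervalIntegral.integral_same
    rw [h0] at this
    linarith
  -- The constant of integration κ is fixed by periodicity, which requires H(2π) + κ = lκ.
  refine ⟨fun θ => Real.exp (-(μ * S θ)) * (H θ + H (2 * Real.pi) / (l - 1)), fun θ => ?_,
    fun θ => ?_⟩
  · simp only
    rw [hS2, hH2, mul_add μ, neg_add, Real.exp_add, Real.exp_neg (μ * S (2 * Real.pi)), ← hl]
    have : l ≠ 0 := (Real.exp_pos _).ne'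
    field_simp
    ring
  · have h1 := (((hS θ).const_mul μ).neg.exp).mul ((hH θ).add_const (H (2 * Real.pi) / (l - 1)))
    refine h1.congr_deriv ?_
    have : Real.exp (-(μ * S θ)) * Real.exp (μ * S θ) = 1 := by
      rw [← Real.exp_add, neg_add_cancel, Real.exp_zero]
    simp only [g, Pi.neg_apply]
    linear_combination (f θ * r θ) * this

/-- Where y² is largest yy' = 0, so there either y = 0 or μy = f. The argument does not depend on
the sign of μ. -/
theorem abs_le_of_firstOrder {r : SmoothFun} (hr : ∀ θ, 0 < r θ) {μ C : ℝ} (hμ : 0 < |μ|)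
    {f y : ℝ → ℝ} (hC : ∀ θ, |f θ| ≤ C) (hp : Function.Periodic y (2 * Real.pi))
    (hy : ∀ θ, HasDerivAt y (r θ * (f θ - μ * y θ)) θ) (θ : ℝ) : |y θ| ≤ C / |μ| := by
  have hC0 : 0 ≤ C := (abs_nonneg _).trans (hC 0)
  have hc : Continuous y := continuous_iff_continuousAt.2 fun θ => (hy θ).continuousAt
  obtain ⟨x, hx⟩ := exists_forall_le_of_periodic (f := fun θ => y θ ^ 2) (by fun_prop)
    (fun θ => by simp only [hp θ])
  have hmax : IsLocalMax (fun θ => y θ ^ 2) x := Filter.Eventually.of_forall hx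
  have h0 := hmax.hasDerivAt_eq_zero ((hy x).pow 2)
  refine (sq_le_sq.1 (hx θ)).trans ?_
  rw [le_div_iff₀ hμ]
  have hrx := (hr x).ne'
  simp only [Nat.cast_ofNat, Nat.add_one_sub_one, pow_one, mul_eq_zero, hrx, OfNat.ofNat_ne_zero,
    false_or] at h0
  rcases h0 with h0 | h0
  · rw [h0, abs_zero, zero_mul]
    exact hC0
  · rw [← abs_mul, mul_comm, ← sub_eq_zero.1 h0]
    exact hC x

/-- Periodic solutions of a second order equation, written as a first order system. -/
def IsSystemSol (r : SmoothFun) (μ : ℝ) (f u y : ℝ → ℝ) : Prop :=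
  Function.Periodic u (2 * Real.pi) ∧ Function.Periodic y (2 * Real.pi) ∧
    (∀ θ, HasDerivAt u (r θ * (y θ - μ * u θ)) θ) ∧
    ∀ θ, HasDerivAt y (r θ * (-f θ - -μ * y θ)) θ

theorem IsSystemSol.continuous {r : SmoothFun} {μ : ℝ} {f u y : ℝ → ℝ}
    (h : IsSystemSol r μ f u y) : Continuous u :=
  continuous_iff_continuousAt.2 fun θ => (h.2.2.1 θ).continuousAt

/-- With δ = r⁻¹ d/dθ the system reads (δ - μ)(δ + μ)u = -f, that is μ²u - δ²u = f. The two
first-order factors are inverted one after the other. -/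
theorem exists_isSystemSol {r : SmoothFun} (hr : ∀ θ, 0 < r θ) {μ : ℝ} (hμ : μ ≠ 0) {f : ℝ → ℝ}
    (hf : Continuous f) (hp : Function.Periodic f (2 * Real.pi)) :
    ∃ u y : ℝ → ℝ, IsSystemSol r μ f u y := by
  obtain ⟨y, hy, hy'⟩ := exists_firstOrder hr (neg_ne_zero.2 hμ) hf.neg
    (fun θ => congrArg Neg.neg (hp θ))
  obtain ⟨u, hu, hu'⟩ := exists_firstOrder hr hμ
    (continuous_iff_continuousAt.2 fun θ => (hy' θ).continuousAt) hy
  exact ⟨u, y, hu, hy, hu', hy'⟩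

theorem IsSystemSol.sub {r : SmoothFun} {μ : ℝ} {f u y g v z : ℝ → ℝ}
    (h : IsSystemSol r μ f u y) (k : IsSystemSol r μ g v z) :
    IsSystemSol r μ (fun θ => f θ - g θ) (fun θ => u θ - v θ) (fun θ => y θ - z θ) := by
  refine ⟨fun θ => ?_, fun θ => ?_, fun θ => ?_, fun θ => ?_⟩
  · simp only [h.1 θ, k.1 θ]
  · simp only [h.2.1 θ, k.2.1 θ]
  · exact ((h.2.2.1 θ).sub (k.2.2.1 θ)).congr_deriv (by ring)
  · exact ((h.2.2.2 θ).sub (k.2.2.2 θ)).congr_deriv (by ring)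

/-- Each first-order factor contributes one division by μ. The sharp constant μ⁻² is what makes the
fixed point map below a contraction. -/
theorem IsSystemSol.abs_le {r : SmoothFun} (hr : ∀ θ, 0 < r θ) {μ C : ℝ} (hμ : 0 < μ)
    {f u y : ℝ → ℝ} (hC : ∀ θ, |f θ| ≤ C) (h : IsSystemSol r μ f u y) (θ : ℝ) :
    |u θ| ≤ C / μ ^ 2 := by
  have h1 := abs_le_of_firstOrder (C := C) hr (by simpa using hμ.ne')
    (fun θ => by simpa using hC θ) h.2.1 h.2.2.2
  rw [abs_neg, abs_of_pos hμ] at h1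
  have h2 := abs_le_of_firstOrder hr (abs_pos.2 hμ.ne') h1 h.1 h.2.2.1 θ
  rwa [abs_of_pos hμ, div_div, ← sq] at h2

/-- The right-hand sides of the system are polynomial in u, y and smooth coefficients, so each order
of regularity gives the next. -/
theorem IsSystemSol.contDiff {r p q : SmoothFun} {μ : ℝ} {u y : ℝ → ℝ}
    (h : IsSystemSol r μ (fun θ => p θ * u θ + q θ) u y) : ContDiff ℝ ∞ u ∧ ContDiff ℝ ∞ y := by
  suffices ∀ n : ℕ, ContDiff ℝ n u ∧ ContDiff ℝ n y from
    ⟨contDiff_infty.2 fun n => (this n).1, contDiff_infty.2 fun n => (this n).2⟩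
  intro n
  have hd : ∀ f : SmoothFun, ContDiff ℝ n (f : ℝ → ℝ) := fun f =>
    f.contDiff.of_le (by exact_mod_cast le_top)
  induction n with
  | zero => exact ⟨contDiff_zero.2 h.continuous,
      contDiff_zero.2 (continuous_iff_continuousAt.2 fun θ => (h.2.2.2 θ).continuousAt)⟩
  | succ n ih =>
    have hd' : ∀ f : SmoothFun, ContDiff ℝ n (f : ℝ → ℝ) := fun f =>
      f.contDiff.of_le (by exact_mod_cast le_top)
    obtain ⟨hu, hy⟩ := ih hd'
    have := hd' r
    have := hd' p
    have := hd' q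
    push_cast
    constructor
    · refine contDiff_succ_iff_deriv.2 ⟨fun t => (h.2.2.1 t).differentiableAt, by simp, ?_⟩
      rw [funext fun t => (h.2.2.1 t).deriv]
      fun_prop
    · refine contDiff_succ_iff_deriv.2 ⟨fun t => (h.2.2.2 t).differentiableAt, by simp, ?_⟩
      rw [funext fun t => (h.2.2.2 t).deriv]
      fun_prop

open scoped BoundedContinuousFunction in
/-- Continuous periodic functions with the supremum norm. -/
abbrev PeriodicBCF : Type := {g : ℝ →ᵇ ℝ // Function.Periodic g (2 * Real.pi)}

open scoped BoundedContinuousFunction in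
-- Banach's fixed point theorem for the map sending g to the solution with right-hand side pg + q.
-- Its Lipschitz constant is at most sup|p|/μ² ≤ 1 - c/μ² < 1.
theorem exists_isSystemSol_fixed {r p : SmoothFun} (hr : ∀ θ, 0 < r θ) {μ c : ℝ} (hμ : 0 < μ)
    (hc : 0 < c) (hcμ : c ≤ μ ^ 2) (hp : ∀ θ, |p θ| ≤ μ ^ 2 - c) (q : SmoothFun) :
    ∃ u y : ℝ → ℝ, IsSystemSol r μ (fun θ => p θ * u θ + q θ) u y := by
  have hclosed : IsClosed {g : ℝ →ᵇ ℝ | Function.Periodic g (2 * Real.pi)} := by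
    have : {g : ℝ →ᵇ ℝ | Function.Periodic g (2 * Real.pi)} =
        ⋂ x, {g : ℝ →ᵇ ℝ | g (x + 2 * Real.pi) = g x} := by
      ext g
      simp [Function.Periodic]
    rw [this]
    exact isClosed_iInter fun x => isClosed_eq (BoundedContinuousFunction.lipschitz_eval_const _).continuous
      (BoundedContinuousFunction.lipschitz_eval_const _).continuous
  have : CompleteSpace PeriodicBCF := hclosed.completeSpace_coe
  have : Nonempty PeriodicBCF := ⟨⟨0, fun _ => rfl⟩⟩
  have hex : ∀ g : PeriodicBCF, ∃ w : PeriodicBCF, ∃ y, IsSystemSol r μ (fun θ => p θ * (g.1 : ℝ → ℝ) θ + q θ) (w.1 : ℝ → ℝ) y := by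
    intro g
    have hg := g.1.continuous
    have hpc := p.continuous
    have hqc := q.continuous
    obtain ⟨u, y, h⟩ := exists_isSystemSol hr hμ.ne' (f := fun θ => p θ * g.1 θ + q θ)
      (by fun_prop) (fun θ => by simp only [p.periodic θ, q.periodic θ, g.2 θ])
    obtain ⟨C, hC⟩ := (h.1.compact_of_continuous Real.two_pi_pos.ne' h.continuous).isBounded
      |>.exists_norm_le
    exact ⟨⟨BoundedContinuousFunction.ofNormedAddCommGroup u h.continuous C
      fun x => hC _ ⟨x, rfl⟩, h.1⟩, y, h⟩
  choose Φ Y hΦ using hex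
  have hK : (1 - c / μ ^ 2) < 1 := by
    have : 0 < c / μ ^ 2 := by positivity
    linarith
  have hK0 : 0 ≤ 1 - c / μ ^ 2 := by
    rw [sub_nonneg, div_le_one (by positivity)]
    exact hcμ
  have hcontr : ContractingWith ⟨1 - c / μ ^ 2, hK0⟩ Φ := by
    refine ⟨hK, LipschitzWith.of_dist_le_mul fun g g' => ?_⟩
    change dist (Φ g).1 (Φ g').1 ≤ (1 - c / μ ^ 2) * dist g.1 g'.1
    rw [BoundedContinuousFunction.dist_le (by positivity)]
    intro θ
    have := (IsSystemSol.sub (hΦ g) (hΦ g')).abs_le (C := (μ ^ 2 - c) * dist g.1 g'.1) hr hμ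
      (fun x => ?_) θ
    · rw [Real.dist_eq]
      convert this using 1
      field_simp
    · rw [add_sub_add_right_eq_sub, ← mul_sub, abs_mul]
      exact mul_le_mul (hp x) (by
        rw [← Real.dist_eq]
        exact BoundedContinuousFunction.dist_coe_le_dist x) (abs_nonneg _)
        ((abs_nonneg _).trans (hp x))
  have hfix := hcontr.fixedPoint_isFixedPt
  set g := hcontr.fixedPoint
  have := hΦ g
  rw [hfix] at this
  exact ⟨_, _, this⟩

/-- Multiplied by a, and with δ = a d/dθ, the equation becomes μ²u - δ²u = (μ² - am)u + aB, a fixed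
point problem for the model operator. The auxiliary unknown is y = au' + μu. -/
theorem exists_ellOp_eq {m a r : SmoothFun} (har : a * r = 1) (hm : ∀ θ, 0 < m θ)
    (ha : ∀ θ, 0 < a θ) (B : SmoothFun) : ∃ u, ellOp m a u = B := by
  have har' : ∀ θ, a θ * r θ = 1 := fun θ => by rw [← mul_apply, har, one_apply]
  have hr : ∀ θ, 0 < r θ := fun θ => pos_of_mul_pos_right (by rw [har' θ]; exact one_pos) (ha θ).le
  have ham : ∀ θ, 0 < (a * m) θ := fun θ => mul_pos (ha θ) (hm θ)
  obtain ⟨c, hc, hcam⟩ := exists_lower_bound ham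
  obtain ⟨K, hK, hamK⟩ := (a * m).exists_bound
  -- With μ² an upper bound of am and c a positive lower bound, 0 ≤ μ² - am ≤ μ² - c, as the
  -- contraction requires.
  set μ := Real.sqrt K with hμ
  have hμ2 : μ ^ 2 = K := Real.sq_sqrt hK.le
  have hμ0 : 0 < μ := Real.sqrt_pos.2 hK
  have hp : ∀ θ, |(const (μ ^ 2) - a * m) θ| ≤ μ ^ 2 - c := fun θ => by
    have h1 := (abs_le.1 (hamK θ)).2
    have h2 := hcam θ
    rw [hμ2, sub_apply, const_apply, abs_of_nonneg (by linarith)]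
    linarith
  obtain ⟨u, y, h⟩ := exists_isSystemSol_fixed hr hμ0 hc
    (by rw [hμ2]; exact (hcam 0).trans ((le_abs_self _).trans (hamK 0))) hp (a * B)
  obtain ⟨hu, hy⟩ := h.contDiff
  refine ⟨mk u hu h.1, ?_⟩
  have e1 : D (mk u hu h.1) = r * (mk y hy h.2.1 - const μ * mk u hu h.1) :=
    D_eq fun θ => h.2.2.1 θ
  have e2 : D (mk y hy h.2.1) = r * (const μ * mk y hy h.2.1 -
      ((const (μ ^ 2) - a * m) * mk u hu h.1 + a * B)) :=
    D_eq fun θ => (h.2.2.2 θ).congr_deriv (by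
      simp only [mul_apply, sub_apply, add_apply, const_apply, mk_apply]
      ring)
  have e3 : a * D (mk u hu h.1) = mk y hy h.2.1 - const μ * mk u hu h.1 := by
    rw [e1]
    linear_combination (mk y hy h.2.1 - const μ * mk u hu h.1) * har
  rw [ellOp_apply, e3, map_sub, D_mul, D_const, e1, e2]
  have e4 : const (μ ^ 2) = const μ * const μ := by
    ext θ
    simp [sq]
  linear_combination (r * mk u hu h.1) * e4 + (B - m * mk u hu h.1) * har

/-! ### The elliptic operator: smooth dependence -/

/-- Induction on the order. The candidate derivative W solves the formally differentiated equation;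
its right-hand side contains U, which already has order n, so the induction hypothesis applies to W.
The difference quotient of U minus W has image tending to 0 under the operator at time t + s, hence
tends to 0. -/
theorem isSmoothCurve_of_ellOp {M A R B U : ℝ → SmoothFun} (hM : IsSmoothCurve M)
    (hA : IsSmoothCurve A) (hR : IsSmoothCurve R) (hB : IsSmoothCurve B)
    (hAR : ∀ t, A t * R t = 1) (hM0 : ∀ t θ, 0 < M t θ) (hA0 : ∀ t θ, 0 < A t θ)
    (hU : ∀ t, ellOp (M t) (A t) (U t) = B t) : IsSmoothCurve U := by
  refine isSmoothCurve_of_curveDiff fun n => ?_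
  replace hB := hB.curveDiff n
  induction n generalizing B U with
  | zero =>
    refine continuous_iff_continuousAt.2 fun t => ?_
    have hMc : Continuous M := hM.curveDiff 0
    have hAc : Continuous A := hA.curveDiff 0
    have hRc : Continuous R := hR.curveDiff 0
    have hBc : Continuous B := hB
    -- The image is B(s) minus the operator at time s applied to the fixed function U(t), which is
    -- continuous in s and vanishes at s = t.
    have h1 : Filter.Tendsto (fun s => ellOp (M s) (A s) (U s - U t)) (𝓝 t) (𝓝 0) := by
      have : Continuous fun s => B s - (M s * U t - D (A s * D (U t))) :=
        hBc.sub ((hMc.mul continuous_const).sub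
          (continuous_D.comp (hAc.mul continuous_const)))
      have h2 := this.tendsto t
      rw [← ellOp_apply, hU, sub_self] at h2
      refine h2.congr fun s => ?_
      rw [map_sub, hU, ellOp_apply]
    have h3 := tendsto_zero_of_ellOp (hMc.tendsto t) (hRc.tendsto t) hAR (hM0 t) hA0 h1
    have h4 := h3.add_const (U t)
    simp only [sub_add_cancel, zero_add] at h4
    exact h4
  | succ n ih =>
    have hUn := ih hU hB.of_succ
    obtain ⟨B', hB', hB'n⟩ := hB
    obtain ⟨M', hM', hM'n⟩ := hM.curveDiff (n + 1)
    obtain ⟨A', hA', hA'n⟩ := hA.curveDiff (n + 1)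
    choose W hW using fun t => exists_ellOp_eq (hAR t) (hM0 t) (hA0 t)
      (B' t - (M' t * U t - D (A' t * D (U t))))
    refine ⟨W, fun t => ?_, ih hW (hB'n.sub ((curveDiff_mul hM'n hUn).sub
      ((curveDiff_mul hA'n (hUn.clm D continuous_D)).clm D continuous_D)))⟩
    have hMt := (hM' t).tendsto
    have hAt := (hA' t).tendsto
    have hRt : Filter.Tendsto (fun s => R (t + s)) (𝓝[≠] 0) (𝓝 (R t)) := by
      obtain ⟨R', hR'⟩ := hR.hasCurveDeriv t
      exact hR'.tendsto
    have hlim : Filter.Tendsto (fun s : ℝ => s⁻¹ • (B (t + s) - B t) -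
        ((s⁻¹ • (M (t + s) - M t)) * U t - D ((s⁻¹ • (A (t + s) - A t)) * D (U t))) -
        (M (t + s) * W t - D (A (t + s) * D (W t)))) (𝓝[≠] 0) (𝓝 0) := by
      have h1 := ((hB' t).sub ((Filter.Tendsto.mul_const (U t) (hM' t)).sub
        ((continuous_D.tendsto _).comp (Filter.Tendsto.mul_const (D (U t)) (hA' t))))).sub
        ((hMt.mul_const (W t)).sub ((continuous_D.tendsto _).comp (hAt.mul_const (D (W t)))))
      rw [← hW t, ← ellOp_apply, sub_self] at h1
      exact h1
    have hdiff : Filter.Tendsto (fun s => ellOp (M (t + s)) (A (t + s))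
        (s⁻¹ • (U (t + s) - U t) - W t)) (𝓝[≠] 0) (𝓝 0) := by
      refine hlim.congr fun s => ?_
      rw [map_sub, map_smul, map_sub, hU, ← hU t, ellOp_apply, ellOp_apply, ellOp_apply,
        smul_mul_assoc, smul_mul_assoc, map_smul, sub_mul, sub_mul, map_sub, ← smul_sub,
        ← smul_sub]
      congr 2
      ring
    have h3 := tendsto_zero_of_ellOp hMt hRt (fun s => hAR (t + s)) (hM0 t)
      (fun s => hA0 (t + s)) hdiff
    have h4 := h3.add_const (W t)
    simp only [sub_add_cancel, zero_add] at h4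
    exact h4

end SmoothFun

namespace SmoothFun

/-! ### Operations on smooth curves of functions -/

/-- Composition with a function that is smooth along the values. -/
def comp (φ : ℝ → ℝ) (f : SmoothFun) (h : ∀ θ, ContDiffAt ℝ ∞ φ (f θ)) : SmoothFun :=
  mk (fun θ => φ (f θ)) (contDiff_iff_contDiffAt.2 fun θ => (h θ).comp θ f.contDiff.contDiffAt)
    (fun θ => by simp only [f.periodic θ])

@[simp] theorem comp_apply (φ : ℝ → ℝ) (f : SmoothFun) (h) (θ : ℝ) : comp φ f h θ = φ (f θ) := rfl

/-- The cosine of a function. -/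
def cosF (f : SmoothFun) : SmoothFun := comp Real.cos f fun _ => Real.contDiff_cos.contDiffAt

/-- The sine of a function. -/
def sinF (f : SmoothFun) : SmoothFun := comp Real.sin f fun _ => Real.contDiff_sin.contDiffAt

/-- The exponential of a function. -/
def expF (f : SmoothFun) : SmoothFun := comp Real.exp f fun _ => Real.contDiff_exp.contDiffAt

/-- The inverse of a positive function. -/
def invF (f : SmoothFun) (hf : ∀ θ, 0 < f θ) : SmoothFun :=
  comp Inv.inv f fun θ => contDiffAt_inv ℝ (hf θ).ne'

/-- The square root of a positive function. -/
def sqrtF (f : SmoothFun) (hf : ∀ θ, 0 < f θ) : SmoothFun :=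
  comp Real.sqrt f fun θ => Real.contDiffAt_sqrt (hf θ).ne'

@[simp] theorem cosF_apply (f : SmoothFun) (θ : ℝ) : cosF f θ = Real.cos (f θ) := rfl
@[simp] theorem sinF_apply (f : SmoothFun) (θ : ℝ) : sinF f θ = Real.sin (f θ) := rfl
@[simp] theorem expF_apply (f : SmoothFun) (θ : ℝ) : expF f θ = Real.exp (f θ) := rfl
@[simp] theorem invF_apply (f : SmoothFun) (hf) (θ : ℝ) : invF f hf θ = (f θ)⁻¹ := rfl
@[simp] theorem sqrtF_apply (f : SmoothFun) (hf) (θ : ℝ) : sqrtF f hf θ = Real.sqrt (f θ) := rfl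

theorem mul_invF (f : SmoothFun) (hf : ∀ θ, 0 < f θ) : f * invF f hf = 1 := by
  ext θ
  exact mul_inv_cancel₀ (hf θ).ne'

theorem D_cosF (f : SmoothFun) : D (cosF f) = -(sinF f * D f) :=
  D_eq fun θ => (f.hasDerivAt θ).cos.congr_deriv (by simp)

theorem D_sinF (f : SmoothFun) : D (sinF f) = cosF f * D f :=
  D_eq fun θ => (f.hasDerivAt θ).sin

end SmoothFun

open SmoothFun

section Curves

variable {c d : ℝ → SmoothFun}

theorem isSmoothCurve_const {E : Type*} [AddCommGroup E] [Module ℝ E] [TopologicalSpace E] (f : E) :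
    IsSmoothCurve (fun _ : ℝ => f) := by
  refine ⟨fun n _ => if n = 0 then f else 0, rfl, fun n t => ?_⟩
  simp only [sub_self, smul_zero, HasCurveDeriv, Nat.add_eq_zero_iff, one_ne_zero, and_false,
    if_false]
  exact tendsto_const_nhds

theorem IsSmoothCurve.add (hc : IsSmoothCurve c) (hd : IsSmoothCurve d) :
    IsSmoothCurve (fun t => c t + d t) :=
  isSmoothCurve_iff.2 ((isSmoothCurve_iff.1 hc).add (isSmoothCurve_iff.1 hd))

theorem IsSmoothCurve.sub (hc : IsSmoothCurve c) (hd : IsSmoothCurve d) :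
    IsSmoothCurve (fun t => c t - d t) :=
  isSmoothCurve_iff.2 ((isSmoothCurve_iff.1 hc).sub (isSmoothCurve_iff.1 hd))

theorem IsSmoothCurve.neg (hc : IsSmoothCurve c) : IsSmoothCurve (fun t => -c t) :=
  isSmoothCurve_iff.2 (isSmoothCurve_iff.1 hc).neg

theorem IsSmoothCurve.mul (hc : IsSmoothCurve c) (hd : IsSmoothCurve d) :
    IsSmoothCurve (fun t => c t * d t) :=
  isSmoothCurve_iff.2 ((isSmoothCurve_iff.1 hc).mul (isSmoothCurve_iff.1 hd))

theorem IsSmoothCurve.pow (hc : IsSmoothCurve c) (n : ℕ) : IsSmoothCurve (fun t => c t ^ n) := by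
  rw [isSmoothCurve_iff]
  simp only [pow_apply]
  exact (isSmoothCurve_iff.1 hc).pow n

theorem IsSmoothCurve.smul {b : ℝ → ℝ} (hb : ContDiff ℝ ∞ b) (hd : IsSmoothCurve d) :
    IsSmoothCurve (fun t => b t • d t) :=
  isSmoothCurve_iff.2 ((hb.comp contDiff_fst).mul (isSmoothCurve_iff.1 hd))

theorem IsSmoothCurve.D (hc : IsSmoothCurve c) : IsSmoothCurve (fun t => D (c t)) :=
  hc.clm SmoothFun.D continuous_D

theorem IsSmoothCurve.integral (hc : IsSmoothCurve c) :
    ContDiff ℝ ∞ (fun t => integral (c t)) :=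
  isSmoothCurve_real.1 (hc.clm SmoothFun.integral.toLinearMap SmoothFun.integral.continuous)

theorem IsSmoothCurve.postcomp (hc : IsSmoothCurve c) (φ : ℝ → ℝ)
    (h : ∀ t θ, ContDiffAt ℝ ∞ φ (c t θ)) : IsSmoothCurve (fun t => comp φ (c t) (h t)) :=
  isSmoothCurve_iff.2 <| contDiff_iff_contDiffAt.2 fun p =>
    (h p.1 p.2).comp p (isSmoothCurve_iff.1 hc).contDiffAt

theorem IsSmoothCurve.cosF (hc : IsSmoothCurve c) : IsSmoothCurve (fun t => cosF (c t)) :=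
  hc.postcomp _ _

theorem IsSmoothCurve.sinF (hc : IsSmoothCurve c) : IsSmoothCurve (fun t => sinF (c t)) :=
  hc.postcomp _ _

theorem IsSmoothCurve.expF (hc : IsSmoothCurve c) : IsSmoothCurve (fun t => expF (c t)) :=
  hc.postcomp _ _

theorem IsSmoothCurve.invF (hc : IsSmoothCurve c) (h : ∀ t θ, 0 < c t θ) :
    IsSmoothCurve (fun t => invF (c t) (h t)) :=
  hc.postcomp _ _

theorem IsSmoothCurve.sqrtF (hc : IsSmoothCurve c) (h : ∀ t θ, 0 < c t θ) :
    IsSmoothCurve (fun t => sqrtF (c t) (h t)) :=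
  hc.postcomp _ _

/-- Through the exponential law smoothness of a curve is local in time, so it may be checked in a
chart around each time. -/
theorem isSmoothCurve_of_eventuallyEq
    (h : ∀ t₀, ∃ d : ℝ → SmoothFun, IsSmoothCurve d ∧ ∀ᶠ t in 𝓝 t₀, c t = d t) :
    IsSmoothCurve c := by
  refine isSmoothCurve_iff.2 (contDiff_iff_contDiffAt.2 fun p => ?_)
  obtain ⟨d, hd, hcd⟩ := h p.1
  refine (isSmoothCurve_iff.1 hd).contDiffAt.congr_of_eventuallyEq ?_
  filter_upwards [(continuous_fst (X := ℝ) (Y := ℝ)).tendsto p |>.eventually hcd] with x hx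
  rw [hx]

theorem HasCurveDeriv.hasDerivAt_apply {h : SmoothFun} {t : ℝ} (hc : HasCurveDeriv c h t) (θ : ℝ) :
    HasDerivAt (fun t => c t θ) (h θ) t :=
  hasCurveDeriv_real.1 (hc.clm (eval θ).toLinearMap (eval θ).continuous)

theorem HasCurveDeriv.hasDerivAt_D_apply {h : SmoothFun} {t : ℝ} (hc : HasCurveDeriv c h t)
    (θ : ℝ) : HasDerivAt (fun t => SmoothFun.D (c t) θ) (SmoothFun.D h θ) t :=
  (hc.clm SmoothFun.D continuous_D).hasDerivAt_apply θ

theorem HasCurveDeriv.integral {h : SmoothFun} {t : ℝ} (hc : HasCurveDeriv c h t) :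
    HasDerivAt (fun t => SmoothFun.integral (c t)) (SmoothFun.integral h) t :=
  hasCurveDeriv_real.1 (hc.clm SmoothFun.integral.toLinearMap SmoothFun.integral.continuous)

/-- A smooth curve already has a derivative in C^∞; its values at points identify it. Derivatives
can thus be computed at fixed θ. -/
theorem IsSmoothCurve.hasCurveDeriv_of_pointwise (hc : IsSmoothCurve c) {h : SmoothFun} {t : ℝ}
    (hh : ∀ θ, HasDerivAt (fun t => c t θ) (h θ) t) : HasCurveDeriv c h t := by
  obtain ⟨k, hk⟩ := hc.hasCurveDeriv t
  rwa [show h = k from SmoothFun.ext fun θ => (hh θ).unique (hk.hasDerivAt_apply θ)]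

end Curves

/-! ### Angle functions -/

namespace SmoothAngleFun

/-- The cosine of a circle valued map. -/
def cosFun (α : SmoothAngleFun) : SmoothFun :=
  SmoothFun.mk (fun θ => (α θ).cos) α.smooth_cos fun θ => by simp only [α.periodic θ]

/-- The sine of a circle valued map. -/
def sinFun (α : SmoothAngleFun) : SmoothFun :=
  SmoothFun.mk (fun θ => (α θ).sin) α.smooth_sin fun θ => by simp only [α.periodic θ]

/-- The derivative of a circle valued map. -/
def derivFun (α : SmoothAngleFun) : SmoothFun := α.cosFun * D α.sinFun - α.sinFun * D α.cosFun

@[simp] theorem cosFun_apply (α : SmoothAngleFun) (θ : ℝ) : α.cosFun θ = (α θ).cos := rfl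
@[simp] theorem sinFun_apply (α : SmoothAngleFun) (θ : ℝ) : α.sinFun θ = (α θ).sin := rfl

theorem derivFun_apply (α : SmoothAngleFun) (θ : ℝ) : α.derivFun θ = α.angDeriv θ := rfl

theorem cos_sq_add_sin_sq (α : SmoothAngleFun) : α.cosFun ^ 2 + α.sinFun ^ 2 = 1 := by
  ext θ
  simp [Real.Angle.cos_sq_add_sin_sq]

theorem cos_mul_D_add (α : SmoothAngleFun) : α.cosFun * D α.cosFun + α.sinFun * D α.sinFun = 0 := by
  have h := congrArg D α.cos_sq_add_sin_sq
  have h1 : D (1 : SmoothFun) = 0 := D_const 1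
  rw [map_add, sq, sq, D_mul, D_mul, h1] at h
  have h2 : (2 : ℝ) • (α.cosFun * D α.cosFun + α.sinFun * D α.sinFun) = 0 := by
    rw [two_smul]
    linear_combination h
  exact (smul_eq_zero.1 h2).resolve_left two_ne_zero

theorem D_cosFun (α : SmoothAngleFun) : D α.cosFun = -(α.derivFun * α.sinFun) := by
  rw [derivFun]
  linear_combination (-D α.cosFun) * α.cos_sq_add_sin_sq + α.cosFun * α.cos_mul_D_add

theorem D_sinFun (α : SmoothAngleFun) : D α.sinFun = α.derivFun * α.cosFun := by
  rw [derivFun]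
  linear_combination (-D α.sinFun) * α.cos_sq_add_sin_sq + α.sinFun * α.cos_mul_D_add

theorem angle_ext {α β : Real.Angle} (hc : α.cos = β.cos) (hs : α.sin = β.sin) : α = β := by
  rw [← Complex.arg_cos_add_sin_mul_I_coe_angle α, hc, hs, Complex.arg_cos_add_sin_mul_I_coe_angle]

theorem ext_fun {α β : SmoothAngleFun} (h : ∀ θ, α θ = β θ) : α = β := by
  cases α
  cases β
  congr
  exact funext h

/-- The hypotheses are the addition formulas for β = α + f. Working with cosine and sine avoids a
global real lift of α, which fails to exist as a periodic function when the winding number is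
nonzero. -/
theorem derivFun_eq_of_add {α β : SmoothAngleFun} {f : SmoothFun}
    (hc : β.cosFun = α.cosFun * cosF f - α.sinFun * sinF f)
    (hs : β.sinFun = α.sinFun * cosF f + α.cosFun * sinF f) :
    β.derivFun = α.derivFun + D f := by
  have h1 : cosF f ^ 2 + sinF f ^ 2 = 1 := by
    ext θ
    simp
  have h2 := α.cos_sq_add_sin_sq
  rw [derivFun, hc, hs]
  simp only [map_add, map_sub, D_mul, D_cosF, D_sinF, D_cosFun, D_sinFun]
  have h3 : (α.cosFun ^ 2 + α.sinFun ^ 2) * (cosF f ^ 2 + sinF f ^ 2) = 1 := by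
    rw [h1, h2, one_mul]
  linear_combination (α.derivFun + D f) * h3

/-- The circle valued map `α + f`. -/
def addFun (α : SmoothAngleFun) (f : SmoothFun) : SmoothAngleFun where
  toFun θ := α θ + ((f θ : ℝ) : Real.Angle)
  periodic θ := by simp only [α.periodic θ, f.periodic θ]
  smooth_cos := by
    simp only [Real.Angle.cos_add, Real.Angle.cos_coe, Real.Angle.sin_coe]
    exact (α.cosFun * cosF f - α.sinFun * sinF f).contDiff
  smooth_sin := by
    simp only [Real.Angle.sin_add, Real.Angle.cos_coe, Real.Angle.sin_coe]
    exact (α.sinFun * cosF f + α.cosFun * sinF f).contDiff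

@[simp] theorem addFun_apply (α : SmoothAngleFun) (f : SmoothFun) (θ : ℝ) :
    α.addFun f θ = α θ + ((f θ : ℝ) : Real.Angle) := rfl

end SmoothAngleFun

/-! ### Points of the manifold and smooth curves in it -/

namespace Maps

theorem ext_fun {p q : Maps} (h₁ : ∀ θ, p.q₁ θ = q.q₁ θ) (h₂ : ∀ θ, p.q₂ θ = q.q₂ θ)
    (h₃ : ∀ θ, p.q₃ θ = q.q₃ θ) : p = q := by
  cases p
  cases q
  congr
  · exact SmoothFun.ext h₁
  · exact SmoothAngleFun.ext_fun h₂
  · exact SmoothFun.ext h₃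

/-- The point `p + h`. -/
def shift (p : Maps) (h : Model) (hp : ∀ θ, 0 < p.q₁ θ + h.1 θ) : Maps where
  q₁ := p.q₁ + h.1
  q₂ := p.q₂.addFun h.2.1
  q₃ := p.q₃ + h.2.2
  pos := hp

end Maps

theorem shift_shift (p : Maps) (h : Model) (hp : ∀ θ, 0 < p.q₁ θ + h.1 θ) :
    Shift p h (p.shift h hp) := fun _ => ⟨rfl, rfl, rfl⟩

namespace Shift

variable {p q : Maps} {h : Model}

theorem eq_shift (H : Shift p h q) (hp : ∀ θ, 0 < p.q₁ θ + h.1 θ) : q = p.shift h hp :=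
  Maps.ext_fun (fun θ => (H θ).1) (fun θ => (H θ).2.1) (fun θ => (H θ).2.2)

theorem q₁ (H : Shift p h q) : q.q₁ = p.q₁ + h.1 := SmoothFun.ext fun θ => (H θ).1

theorem q₃ (H : Shift p h q) : q.q₃ = p.q₃ + h.2.2 := SmoothFun.ext fun θ => (H θ).2.2

theorem cosFun (H : Shift p h q) :
    q.q₂.cosFun = p.q₂.cosFun * cosF h.2.1 - p.q₂.sinFun * sinF h.2.1 :=
  SmoothFun.ext fun θ => by
    simp [(H θ).2.1, Real.Angle.cos_add]

theorem sinFun (H : Shift p h q) :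
    q.q₂.sinFun = p.q₂.sinFun * cosF h.2.1 + p.q₂.cosFun * sinF h.2.1 :=
  SmoothFun.ext fun θ => by
    simp [(H θ).2.1, Real.Angle.sin_add]

theorem derivFun (H : Shift p h q) : q.q₂.derivFun = p.q₂.derivFun + D h.2.1 :=
  SmoothAngleFun.derivFun_eq_of_add H.cosFun H.sinFun

/-- The displacement from a point to itself is determined only modulo 2π in the second coordinate.
Its cosine is 1 and its sine 0, which is enough for the velocity formulas. -/
theorem coe_eq_zero (H : Shift p h p) (θ : ℝ) : ((h.2.1 θ : ℝ) : Real.Angle) = 0 := by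
  have := (H θ).2.1
  rwa [left_eq_add] at this

theorem cosF_eq_one (H : Shift p h p) (θ : ℝ) : Real.cos (h.2.1 θ) = 1 := by
  rw [← Real.Angle.cos_coe, H.coe_eq_zero, Real.Angle.cos_zero]

theorem sinF_eq_zero (H : Shift p h p) (θ : ℝ) : Real.sin (h.2.1 θ) = 0 := by
  rw [← Real.Angle.sin_coe, H.coe_eq_zero, Real.Angle.sin_zero]

end Shift

section MapsCurves

variable {γ : ℝ → Maps}

theorem IsSmoothCurveInMaps.q₁ (hγ : IsSmoothCurveInMaps γ) :
    IsSmoothCurve (fun t => (γ t).q₁) :=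
  isSmoothCurve_of_eventuallyEq fun t₀ => by
    obtain ⟨c, hc, hs⟩ := hγ t₀
    exact ⟨_, (isSmoothCurve_const (γ t₀).q₁).add hc.fst, hs.mono fun t ht => ht.q₁⟩

theorem IsSmoothCurveInMaps.q₃ (hγ : IsSmoothCurveInMaps γ) :
    IsSmoothCurve (fun t => (γ t).q₃) :=
  isSmoothCurve_of_eventuallyEq fun t₀ => by
    obtain ⟨c, hc, hs⟩ := hγ t₀
    exact ⟨_, (isSmoothCurve_const (γ t₀).q₃).add hc.snd.snd, hs.mono fun t ht => ht.q₃⟩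

theorem IsSmoothCurveInMaps.cosFun (hγ : IsSmoothCurveInMaps γ) :
    IsSmoothCurve (fun t => (γ t).q₂.cosFun) :=
  isSmoothCurve_of_eventuallyEq fun t₀ => by
    obtain ⟨c, hc, hs⟩ := hγ t₀
    exact ⟨_, ((isSmoothCurve_const (γ t₀).q₂.cosFun).mul hc.snd.fst.cosF).sub
      ((isSmoothCurve_const (γ t₀).q₂.sinFun).mul hc.snd.fst.sinF), hs.mono fun t ht => ht.cosFun⟩

theorem IsSmoothCurveInMaps.sinFun (hγ : IsSmoothCurveInMaps γ) :
    IsSmoothCurve (fun t => (γ t).q₂.sinFun) :=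
  isSmoothCurve_of_eventuallyEq fun t₀ => by
    obtain ⟨c, hc, hs⟩ := hγ t₀
    exact ⟨_, ((isSmoothCurve_const (γ t₀).q₂.sinFun).mul hc.snd.fst.cosF).add
      ((isSmoothCurve_const (γ t₀).q₂.cosFun).mul hc.snd.fst.sinF), hs.mono fun t ht => ht.sinFun⟩

theorem IsSmoothCurveInMaps.derivFun (hγ : IsSmoothCurveInMaps γ) :
    IsSmoothCurve (fun t => (γ t).q₂.derivFun) :=
  (hγ.cosFun.mul hγ.sinFun.D).sub (hγ.sinFun.mul hγ.cosFun.D)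

variable {h : Model}

theorem HasVelocity.q₁ (hv : HasVelocity γ 0 h) (θ : ℝ) :
    HasDerivAt (fun t => (γ t).q₁ θ) (h.1 θ) 0 := by
  obtain ⟨c, -, hs, hd⟩ := hv
  refine ((hd.fst.hasDerivAt_apply θ).const_add ((γ 0).q₁ θ)).congr_of_eventuallyEq ?_
  exact hs.mono fun t ht => (ht θ).1

theorem HasVelocity.q₃ (hv : HasVelocity γ 0 h) (θ : ℝ) :
    HasDerivAt (fun t => (γ t).q₃ θ) (h.2.2 θ) 0 := by
  obtain ⟨c, -, hs, hd⟩ := hv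
  refine ((hd.snd.snd.hasDerivAt_apply θ).const_add ((γ 0).q₃ θ)).congr_of_eventuallyEq ?_
  exact hs.mono fun t ht => (ht θ).2.2

theorem HasVelocity.derivFun (hv : HasVelocity γ 0 h) (θ : ℝ) :
    HasDerivAt (fun t => (γ t).q₂.derivFun θ) (D h.2.1 θ) 0 := by
  obtain ⟨c, -, hs, hd⟩ := hv
  refine ((hd.snd.fst.hasDerivAt_D_apply θ).const_add ((γ 0).q₂.derivFun θ)).congr_of_eventuallyEq ?_
  filter_upwards [hs] with t ht
  rw [ht.derivFun]
  rfl

theorem HasVelocity.cosFun (hv : HasVelocity γ 0 h) (θ : ℝ) :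
    HasDerivAt (fun t => (γ t).q₂.cosFun θ) (-((γ 0).q₂.sinFun θ * h.2.1 θ)) 0 := by
  obtain ⟨c, -, hs, hd⟩ := hv
  have h1 := hd.snd.fst.hasDerivAt_apply θ
  have h2 := (h1.cos.const_mul ((γ 0).q₂.cosFun θ)).sub (h1.sin.const_mul ((γ 0).q₂.sinFun θ))
  rw [hs.self_of_nhds.cosF_eq_one, hs.self_of_nhds.sinF_eq_zero] at h2
  refine (h2.congr_deriv ?_).congr_of_eventuallyEq ?_
  · ring
  · filter_upwards [hs] with t ht
    rw [ht.cosFun]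
    rfl

theorem HasVelocity.sinFun (hv : HasVelocity γ 0 h) (θ : ℝ) :
    HasDerivAt (fun t => (γ t).q₂.sinFun θ) ((γ 0).q₂.cosFun θ * h.2.1 θ) 0 := by
  obtain ⟨c, -, hs, hd⟩ := hv
  have h1 := hd.snd.fst.hasDerivAt_apply θ
  have h2 := (h1.cos.const_mul ((γ 0).q₂.sinFun θ)).add (h1.sin.const_mul ((γ 0).q₂.cosFun θ))
  rw [hs.self_of_nhds.cosF_eq_one, hs.self_of_nhds.sinF_eq_zero] at h2
  refine (h2.congr_deriv ?_).congr_of_eventuallyEq ?_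
  · ring
  · filter_upwards [hs] with t ht
    rw [ht.sinFun]
    rfl

end MapsCurves

/-! ### The metric -/

theorem pow_pos_of_pos {f : SmoothFun} (hf : ∀ θ, 0 < f θ) (n : ℕ) (θ : ℝ) : 0 < (f ^ n) θ := by
  rw [pow_apply]
  exact pow_pos (hf θ) n

/-- The pointwise inner product of two tangent vectors. -/
def GDensity (q : Maps) (h k : Model) : SmoothFun :=
  (4 : ℝ) • (h.1 * k.1) + q.q₁ ^ 2 * (h.2.1 * k.2.1) +
    invF (q.q₁ ^ 6) (pow_pos_of_pos q.pos 6) * (h.2.2 * k.2.2)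

theorem GL2_eq (q : Maps) (h k : Model) : GL2 q h k = integral (GDensity q h k) := by
  rw [GL2, integral_def]
  refine intervalIntegral.integral_congr fun θ _ => ?_
  simp only [GDensity, add_apply, mul_apply, smul_apply, pow_apply, invF_apply]
  ring

/-- The metric as a bilinear form. -/
def GForm (q : Maps) : Model →ₗ[ℝ] Model →ₗ[ℝ] ℝ :=
  LinearMap.mk₂ ℝ (GL2 q)
    (fun h h' k => by
      rw [GL2_eq, GL2_eq, GL2_eq, ← map_add]
      congr 1
      simp only [GDensity, Prod.fst_add, Prod.snd_add, add_mul, smul_add]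
      ring)
    (fun r h k => by
      rw [GL2_eq, GL2_eq, ← map_smul]
      congr 1
      simp only [GDensity, Prod.smul_fst, Prod.smul_snd, smul_mul_assoc, mul_smul_comm, smul_add]
      rw [smul_comm])
    (fun h k k' => by
      rw [GL2_eq, GL2_eq, GL2_eq, ← map_add]
      congr 1
      simp only [GDensity, Prod.fst_add, Prod.snd_add, mul_add, smul_add]
      ring)
    (fun r h k => by
      rw [GL2_eq, GL2_eq, ← map_smul]
      congr 1
      simp only [GDensity, Prod.smul_fst, Prod.smul_snd, mul_smul_comm, smul_add]
      rw [smul_comm])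

theorem GL2_comm (q : Maps) (h k : Model) : GL2 q h k = GL2 q k h := by
  rw [GL2_eq, GL2_eq]
  congr 1
  simp only [GDensity, mul_comm]

theorem GL2_self_eq_zero {q : Maps} {h : Model} (H : GL2 q h h = 0) : h = 0 := by
  have hpos : ∀ θ, 0 < q.q₁ θ := q.pos
  have h1 : GDensity q h h = 0 := by
    refine eq_zero_of_integral_eq_zero (fun θ => ?_) (by rwa [← GL2_eq])
    have := hpos θ
    simp only [GDensity, add_apply, mul_apply, smul_apply, pow_apply, invF_apply, ← sq]
    positivity
  have h2 : ∀ θ, h.1 θ = 0 ∧ h.2.1 θ = 0 ∧ h.2.2 θ = 0 := fun θ => by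
    have h3 : GDensity q h h θ = 0 := by rw [h1, zero_apply]
    have := hpos θ
    simp only [GDensity, add_apply, mul_apply, smul_apply, pow_apply, invF_apply, ← sq] at h3
    have e1 : 0 ≤ 4 * h.1 θ ^ 2 := by positivity
    have e2 : 0 ≤ q.q₁ θ ^ 2 * h.2.1 θ ^ 2 := by positivity
    have e3 : 0 ≤ (q.q₁ θ ^ 6)⁻¹ * h.2.2 θ ^ 2 := by positivity
    have f1 : 4 * h.1 θ ^ 2 = 0 := by linarith
    have f2 : q.q₁ θ ^ 2 * h.2.1 θ ^ 2 = 0 := by linarith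
    have f3 : (q.q₁ θ ^ 6)⁻¹ * h.2.2 θ ^ 2 = 0 := by linarith
    have n2 : q.q₁ θ ^ 2 ≠ 0 := by positivity
    have n3 : (q.q₁ θ ^ 6)⁻¹ ≠ 0 := by positivity
    refine ⟨?_, ?_, ?_⟩
    · simpa using f1
    · simpa [n2] using f2
    · exact pow_eq_zero_iff two_ne_zero |>.1 ((mul_eq_zero.1 f3).resolve_left n3)
  exact Prod.ext (SmoothFun.ext fun θ => (h2 θ).1)
    (Prod.ext (SmoothFun.ext fun θ => (h2 θ).2.1) (SmoothFun.ext fun θ => (h2 θ).2.2))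

theorem IsSmoothCurveInMaps.GL2 {γ : ℝ → Maps} (hγ : IsSmoothCurveInMaps γ) {h k : ℝ → Model}
    (hh : IsSmoothCurve h) (hk : IsSmoothCurve k) :
    ContDiff ℝ ∞ (fun t => GL2 (γ t) (h t) (k t)) := by
  simp only [GL2_eq]
  refine IsSmoothCurve.integral ?_
  exact ((IsSmoothCurve.smul contDiff_const (hh.fst.mul hk.fst)).add
    ((hγ.q₁.pow 2).mul (hh.snd.fst.mul hk.snd.fst))).add
    (((hγ.q₁.pow 6).invF fun t => pow_pos_of_pos (γ t).pos 6).mul (hh.snd.snd.mul hk.snd.snd))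

/-! ### The closing condition and its gradient -/

theorem coe_toCircle_eq (α : Real.Angle) :
    (α.toCircle : ℂ) = ((α.cos : ℝ) : ℂ) + ((α.sin : ℝ) : ℂ) * Complex.I :=
  Real.Angle.coe_toCircle α

/-- The velocity field `q₁² exp(iq₂)` of the curve defined by `q`. -/
def speed (q : Maps) (θ : ℝ) : ℂ := ((q.q₁ θ : ℝ) : ℂ) ^ 2 * ((q.q₂ θ).toCircle : ℂ)

theorem speed_re (q : Maps) (θ : ℝ) : (speed q θ).re = (q.q₁ ^ 2 * q.q₂.cosFun) θ := by
  rw [speed, coe_toCircle_eq, ← Complex.ofReal_pow, Complex.re_ofReal_mul]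
  simp

theorem speed_im (q : Maps) (θ : ℝ) : (speed q θ).im = (q.q₁ ^ 2 * q.q₂.sinFun) θ := by
  rw [speed, coe_toCircle_eq, ← Complex.ofReal_pow, Complex.im_ofReal_mul]
  simp

theorem contDiff_speed (q : Maps) : ContDiff ℝ ∞ (speed q) := by
  have : speed q = fun θ => (((q.q₁ ^ 2 * q.q₂.cosFun) θ : ℝ) : ℂ) +
      (((q.q₁ ^ 2 * q.q₂.sinFun) θ : ℝ) : ℂ) * Complex.I := by
    funext θ
    rw [← speed_re, ← speed_im, Complex.re_add_im]
  rw [this]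
  exact (Complex.ofRealCLM.contDiff.comp (q.q₁ ^ 2 * q.q₂.cosFun).contDiff).add
    ((Complex.ofRealCLM.contDiff.comp (q.q₁ ^ 2 * q.q₂.sinFun).contDiff).mul contDiff_const)

theorem Hcl_re (q : Maps) : (Hcl q).re = integral (q.q₁ ^ 2 * q.q₂.cosFun) := by
  have h := Complex.reCLM.intervalIntegral_comp_comm
    ((contDiff_speed q).continuous.intervalIntegrable (μ := MeasureTheory.volume) 0 (2 * Real.pi))
  rw [integral_def]
  simp only [← speed_re]
  exact h.symm

theorem Hcl_im (q : Maps) : (Hcl q).im = integral (q.q₁ ^ 2 * q.q₂.sinFun) := by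
  have h := Complex.imCLM.intervalIntegral_comp_comm
    ((contDiff_speed q).continuous.intervalIntegrable (μ := MeasureTheory.volume) 0 (2 * Real.pi))
  rw [integral_def]
  simp only [← speed_im]
  exact h.symm

theorem Hcl_eq_zero_iff (q : Maps) : Hcl q = 0 ↔
    integral (q.q₁ ^ 2 * q.q₂.cosFun) = 0 ∧ integral (q.q₁ ^ 2 * q.q₂.sinFun) = 0 := by
  rw [Complex.ext_iff, Hcl_re, Hcl_im]
  rfl

theorem gradHcl_zero (q : Maps) : gradHcl q 0 =
    ((1 / 2 : ℝ) • (q.q₁ * q.q₂.cosFun), -q.q₂.sinFun, 0) := by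
  refine Prod.ext (SmoothFun.ext fun θ => ?_) rfl
  exact mul_assoc _ _ _

theorem gradHcl_one (q : Maps) : gradHcl q 1 =
    ((1 / 2 : ℝ) • (q.q₁ * q.q₂.sinFun), q.q₂.cosFun, 0) := by
  refine Prod.ext (SmoothFun.ext fun θ => ?_) rfl
  exact mul_assoc _ _ _

theorem GL2_gradHcl_zero (q : Maps) (h : Model) : GL2 q (gradHcl q 0) h =
    integral ((2 : ℝ) • (q.q₁ * h.1 * q.q₂.cosFun) - q.q₁ ^ 2 * (q.q₂.sinFun * h.2.1)) := by
  rw [GL2_eq, gradHcl_zero]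
  congr 1
  ext θ
  simp [GDensity]
  ring

theorem GL2_gradHcl_one (q : Maps) (h : Model) : GL2 q (gradHcl q 1) h =
    integral ((2 : ℝ) • (q.q₁ * h.1 * q.q₂.sinFun) + q.q₁ ^ 2 * (q.q₂.cosFun * h.2.1)) := by
  rw [GL2_eq, gradHcl_one]
  congr 1
  ext θ
  simp [GDensity]
  ring

/-- The integral is continuous and linear, so it commutes with the time derivative, and the
integrand is differentiated by the product rule at each θ. -/
theorem isGradientAt_HclComp (q : Maps) (i : Fin 2) : IsGradientAt (HclComp i) q (gradHcl q i) := by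
  rintro γ h hγ rfl hv
  fin_cases i
  · change HasDerivAt (fun t => (Hcl (γ t)).re) (GL2 (γ 0) (gradHcl (γ 0) 0) h) 0
    simp only [Hcl_re]
    rw [GL2_gradHcl_zero]
    refine (IsSmoothCurve.hasCurveDeriv_of_pointwise ((hγ.q₁.pow 2).mul hγ.cosFun) fun θ => ?_).integral
    simp only [mul_apply, pow_apply]
    refine (((hv.q₁ θ).pow 2).mul (hv.cosFun θ)).congr_deriv ?_
    simp
    ring
  · change HasDerivAt (fun t => (Hcl (γ t)).im) (GL2 (γ 0) (gradHcl (γ 0) 1) h) 0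
    simp only [Hcl_im]
    rw [GL2_gradHcl_one]
    refine (IsSmoothCurve.hasCurveDeriv_of_pointwise ((hγ.q₁.pow 2).mul hγ.sinFun) fun θ => ?_).integral
    simp only [mul_apply, pow_apply]
    refine (((hv.q₁ θ).pow 2).mul (hv.sinFun θ)).congr_deriv ?_
    simp
    ring

/-! ### The image of the transform and its inverse -/

theorem mem_imOp_iff {q : Maps} : q ∈ imOp ↔ q.q₃ = q.q₁ ^ 2 * q.q₂.derivFun := by
  have hpos := q.pos
  constructor
  · intro h
    ext θ
    have := h θ
    rw [← SmoothAngleFun.derivFun_apply] at this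
    rw [mul_apply, pow_apply, this, mul_inv_cancel_left₀ (pow_ne_zero 2 (hpos θ).ne')]
  · intro h θ
    rw [← SmoothAngleFun.derivFun_apply, h, mul_apply, pow_apply,
      inv_mul_cancel_left₀ (pow_ne_zero 2 (hpos θ).ne')]

namespace Imm

theorem hasDerivAt_tangent (c : Imm) (θ : ℝ) : HasDerivAt c.tangent (deriv c.tangent θ) θ :=
  (c.contDiff_tangent.differentiable (by simp) θ).hasDerivAt

theorem curvature_eq (c : Imm) (θ : ℝ) : c.curvature θ = ‖deriv c θ‖⁻¹ *
    ((c.tangent θ).re * (deriv c.tangent θ).im - (c.tangent θ).im * (deriv c.tangent θ).re) := by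
  rw [curvature, Ds, normal, real_inner_smul_left, Complex.inner]
  simp
  left
  ring

theorem angDeriv_rTransform (c : Imm) (θ : ℝ) : c.rTransform.q₂.angDeriv θ =
    (c.tangent θ).re * (deriv c.tangent θ).im - (c.tangent θ).im * (deriv c.tangent θ).re := by
  have h1 : HasDerivAt (fun x => (c.turningAngle x).sin) (deriv c.tangent θ).im θ := by
    simp only [sin_turningAngle]
    exact Complex.imCLM.hasFDerivAt.comp_hasDerivAt θ (c.hasDerivAt_tangent θ)
  have h2 : HasDerivAt (fun x => (c.turningAngle x).cos) (deriv c.tangent θ).re θ := by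
    simp only [cos_turningAngle]
    exact Complex.reCLM.hasFDerivAt.comp_hasDerivAt θ (c.hasDerivAt_tangent θ)
  change (c.turningAngle θ).cos * deriv (fun x => (c.turningAngle x).sin) θ -
    (c.turningAngle θ).sin * deriv (fun x => (c.turningAngle x).cos) θ = _
  rw [h1.deriv, h2.deriv, cos_turningAngle, sin_turningAngle]

/-- This yields both the closing condition, as the integral of c' over a period, and injectivity of
R modulo translations. -/
theorem speed_rTransform (c : Imm) (θ : ℝ) : speed c.rTransform θ = deriv c θ := by
  have h1 : (((c.turningAngle θ).toCircle : Circle) : ℂ) = c.tangent θ := by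
    rw [coe_toCircle_eq, cos_turningAngle, sin_turningAngle, Complex.re_add_im]
  have h2 := (c.norm_deriv_pos θ).ne'
  change ((Real.sqrt ‖deriv c θ‖ : ℝ) : ℂ) ^ 2 * (((c.turningAngle θ).toCircle : Circle) : ℂ) = _
  rw [h1, ← Complex.ofReal_pow, Real.sq_sqrt (norm_nonneg _), tangent, Ds, Complex.real_smul,
    Complex.ofReal_inv, mul_inv_cancel_left₀ (by exact_mod_cast h2)]

theorem rTransform_mem_imCl (c : Imm) : c.rTransform ∈ imCl := by
  constructor
  · intro θ
    have h2 := (c.norm_deriv_pos θ).ne'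
    rw [angDeriv_rTransform]
    change _ = ((Real.sqrt ‖deriv c θ‖) ^ 2)⁻¹ * (c.curvature θ * ‖deriv c θ‖ ^ 2)
    rw [Real.sq_sqrt (norm_nonneg _), curvature_eq]
    field_simp
  · change ∫ θ in (0 : ℝ)..2 * Real.pi, speed c.rTransform θ = 0
    simp only [speed_rTransform]
    have hd : Differentiable ℝ c.toFun := c.smooth.differentiable (by simp)
    rw [intervalIntegral.integral_deriv_eq_sub (fun θ _ => hd θ)
      (c.contDiff_deriv.continuous.intervalIntegrable _ _)]
    have := c.periodic 0
    rw [zero_add] at this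
    rw [this, sub_self]

end Imm

theorem periodic_speed (q : Maps) : Function.Periodic (speed q) (2 * Real.pi) := fun θ => by
  simp only [speed, q.q₁.periodic θ, q.q₂.periodic θ]

theorem speed_eq_smul (q : Maps) (θ : ℝ) : speed q θ = (q.q₁ θ ^ 2) • ((q.q₂ θ).toCircle : ℂ) := by
  rw [speed, Complex.real_smul, Complex.ofReal_pow]

theorem norm_speed (q : Maps) (θ : ℝ) : ‖speed q θ‖ = q.q₁ θ ^ 2 := by
  rw [speed_eq_smul, norm_smul, Circle.norm_coe, mul_one, Real.norm_of_nonneg (sq_nonneg _)]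

theorem hasDerivAt_integral_speed (q : Maps) (θ : ℝ) :
    HasDerivAt (fun θ => ∫ σ in (0 : ℝ)..θ, speed q σ) (speed q θ) θ :=
  ((contDiff_speed q).continuous.integral_hasStrictDerivAt 0 θ).hasDerivAt

/-- The closed curve `θ ↦ ∫₀^θ q₁² exp(iq₂)` defined by a point `q` satisfying the closing
condition. -/
def curveOf (q : Maps) (hq : Hcl q = 0) : Imm where
  toFun θ := ∫ σ in (0 : ℝ)..θ, speed q σ
  smooth := contDiff_infty_iff_deriv.2 ⟨fun θ => (hasDerivAt_integral_speed q θ).differentiableAt, by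
    rw [funext fun θ => (hasDerivAt_integral_speed q θ).deriv]
    exact contDiff_speed q⟩
  periodic θ := by
    -- The increment over a period starting at θ equals the one starting at 0, which is the closing
    -- integral.
    have h1 := (periodic_speed q).intervalIntegral_add_eq θ 0
    rw [zero_add, show ∫ σ in (0 : ℝ)..2 * Real.pi, speed q σ = 0 from hq] at h1
    have hi := fun a b => (contDiff_speed q).continuous.intervalIntegrable
      (μ := MeasureTheory.volume) a b
    beta_reduce
    rw [← intervalIntegral.integral_add_adjacent_intervals (hi 0 θ) (hi _ _), h1, add_zero]
  immersed θ := by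
    rw [(hasDerivAt_integral_speed q θ).deriv, ← norm_pos_iff, norm_speed]
    exact pow_pos (q.pos θ) 2

theorem deriv_curveOf (q : Maps) (hq : Hcl q = 0) (θ : ℝ) : deriv (curveOf q hq) θ = speed q θ :=
  (hasDerivAt_integral_speed q θ).deriv

theorem tangent_curveOf (q : Maps) (hq : Hcl q = 0) (θ : ℝ) :
    (curveOf q hq).tangent θ = ((q.q₂ θ).toCircle : ℂ) := by
  have h := pow_pos (q.pos θ) 2
  rw [Imm.tangent, Imm.Ds, deriv_curveOf, norm_speed, speed_eq_smul, inv_smul_smul₀ h.ne']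

theorem turningAngle_curveOf (q : Maps) (hq : Hcl q = 0) (θ : ℝ) :
    (curveOf q hq).turningAngle θ = q.q₂ θ := by
  apply SmoothAngleFun.angle_ext
  · rw [Imm.cos_turningAngle, tangent_curveOf, coe_toCircle_eq]
    simp
  · rw [Imm.sin_turningAngle, tangent_curveOf, coe_toCircle_eq]
    simp

theorem rTransform_curveOf {q : Maps} (hq : q ∈ imCl) : (curveOf q hq.2).rTransform = q := by
  have h1 : ∀ θ, (curveOf q hq.2).rTransform.q₁ θ = q.q₁ θ := fun θ => by
    change Real.sqrt ‖deriv (curveOf q hq.2) θ‖ = _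
    rw [deriv_curveOf, norm_speed, Real.sqrt_sq (q.pos θ).le]
  have h2 : (curveOf q hq.2).rTransform.q₂ = q.q₂ :=
    SmoothAngleFun.ext_fun fun θ => turningAngle_curveOf q hq.2 θ
  refine Maps.ext_fun h1 (fun θ => by rw [h2]) fun θ => ?_
  -- Both points satisfy the constraint, so agreement of the first two components forces agreement
  -- of the third; the curvature of the curve is not computed again.
  have e1 := mem_imOp_iff.1 hq.1
  have e2 := mem_imOp_iff.1 (curveOf q hq.2).rTransform_mem_imCl.1
  rw [e1, e2, h2, mul_apply, mul_apply, pow_apply, pow_apply, h1]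

theorem R_mk (c : Imm) : R (Quotient.mk Imm.translationSetoid c) = c.rTransform := rfl

theorem range_R : Set.range R = imCl := by
  ext q
  constructor
  · rintro ⟨x, rfl⟩
    induction x using Quotient.inductionOn with
    | h c => exact c.rTransform_mem_imCl
  · intro hq
    exact ⟨Quotient.mk _ (curveOf q hq.2), rTransform_curveOf hq⟩

theorem R_eq_iff {q : Maps} (hq : q ∈ imCl) (x : ImmModTra) :
    R x = q ↔ x = Quotient.mk Imm.translationSetoid (curveOf q hq.2) := by
  constructor
  · induction x using Quotient.inductionOn with
    | h d =>
      intro h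
      rw [R_mk] at h
      apply Quotient.sound
      set c := curveOf q hq.2 with hc
      have hd : ∀ θ, deriv d θ = deriv c θ := fun θ => by
        rw [← d.speed_rTransform, h, hc, deriv_curveOf]
      have hdd : Differentiable ℝ d.toFun := d.smooth.differentiable (by simp)
      have hdc : Differentiable ℝ c.toFun := c.smooth.differentiable (by simp)
      refine ⟨c 0 - d 0, fun θ => ?_⟩
      have h3 := is_const_of_deriv_eq_zero (f := fun θ => c θ - d θ) (hdc.sub hdd) (fun x => by
        have := ((hdc x).hasDerivAt.sub (hdd x).hasDerivAt).deriv
        rw [hd x, sub_self] at this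
        exact this) θ 0
      linear_combination h3
  · rintro rfl
    exact rTransform_curveOf hq

/-! ### The orthogonal projection without the closing condition -/

/-- The linearization of `q₃ = q₁² q₂'` at `q`, solved for the third component. -/
def linThird (q : Maps) (h₁ h₂ : SmoothFun) : SmoothFun :=
  (2 : ℝ) • (q.q₁ * q.q₂.derivFun * h₁) + q.q₁ ^ 2 * D h₂

theorem linThird_add (q : Maps) (h₁ h₂ k₁ k₂ : SmoothFun) :
    linThird q (h₁ + k₁) (h₂ + k₂) = linThird q h₁ h₂ + linThird q k₁ k₂ := by
  simp only [linThird, mul_add, smul_add, map_add]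
  abel

theorem linThird_smul (q : Maps) (r : ℝ) (h₁ h₂ : SmoothFun) :
    linThird q (r • h₁) (r • h₂) = r • linThird q h₁ h₂ := by
  simp only [linThird, map_smul, mul_smul_comm, smul_add]
  rw [smul_comm]

/-- The tangent space at `q` of the set of solutions of `q₂' = q₁⁻² q₃`. -/
def tangentOp (q : Maps) : Submodule ℝ Model where
  carrier := {h | h.2.2 = linThird q h.1 h.2.1}
  add_mem' {h k} hh hk := by
    change h.2.2 + k.2.2 = linThird q (h.1 + k.1) (h.2.1 + k.2.1)
    rw [linThird_add, hh, hk]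
  zero_mem' := by
    have := linThird_smul q 0 0 0
    simp only [zero_smul] at this
    exact this.symm
  smul_mem' r h hh := by
    change r • h.2.2 = linThird q (r • h.1) (r • h.2.1)
    rw [linThird_smul, hh]

theorem mem_tangentOp {q : Maps} {h : Model} :
    h ∈ tangentOp q ↔ h.2.2 = linThird q h.1 h.2.1 := Iff.rfl

theorem den_pos (q : Maps) (θ : ℝ) : 0 < (q.q₁ ^ 8 + q.q₃ ^ 2) θ := by
  have := q.pos θ
  simp only [add_apply, pow_apply]
  positivity

/-- The function `(q₁⁸ + q₃²)⁻¹`. -/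
def invDen (q : Maps) : SmoothFun := invF (q.q₁ ^ 8 + q.q₃ ^ 2) (den_pos q)

/-- The leading coefficient as a smooth function. -/
def leading (q : Maps) : SmoothFun := q.q₁ ^ 6 * invDen q

/-- The inverse of the leading coefficient. -/
def invLeading (q : Maps) : SmoothFun :=
  (q.q₁ ^ 8 + q.q₃ ^ 2) * invF (q.q₁ ^ 6) (pow_pos_of_pos q.pos 6)

theorem leading_mul_invLeading (q : Maps) : leading q * invLeading q = 1 := by
  have h1 := mul_invF _ (den_pos q)
  have h2 := mul_invF _ (pow_pos_of_pos q.pos 6)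
  rw [leading, invLeading, invDen]
  linear_combination h2 + (q.q₁ ^ 6 * invF (q.q₁ ^ 6) (pow_pos_of_pos q.pos 6)) * h1

theorem leading_pos (q : Maps) (θ : ℝ) : 0 < leading q θ :=
  mul_pos (pow_pos_of_pos q.pos 6 θ) (inv_pos.2 (den_pos q θ))

/-- The function `(2 q₁³ q₃ h₁ - q₁⁴ h₃) / (q₁⁸ + q₃²)`. -/
def flux (q : Maps) : Model →ₗ[ℝ] SmoothFun where
  toFun h := ((2 : ℝ) • (q.q₁ ^ 3 * q.q₃ * h.1) - q.q₁ ^ 4 * h.2.2) * invDen q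
  map_add' h k := by
    simp only [Prod.fst_add, Prod.snd_add, mul_add, smul_add]
    ring
  map_smul' r h := by
    simp only [Prod.smul_fst, Prod.smul_snd, mul_smul_comm, RingHom.id_apply]
    rw [smul_comm, ← smul_sub, smul_mul_assoc]

theorem flux_apply (q : Maps) (h : Model) :
    flux q h = ((2 : ℝ) • (q.q₁ ^ 3 * q.q₃ * h.1) - q.q₁ ^ 4 * h.2.2) * invDen q := rfl

/-- The right hand side of the elliptic equation. -/
def ellRhs (q : Maps) : Model →ₗ[ℝ] SmoothFun where
  toFun h := q.q₁ ^ 2 * h.2.1 + D (flux q h)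
  map_add' h k := by
    simp only [Prod.fst_add, Prod.snd_add, mul_add, map_add]
    abel
  map_smul' r h := by
    simp only [Prod.smul_fst, Prod.smul_snd, mul_smul_comm, map_smul, RingHom.id_apply, smul_add]

theorem ellRhs_apply (q : Maps) (h : Model) : ellRhs q h = q.q₁ ^ 2 * h.2.1 + D (flux q h) := rfl

theorem ellRhs_apply_apply (q : Maps) (h : Model) (θ : ℝ) : ellRhs q h θ = coeffB q h θ := by
  rw [ellRhs_apply, add_apply, mul_apply, pow_apply, D_apply, coeffB]
  congr 2
  funext x
  simp only [flux_apply, invDen, mul_apply, sub_apply, smul_apply, add_apply, pow_apply, invF_apply]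
  ring

/-- The solution operator of the elliptic equation. -/
def ellEquiv (q : Maps) : SmoothFun ≃ₗ[ℝ] SmoothFun :=
  LinearEquiv.ofBijective (ellOp (q.q₁ ^ 2) (leading q))
    ⟨(injective_iff_map_eq_zero _).2 fun _ h =>
        eq_zero_of_ellOp_eq_zero (pow_pos_of_pos q.pos 2) (leading_pos q) h,
      exists_ellOp_eq (leading_mul_invLeading q) (pow_pos_of_pos q.pos 2) (leading_pos q)⟩

theorem solvesElliptic_iff {q : Maps} {h : Model} {u : SmoothFun} :
    SolvesElliptic q h u ↔ u = (ellEquiv q).symm (ellRhs q h) := by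
  rw [LinearEquiv.eq_symm_apply]
  have e : ∀ θ, ellEquiv q u θ =
      (q.q₁ θ) ^ 2 * u θ - deriv (fun x => coeffA q x * deriv u x) θ := fun θ => by
    change ellOp _ _ u θ = _
    rw [ellOp_apply, sub_apply, mul_apply, pow_apply, D_apply]
    congr 2
  constructor
  · intro H
    ext θ
    rw [e, H, ellRhs_apply_apply]
  · intro H θ
    rw [← e, H, ellRhs_apply_apply]

/-- The second component of the projection. -/
def popSecond (q : Maps) : Model →ₗ[ℝ] SmoothFun := (ellEquiv q).symm.toLinearMap ∘ₗ ellRhs q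

theorem ellOp_popSecond (q : Maps) (h : Model) :
    ellOp (q.q₁ ^ 2) (leading q) (popSecond q h) = ellRhs q h :=
  (ellEquiv q).apply_symm_apply _

/-- The first component of the projection. -/
def popFirst (q : Maps) : Model →ₗ[ℝ] SmoothFun where
  toFun h := (q.q₁ ^ 8 * h.1 + (1 / 2 : ℝ) • (q.q₁ * q.q₃ * h.2.2 -
    q.q₁ ^ 3 * q.q₃ * D (popSecond q h))) * invDen q
  map_add' h k := by
    simp only [Prod.fst_add, Prod.snd_add, map_add, mul_add, add_sub_add_comm, smul_add]
    ring
  map_smul' r h := by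
    simp only [Prod.smul_fst, Prod.smul_snd, map_smul, mul_smul_comm, RingHom.id_apply, ← smul_sub]
    rw [smul_comm, ← smul_add, smul_mul_assoc]

theorem popFirst_apply (q : Maps) (h : Model) : popFirst q h =
    (q.q₁ ^ 8 * h.1 + (1 / 2 : ℝ) • (q.q₁ * q.q₃ * h.2.2 -
      q.q₁ ^ 3 * q.q₃ * D (popSecond q h))) * invDen q := rfl

/-- The orthogonal projection to the tangent space without the closing condition. -/
def Pop (q : Maps) : Model →ₗ[ℝ] Model where
  toFun h := (popFirst q h, popSecond q h, linThird q (popFirst q h) (popSecond q h))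
  map_add' h k := by
    rw [map_add, map_add, linThird_add]
    rfl
  map_smul' r h := by
    rw [map_smul, map_smul, linThird_smul]
    rfl

theorem Pop_apply (q : Maps) (h : Model) :
    Pop q h = (popFirst q h, popSecond q h, linThird q (popFirst q h) (popSecond q h)) := rfl

theorem Pop_mem (q : Maps) (h : Model) : Pop q h ∈ tangentOp q := rfl

theorem isGivenByElliptic_Pop (q : Maps) (h : Model) : IsGivenByElliptic q h (Pop q h) := by
  refine ⟨solvesElliptic_iff.2 rfl, fun u hu => solvesElliptic_iff.1 hu, fun θ => ?_, fun θ => ?_⟩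
  · have := (den_pos q θ).ne'
    rw [Pop_apply, popFirst_apply]
    simp only [add_apply, pow_apply] at this
    simp only [mul_apply, add_apply, smul_apply, sub_apply, pow_apply, invDen, invF_apply, D_apply]
    field_simp
    ring
  · rw [Pop_apply]
    simp only [linThird, add_apply, smul_apply, mul_apply, pow_apply,
      SmoothAngleFun.derivFun_apply, D_apply]
    ring

/-- Write k for the projection of h. Its first component is chosen so that the coefficient of a₁
vanishes. What remains is q₁²(h₂ - k₂)a₂ + q₁⁻⁴(h₃ - k₃)a₂', where q₁⁻⁴(h₃ - k₃) is minus the flux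
term; the elliptic equation says exactly that this is a total derivative. -/
theorem GDensity_sub_Pop {q : Maps} (hq : q ∈ imOp) (h : Model) {a : Model}
    (ha : a ∈ tangentOp q) : GDensity q (h - Pop q h) a =
      D (-(flux q h + leading q * D (popSecond q h)) * a.2.1) := by
  have hell := ellOp_popSecond q h
  rw [ellOp_apply, ellRhs_apply] at hell
  rw [mem_tangentOp] at ha
  have e1 : D (-(flux q h + leading q * D (popSecond q h))) =
      q.q₁ ^ 2 * (h.2.1 - popSecond q h) := by
    rw [map_neg, map_add]
    linear_combination hell
  rw [D_mul, e1]
  ext θ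
  have h1 := (q.pos θ).ne'
  have h2 := (den_pos q θ).ne'
  have h3 : q.q₂.derivFun θ = q.q₃ θ / q.q₁ θ ^ 2 := by
    rw [mem_imOp_iff.1 hq, mul_apply, pow_apply, mul_div_cancel_left₀ _ (pow_ne_zero 2 h1)]
  simp only [add_apply, pow_apply] at h2
  simp only [GDensity, Pop_apply, Prod.fst_sub, Prod.snd_sub, ha, linThird, popFirst_apply,
    flux_apply, leading, invDen, mul_apply, add_apply, smul_apply, sub_apply, neg_apply, pow_apply,
    invF_apply, h3]
  field_simp
  ring

theorem isOrthProj_Pop {q : Maps} (hq : q ∈ imOp) (h : Model) :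
    IsOrthProj q (tangentOp q) h (Pop q h) := by
  refine ⟨Pop_mem q h, fun a ha => ?_⟩
  rw [GL2_eq, GDensity_sub_Pop hq h ha, integral_D]

section Smooth

variable {γ : ℝ → Maps} {h : ℝ → Model}

theorem IsSmoothCurveInMaps.invDen (hγ : IsSmoothCurveInMaps γ) :
    IsSmoothCurve (fun t => invDen (γ t)) :=
  ((hγ.q₁.pow 8).add (hγ.q₃.pow 2)).invF fun t => den_pos (γ t)

theorem IsSmoothCurveInMaps.leading (hγ : IsSmoothCurveInMaps γ) :
    IsSmoothCurve (fun t => leading (γ t)) := (hγ.q₁.pow 6).mul hγ.invDen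

theorem IsSmoothCurveInMaps.invLeading (hγ : IsSmoothCurveInMaps γ) :
    IsSmoothCurve (fun t => invLeading (γ t)) :=
  ((hγ.q₁.pow 8).add (hγ.q₃.pow 2)).mul
    ((hγ.q₁.pow 6).invF fun t => pow_pos_of_pos (γ t).pos 6)

theorem IsSmoothCurveInMaps.ellRhs (hγ : IsSmoothCurveInMaps γ) (hh : IsSmoothCurve h) :
    IsSmoothCurve (fun t => ellRhs (γ t) (h t)) := by
  simp only [ellRhs_apply, flux_apply]
  exact ((hγ.q₁.pow 2).mul hh.snd.fst).add
    (((IsSmoothCurve.smul contDiff_const (((hγ.q₁.pow 3).mul hγ.q₃).mul hh.fst)).sub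
      ((hγ.q₁.pow 4).mul hh.snd.snd)).mul hγ.invDen).D

theorem IsSmoothCurveInMaps.popSecond (hγ : IsSmoothCurveInMaps γ) (hh : IsSmoothCurve h) :
    IsSmoothCurve (fun t => popSecond (γ t) (h t)) :=
  isSmoothCurve_of_ellOp (hγ.q₁.pow 2) hγ.leading hγ.invLeading (hγ.ellRhs hh)
    (fun t => leading_mul_invLeading (γ t)) (fun t => pow_pos_of_pos (γ t).pos 2)
    (fun t => leading_pos (γ t)) (fun t => ellOp_popSecond (γ t) (h t))

theorem IsSmoothCurveInMaps.popFirst (hγ : IsSmoothCurveInMaps γ) (hh : IsSmoothCurve h) :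
    IsSmoothCurve (fun t => popFirst (γ t) (h t)) := by
  simp only [popFirst_apply]
  exact (((hγ.q₁.pow 8).mul hh.fst).add (IsSmoothCurve.smul contDiff_const
    (((hγ.q₁.mul hγ.q₃).mul hh.snd.snd).sub
      (((hγ.q₁.pow 3).mul hγ.q₃).mul (hγ.popSecond hh).D)))).mul hγ.invDen

theorem IsSmoothCurveInMaps.Pop (hγ : IsSmoothCurveInMaps γ) (hh : IsSmoothCurve h) :
    IsSmoothCurve (fun t => Pop (γ t) (h t)) := by
  have h1 := hγ.popFirst hh
  have h2 := hγ.popSecond hh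
  exact h1.prodMk (h2.prodMk ((IsSmoothCurve.smul contDiff_const
    ((hγ.q₁.mul hγ.derivFun).mul h1)).add ((hγ.q₁.pow 2).mul h2.D)))

theorem IsSmoothCurveInMaps.gradHcl (hγ : IsSmoothCurveInMaps γ) (i : Fin 2) :
    IsSmoothCurve (fun t => gradHcl (γ t) i) := by
  fin_cases i
  · simp only [Fin.zero_eta, gradHcl_zero]
    exact (IsSmoothCurve.smul contDiff_const (hγ.q₁.mul hγ.cosFun)).prodMk
      (hγ.sinFun.neg.prodMk (isSmoothCurve_const 0))
  · simp only [Fin.mk_one, gradHcl_one]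
    exact (IsSmoothCurve.smul contDiff_const (hγ.q₁.mul hγ.sinFun)).prodMk
      (hγ.cosFun.prodMk (isSmoothCurve_const 0))

theorem IsSmoothCurve.sub_model {h k : ℝ → Model} (hh : IsSmoothCurve h) (hk : IsSmoothCurve k) :
    IsSmoothCurve (fun t => h t - k t) :=
  (hh.fst.sub hk.fst).prodMk ((hh.snd.fst.sub hk.snd.fst).prodMk (hh.snd.snd.sub hk.snd.snd))

theorem IsSmoothCurve.smul_model {b : ℝ → ℝ} (hb : ContDiff ℝ ∞ b) (hh : IsSmoothCurve h) :
    IsSmoothCurve (fun t => b t • h t) :=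
  (IsSmoothCurve.smul hb hh.fst).prodMk
    ((IsSmoothCurve.smul hb hh.snd.fst).prodMk (IsSmoothCurve.smul hb hh.snd.snd))

end Smooth

/-! ### Projecting off the gradients of the closing condition -/

/-- The projection to the orthogonal complement of a vector. -/
def projOff (q : Maps) (w : Model) : Model →ₗ[ℝ] Model :=
  LinearMap.id - (GForm q w).smulRight ((GL2 q w w)⁻¹ • w)

theorem projOff_apply (q : Maps) (w h : Model) :
    projOff q w h = h - (GL2 q w h * (GL2 q w w)⁻¹) • w := by
  rw [mul_smul]
  rfl

theorem GL2_sub_right (q : Maps) (h k l : Model) : GL2 q h (k - l) = GL2 q h k - GL2 q h l :=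
  (GForm q h).map_sub k l

theorem GL2_smul_right (q : Maps) (r : ℝ) (h k : Model) : GL2 q h (r • k) = r * GL2 q h k :=
  (GForm q h).map_smul r k

theorem GL2_sub_left (q : Maps) (h k l : Model) : GL2 q (h - k) l = GL2 q h l - GL2 q k l := by
  rw [GL2_comm, GL2_sub_right, GL2_comm, GL2_comm q l]

theorem GL2_smul_left (q : Maps) (r : ℝ) (h k : Model) : GL2 q (r • h) k = r * GL2 q h k := by
  rw [GL2_comm, GL2_smul_right, GL2_comm]

theorem GL2_projOff (q : Maps) {w : Model} (hw : w ≠ 0) (h : Model) :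
    GL2 q w (projOff q w h) = 0 := by
  have : GL2 q w w ≠ 0 := fun H => hw (GL2_self_eq_zero H)
  rw [projOff_apply, GL2_sub_right, GL2_smul_right, inv_mul_cancel_right₀ this, sub_self]

theorem GL2_projOff_of_orth (q : Maps) {w k : Model} (hk : GL2 q k w = 0) (h : Model) :
    GL2 q k (projOff q w h) = GL2 q k h := by
  rw [projOff_apply, GL2_sub_right, GL2_smul_right, hk, mul_zero, sub_zero]

theorem IsSmoothCurveInMaps.projOff {γ : ℝ → Maps} (hγ : IsSmoothCurveInMaps γ) {w h : ℝ → Model}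
    (hw : IsSmoothCurve w) (hw0 : ∀ t, w t ≠ 0) (hh : IsSmoothCurve h) :
    IsSmoothCurve (fun t => projOff (γ t) (w t) (h t)) := by
  simp only [projOff_apply]
  exact hh.sub_model (IsSmoothCurve.smul_model ((hγ.GL2 hw hh).mul
    ((hγ.GL2 hw hw).inv fun t H => hw0 t (GL2_self_eq_zero H))) hw)

/-- The projection to the orthogonal complement of two vectors, by orthogonalization. -/
def projOff₂ (q : Maps) (v w : Model) : Model →ₗ[ℝ] Model :=
  projOff q (projOff q v w) ∘ₗ projOff q v

theorem projOff₂_apply (q : Maps) (v w h : Model) :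
    projOff₂ q v w h = projOff q (projOff q v w) (projOff q v h) := rfl

theorem projOff_ne_zero {q : Maps} {v w : Model} (H : ∀ s t : ℝ, s • v + t • w = 0 → s = 0 ∧ t = 0) :
    projOff q v w ≠ 0 := fun h => by
  rw [projOff_apply, sub_eq_add_neg, ← neg_smul, add_comm] at h
  exact one_ne_zero (H (-(GL2 q v w * (GL2 q v v)⁻¹)) 1 (by rwa [one_smul])).2

/-- Gram–Schmidt: w is first made orthogonal to v, so removing the new vector preserves
orthogonality to v, and orthogonality to w follows by linearity. -/
theorem GL2_projOff₂ {q : Maps} {v w : Model}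
    (H : ∀ s t : ℝ, s • v + t • w = 0 → s = 0 ∧ t = 0) (h : Model) :
    GL2 q v (projOff₂ q v w h) = 0 ∧ GL2 q w (projOff₂ q v w h) = 0 := by
  have hv : v ≠ 0 := fun hv => one_ne_zero (H 1 0 (by simp [hv])).1
  have h1 : GL2 q v (projOff₂ q v w h) = 0 := by
    rw [projOff₂_apply, GL2_projOff_of_orth q (GL2_projOff q hv w), GL2_projOff q hv]
  refine ⟨h1, ?_⟩
  have h2 : GL2 q (projOff q v w) (projOff₂ q v w h) = 0 := GL2_projOff q (projOff_ne_zero H) _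
  have h3 := projOff_apply q v w
  rw [h3, GL2_sub_left, GL2_smul_left, h1, mul_zero, sub_zero] at h2
  exact h2

theorem sub_projOff_mem (q : Maps) {S : Submodule ℝ Model} {w : Model} (hw : w ∈ S) (h : Model) :
    h - projOff q w h ∈ S := by
  rw [projOff_apply, sub_sub_cancel]
  exact S.smul_mem _ hw

theorem sub_projOff₂_mem (q : Maps) {S : Submodule ℝ Model} {v w : Model} (hv : v ∈ S) (hw : w ∈ S)
    (h : Model) : h - projOff₂ q v w h ∈ S := by
  have h1 : projOff q v w ∈ S := by
    have := S.sub_mem hw (sub_projOff_mem q hv w)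
    rwa [sub_sub_cancel] at this
  have := S.add_mem (sub_projOff_mem q hv h) (sub_projOff_mem q h1 (projOff q v h))
  rwa [sub_add_sub_cancel] at this

/-- A vanishing combination means that g = sg¹ + tg² projects to zero, hence is orthogonal to every
tangent vector, in particular to one sharing its first two components. The closing condition plays
no role. -/
theorem linearIndependent_Pop_grad {q : Maps} (hq : q ∈ imOp) (s t : ℝ)
    (H : s • Pop q (gradHcl q 0) + t • Pop q (gradHcl q 1) = 0) : s = 0 ∧ t = 0 := by
  rw [← map_smul, ← map_smul, ← map_add] at H
  set g := s • gradHcl q 0 + t • gradHcl q 1 with hg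
  -- The third component is the one forced by tangency; it does not contribute to the pairing
  -- because g has zero third component.
  let a : Model := (g.1, g.2.1, linThird q g.1 g.2.1)
  have ha : a ∈ tangentOp q := rfl
  have h1 := (isOrthProj_Pop hq g).2 a ha
  rw [H, sub_zero, GL2_eq] at h1
  have h2 : GDensity q g a = (s ^ 2 + t ^ 2) • q.q₁ ^ 2 := by
    ext θ
    have h3 : (q.q₂ θ).cos ^ 2 + (q.q₂ θ).sin ^ 2 = 1 := Real.Angle.cos_sq_add_sin_sq _
    simp only [GDensity, a, hg, gradHcl_zero, gradHcl_one, Prod.fst_add, Prod.snd_add,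
      Prod.smul_fst, Prod.smul_snd, add_apply, mul_apply, smul_apply, neg_apply, pow_apply,
      smul_zero, zero_apply, SmoothAngleFun.cosFun_apply, SmoothAngleFun.sinFun_apply]
    linear_combination (s ^ 2 + t ^ 2) * q.q₁ θ ^ 2 * h3
  rw [h2, map_smul, smul_eq_mul] at h1
  have h4 : 0 < integral (q.q₁ ^ 2) := integral_pos (pow_pos_of_pos q.pos 2)
  have h5 : s ^ 2 + t ^ 2 = 0 := (mul_eq_zero.1 h1).resolve_right h4.ne'
  constructor <;> nlinarith [sq_nonneg s, sq_nonneg t]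

/-- The tangent space at `q` of the image of the transform. -/
def tangentCl (q : Maps) : Submodule ℝ Model :=
  tangentOp q ⊓ (LinearMap.ker (GForm q (gradHcl q 0)) ⊓ LinearMap.ker (GForm q (gradHcl q 1)))

theorem mem_tangentCl {q : Maps} {h : Model} : h ∈ tangentCl q ↔
    h ∈ tangentOp q ∧ GL2 q (gradHcl q 0) h = 0 ∧ GL2 q (gradHcl q 1) h = 0 := Iff.rfl

/-- The projection off the vectors `vⁱ`. -/
def projT (q : Maps) : Model →ₗ[ℝ] Model :=
  projOff₂ q (Pop q (gradHcl q 0)) (Pop q (gradHcl q 1))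

theorem isProjToComplement_projT {q : Maps} (hq : q ∈ imOp) (h : Model) :
    IsProjToComplement q (fun i : Fin 2 => Pop q (gradHcl q i)) h (projT q h) := by
  constructor
  · intro a ha
    have h1 := GL2_projOff₂ (q := q) (linearIndependent_Pop_grad hq) h
    have h2 : Submodule.span ℝ (Set.range fun i : Fin 2 => Pop q (gradHcl q i)) ≤
        LinearMap.ker (GForm q (projT q h)) := by
      rw [Submodule.span_le]
      rintro _ ⟨i, rfl⟩
      change GL2 q (projT q h) _ = 0
      rw [GL2_comm]
      fin_cases i
      · exact h1.1
      · exact h1.2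
    exact h2 ha
  · exact sub_projOff₂_mem q (Submodule.subset_span (Set.mem_range_self 0))
      (Submodule.subset_span (Set.mem_range_self 1)) h

theorem GL2_Pop_left {q : Maps} (hq : q ∈ imOp) (g : Model) {a : Model} (ha : a ∈ tangentOp q) :
    GL2 q (Pop q g) a = GL2 q g a := by
  have := (isOrthProj_Pop hq g).2 a ha
  rw [GL2_sub_left] at this
  linarith

/-- On vectors tangent to the open constraint, pairing with vⁱ equals pairing with the gradient, by
`GL2_Pop_left`. Removing the vⁱ stays within these vectors, enforces the two closing equations, and
changes the projection only by vectors orthogonal to the smaller space. -/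
theorem isOrthProj_projT_Pop {q : Maps} (hq : q ∈ imOp) (h : Model) :
    IsOrthProj q (tangentCl q) h ((projT q ∘ₗ Pop q) h) := by
  rw [LinearMap.comp_apply]
  have h1 := GL2_projOff₂ (q := q) (linearIndependent_Pop_grad hq) (Pop q h)
  have h2 : projT q (Pop q h) ∈ tangentOp q := by
    have := (tangentOp q).sub_mem (Pop_mem q h)
      (sub_projOff₂_mem q (Pop_mem q (gradHcl q 0)) (Pop_mem q (gradHcl q 1)) (Pop q h))
    rwa [sub_sub_cancel] at this
  refine ⟨mem_tangentCl.2 ⟨h2, ?_, ?_⟩, fun a ha => ?_⟩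
  · rw [← GL2_Pop_left hq _ h2]
    exact h1.1
  · rw [← GL2_Pop_left hq _ h2]
    exact h1.2
  · rw [mem_tangentCl] at ha
    have h3 : Pop q h - projT q (Pop q h) ∈ LinearMap.ker ((GForm q).flip a) :=
      sub_projOff₂_mem q (by
        change GL2 q _ a = 0
        rw [GL2_Pop_left hq _ ha.1, ha.2.1]) (by
        change GL2 q _ a = 0
        rw [GL2_Pop_left hq _ ha.1, ha.2.2]) _
    have h4 := (isOrthProj_Pop hq h).2 a ha.1
    have h5 : GL2 q (Pop q h - projT q (Pop q h)) a = 0 := h3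
    rw [GL2_sub_left] at h4 h5 ⊢
    linarith

theorem isSmoothBundleMapOn_Pop : IsSmoothBundleMapOn Pop imOp :=
  fun _ _ hγ _ hh => hγ.Pop hh

theorem isSmoothBundleMapOn_projT_Pop :
    IsSmoothBundleMapOn (fun q => projT q ∘ₗ Pop q) imCl := by
  intro γ h hγ hmem hh
  have hli := fun t => linearIndependent_Pop_grad (hmem t).1
  have hv := hγ.Pop (hγ.gradHcl 0)
  have hw := hγ.Pop (hγ.gradHcl 1)
  have hv0 : ∀ t, Pop (γ t) (gradHcl (γ t) 0) ≠ 0 := fun t h0 =>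
    one_ne_zero (hli t 1 0 (by simp [h0])).1
  exact hγ.projOff (hγ.projOff hv hv0 hw) (fun t => projOff_ne_zero (hli t))
    (hγ.projOff hv hv0 (hγ.Pop hh))

/-! ### Continuity of cosine and sine, and openness of positivity, in the C^∞-topology -/

namespace SmoothFun

theorem uniform_comp {φ : ℝ → ℝ} (hφ : ∀ x y, |φ x - φ y| ≤ |x - y|) {ι : Type*} {l : Filter ι}
    {F : ι → ℝ → ℝ} {f : ℝ → ℝ} (hF : TendstoUniformly F f l) :
    TendstoUniformly (fun i θ => φ (F i θ)) (fun θ => φ (f θ)) l := by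
  rw [Metric.tendstoUniformly_iff] at *
  intro ε hε
  filter_upwards [hF ε hε] with i hi θ
  exact (hφ _ _).trans_lt (hi θ)

/-- Cosine and sine are treated jointly because differentiation exchanges them. Order zero is the
1-Lipschitz bound. -/
theorem tendstoUpTo_cosF_sinF {f : SmoothFun} (k : ℕ) :
    TendstoUpTo k cosF (𝓝 f) (cosF f) ∧ TendstoUpTo k sinF (𝓝 f) (sinF f) := by
  have hid := fun k => tendsto_iff_upTo.1 (Filter.tendsto_id (α := SmoothFun) (x := 𝓝 f)) k
  have hD := fun k => tendsto_iff_upTo.1 (continuous_D.tendsto f) k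
  have hc : TendstoUniformly (fun g : SmoothFun => cosF g) (cosF f) (𝓝 f) :=
    uniform_comp Real.abs_cos_sub_cos_le (hid 0).uniform
  have hs : TendstoUniformly (fun g : SmoothFun => sinF g) (sinF f) (𝓝 f) :=
    uniform_comp Real.abs_sin_sub_sin_le (hid 0).uniform
  induction k with
  | zero => exact ⟨tendstoUpTo_zero.2 hc, tendstoUpTo_zero.2 hs⟩
  | succ k ih =>
    have h1 : TendstoUpTo k (fun _ : SmoothFun => (-1 : SmoothFun)) (𝓝 f) (-1) :=
      tendsto_iff_upTo.1 tendsto_const_nhds k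
    refine ⟨(tendstoUpTo_succ k).2 ⟨hc, ?_⟩, (tendstoUpTo_succ k).2 ⟨hs, ?_⟩⟩
    · have := h1.mul (ih.2.mul (hD k))
      simpa only [D_cosF, neg_one_mul] using this
    · simpa only [D_sinF] using ih.1.mul (hD k)

theorem continuous_cosF : Continuous cosF :=
  continuous_iff_continuousAt.2 fun _ => tendsto_iff_upTo.2 fun k => (tendstoUpTo_cosF_sinF k).1

theorem continuous_sinF : Continuous sinF :=
  continuous_iff_continuousAt.2 fun _ => tendsto_iff_upTo.2 fun k => (tendstoUpTo_cosF_sinF k).2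

theorem isOpen_pos : IsOpen {f : SmoothFun | ∀ θ, 0 < f θ} := by
  rw [isOpen_iff_mem_nhds]
  intro f hf
  obtain ⟨c, hc, hcf⟩ := exists_lower_bound hf
  have h := (Filter.tendsto_id (α := SmoothFun) (x := 𝓝 f)).uniform_smoothFun
  rw [Metric.tendstoUniformly_iff] at h
  filter_upwards [h c hc] with g hg θ
  have := (abs_lt.1 (hg θ)).2
  have := hcf θ
  simp only [id] at *
  linarith

end SmoothFun


/-! ### Correcting the speed so that a curve closes -/

/-- The cosine of `p₂ + f`. -/
def cosAdd (p : Maps) (f : SmoothFun) : SmoothFun := p.q₂.cosFun * cosF f - p.q₂.sinFun * sinF f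

/-- The sine of `p₂ + f`. -/
def sinAdd (p : Maps) (f : SmoothFun) : SmoothFun := p.q₂.sinFun * cosF f + p.q₂.cosFun * sinF f

theorem cosF_zero : cosF 0 = 1 := SmoothFun.ext fun _ => Real.cos_zero

theorem sinF_zero : sinF 0 = 0 := SmoothFun.ext fun _ => Real.sin_zero

theorem cosAdd_zero (p : Maps) : cosAdd p 0 = p.q₂.cosFun := by
  rw [cosAdd, cosF_zero, sinF_zero, mul_one, mul_zero, sub_zero]

theorem sinAdd_zero (p : Maps) : sinAdd p 0 = p.q₂.sinFun := by
  rw [sinAdd, cosF_zero, sinF_zero, mul_one, mul_zero, add_zero]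

theorem continuous_cosAdd (p : Maps) : Continuous (cosAdd p) :=
  (continuous_const.mul continuous_cosF).sub (continuous_const.mul continuous_sinF)

theorem continuous_sinAdd (p : Maps) : Continuous (sinAdd p) :=
  (continuous_const.mul continuous_cosF).add (continuous_const.mul continuous_sinF)

theorem IsSmoothCurve.cosAdd (p : Maps) {f : ℝ → SmoothFun} (hf : IsSmoothCurve f) :
    IsSmoothCurve (fun t => cosAdd p (f t)) :=
  ((isSmoothCurve_const _).mul hf.cosF).sub ((isSmoothCurve_const _).mul hf.sinF)

theorem IsSmoothCurve.sinAdd (p : Maps) {f : ℝ → SmoothFun} (hf : IsSmoothCurve f) :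
    IsSmoothCurve (fun t => sinAdd p (f t)) :=
  ((isSmoothCurve_const _).mul hf.cosF).add ((isSmoothCurve_const _).mul hf.sinF)

/-- The determinant of the linear system for the correction of the speed. -/
def closeDet (p : Maps) (f : SmoothFun) : ℝ :=
  integral (p.q₂.cosFun * cosAdd p f) * integral (p.q₂.sinFun * sinAdd p f) -
    integral (p.q₂.sinFun * cosAdd p f) * integral (p.q₂.cosFun * sinAdd p f)

/-- The first coefficient of the correction of the speed. -/
def closeB₁ (p : Maps) (x : SmoothFun × SmoothFun × ℝ × ℝ) : ℝ :=
  ((x.2.2.1 - integral (x.1 * cosAdd p x.2.1)) * integral (p.q₂.sinFun * sinAdd p x.2.1) -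
    (x.2.2.2 - integral (x.1 * sinAdd p x.2.1)) * integral (p.q₂.sinFun * cosAdd p x.2.1)) /
    closeDet p x.2.1

/-- The second coefficient of the correction of the speed. -/
def closeB₂ (p : Maps) (x : SmoothFun × SmoothFun × ℝ × ℝ) : ℝ :=
  ((x.2.2.2 - integral (x.1 * sinAdd p x.2.1)) * integral (p.q₂.cosFun * cosAdd p x.2.1) -
    (x.2.2.1 - integral (x.1 * cosAdd p x.2.1)) * integral (p.q₂.cosFun * sinAdd p x.2.1)) /
    closeDet p x.2.1

/-- For `x = (u, f, ζ)`, the modification `v` of `u` by a linear combination of `cos p₂` and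
`sin p₂` such that `∫ v exp(i(p₂ + f)) = ζ`. -/
def closeCorr (p : Maps) (x : SmoothFun × SmoothFun × ℝ × ℝ) : SmoothFun :=
  x.1 + (closeB₁ p x • p.q₂.cosFun + closeB₂ p x • p.q₂.sinFun)

theorem integral_lincomb (a b : ℝ) (u f g h : SmoothFun) :
    integral ((u + (a • f + b • g)) * h) =
      integral (u * h) + (a * integral (f * h) + b * integral (g * h)) := by
  rw [add_mul, add_mul, smul_mul_assoc, smul_mul_assoc, map_add, map_add, map_smul, map_smul,
    smul_eq_mul, smul_eq_mul]

/-- The two coefficients are Cramer's rule for the 2×2 system with determinant `closeDet`. -/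
theorem integral_closeCorr (p : Maps) {x : SmoothFun × SmoothFun × ℝ × ℝ}
    (hx : closeDet p x.2.1 ≠ 0) :
    integral (closeCorr p x * cosAdd p x.2.1) = x.2.2.1 ∧
      integral (closeCorr p x * sinAdd p x.2.1) = x.2.2.2 := by
  rw [closeCorr, integral_lincomb, integral_lincomb, closeB₁, closeB₂]
  constructor
  · field_simp
    rw [closeDet]
    ring
  · field_simp
    rw [closeDet]
    ring

/-- Uniqueness in Cramer's rule. Identities between corrections are checked below by comparing
integrals instead of computing coefficients. -/
theorem closeCorr_eq_of_integral (p : Maps) {u f : SmoothFun} {ζ₁ ζ₂ : ℝ}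
    (hx : closeDet p f ≠ 0) {v : SmoothFun} (a b : ℝ)
    (hv : v = u + (a • p.q₂.cosFun + b • p.q₂.sinFun))
    (h₁ : integral (v * cosAdd p f) = ζ₁) (h₂ : integral (v * sinAdd p f) = ζ₂) :
    closeCorr p (u, f, ζ₁, ζ₂) = v := by
  have ha : closeB₁ p (u, f, ζ₁, ζ₂) = a := by
    rw [closeB₁, div_eq_iff hx, ← h₁, ← h₂, hv, integral_lincomb, integral_lincomb, closeDet]
    ring
  have hb : closeB₂ p (u, f, ζ₁, ζ₂) = b := by
    rw [closeB₂, div_eq_iff hx, ← h₁, ← h₂, hv, integral_lincomb, integral_lincomb, closeDet]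
    ring
  rw [closeCorr, ha, hb, hv]

theorem IsSmoothCurve.integral_mul_cosAdd (p : Maps) {u f : ℝ → SmoothFun} (hu : IsSmoothCurve u)
    (hf : IsSmoothCurve f) : ContDiff ℝ ∞ (fun t => SmoothFun.integral (u t * RTransform.cosAdd p (f t))) :=
  (hu.mul (hf.cosAdd p)).integral

theorem IsSmoothCurve.integral_mul_sinAdd (p : Maps) {u f : ℝ → SmoothFun} (hu : IsSmoothCurve u)
    (hf : IsSmoothCurve f) : ContDiff ℝ ∞ (fun t => SmoothFun.integral (u t * RTransform.sinAdd p (f t))) :=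
  (hu.mul (hf.sinAdd p)).integral

section SmoothCorrection

variable (p : Maps) {x : ℝ → SmoothFun × SmoothFun × ℝ × ℝ}

theorem contDiff_closeDet {f : ℝ → SmoothFun} (hf : IsSmoothCurve f) :
    ContDiff ℝ ∞ (fun t => closeDet p (f t)) :=
  (((isSmoothCurve_const _).integral_mul_cosAdd p hf).mul
    ((isSmoothCurve_const _).integral_mul_sinAdd p hf)).sub
    (((isSmoothCurve_const _).integral_mul_cosAdd p hf).mul
    ((isSmoothCurve_const _).integral_mul_sinAdd p hf))

theorem contDiff_closeB₁ (hx : IsSmoothCurve x) (h0 : ∀ t, closeDet p (x t).2.1 ≠ 0) :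
    ContDiff ℝ ∞ (fun t => closeB₁ p (x t)) :=
  ((((isSmoothCurve_real.1 hx.snd.snd.fst).sub (hx.fst.integral_mul_cosAdd p hx.snd.fst)).mul
    ((isSmoothCurve_const _).integral_mul_sinAdd p hx.snd.fst)).sub
    (((isSmoothCurve_real.1 hx.snd.snd.snd).sub (hx.fst.integral_mul_sinAdd p hx.snd.fst)).mul
    ((isSmoothCurve_const _).integral_mul_cosAdd p hx.snd.fst))).div
    (contDiff_closeDet p hx.snd.fst) h0

theorem contDiff_closeB₂ (hx : IsSmoothCurve x) (h0 : ∀ t, closeDet p (x t).2.1 ≠ 0) :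
    ContDiff ℝ ∞ (fun t => closeB₂ p (x t)) :=
  ((((isSmoothCurve_real.1 hx.snd.snd.snd).sub (hx.fst.integral_mul_sinAdd p hx.snd.fst)).mul
    ((isSmoothCurve_const _).integral_mul_cosAdd p hx.snd.fst)).sub
    (((isSmoothCurve_real.1 hx.snd.snd.fst).sub (hx.fst.integral_mul_cosAdd p hx.snd.fst)).mul
    ((isSmoothCurve_const _).integral_mul_sinAdd p hx.snd.fst))).div
    (contDiff_closeDet p hx.snd.fst) h0

theorem isSmoothCurve_closeCorr (hx : IsSmoothCurve x) (h0 : ∀ t, closeDet p (x t).2.1 ≠ 0) :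
    IsSmoothCurve (fun t => closeCorr p (x t)) :=
  hx.fst.add ((IsSmoothCurve.smul (contDiff_closeB₁ p hx h0) (isSmoothCurve_const _)).add
    (IsSmoothCurve.smul (contDiff_closeB₂ p hx h0) (isSmoothCurve_const _)))

end SmoothCorrection

theorem continuous_closeDet (p : Maps) : Continuous (closeDet p) := by
  have h1 := continuous_cosAdd p
  have h2 := continuous_sinAdd p
  have h3 := SmoothFun.integral.continuous
  unfold closeDet
  fun_prop

/-- The data for which the corrected speed exists and is positive. -/
def closeRegular (p : Maps) : Set (SmoothFun × SmoothFun × ℝ × ℝ) :=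
  {x | closeDet p x.2.1 ≠ 0 ∧ ∀ θ, 0 < closeCorr p x θ}

theorem continuousOn_closeCorr (p : Maps) :
    ContinuousOn (closeCorr p) {x | closeDet p x.2.1 ≠ 0} := by
  have h1 := continuous_cosAdd p
  have h2 := continuous_sinAdd p
  have h3 := SmoothFun.integral.continuous
  have h4 := continuous_closeDet p
  have hb₁ : ContinuousOn (closeB₁ p) {x | closeDet p x.2.1 ≠ 0} := by
    refine ContinuousOn.div (Continuous.continuousOn ?_) (Continuous.continuousOn ?_) fun x hx => hx
    · fun_prop
    · fun_prop
  have hb₂ : ContinuousOn (closeB₂ p) {x | closeDet p x.2.1 ≠ 0} := by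
    refine ContinuousOn.div (Continuous.continuousOn ?_) (Continuous.continuousOn ?_) fun x hx => hx
    · fun_prop
    · fun_prop
  exact continuous_fst.continuousOn.add
    ((hb₁.smul continuousOn_const).add (hb₂.smul continuousOn_const))

theorem isOpen_closeDet_ne (p : Maps) :
    IsOpen {x : SmoothFun × SmoothFun × ℝ × ℝ | closeDet p x.2.1 ≠ 0} :=
  isOpen_ne.preimage ((continuous_closeDet p).comp (continuous_fst.comp continuous_snd))

theorem isOpen_closeRegular (p : Maps) : IsOpen (closeRegular p) :=
  (continuousOn_closeCorr p).isOpen_inter_preimage (isOpen_closeDet_ne p) isOpen_pos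

theorem mem_imCl_iff {q : Maps} : q ∈ imCl ↔ q ∈ imOp ∧
    integral (q.q₁ ^ 2 * q.q₂.cosFun) = 0 ∧ integral (q.q₁ ^ 2 * q.q₂.sinFun) = 0 := by
  rw [← Hcl_eq_zero_iff]
  rfl

/-- If a cos q₂ + b sin q₂ vanished with (a, b) ≠ 0, then g = a sin q₂ - b cos q₂ would have
constant square a² + b² > 0 and hence constant sign, against ∫ q₁² g = 0, which holds because the
curve closes. -/
theorem not_lincomb_eq_zero {q : Maps} (hq : q ∈ imCl) {a b : ℝ}
    (h : a • q.q₂.cosFun + b • q.q₂.sinFun = 0) : a = 0 ∧ b = 0 := by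
  by_contra hab
  have hpos : 0 < a ^ 2 + b ^ 2 := by
    rcases not_and_or.1 hab with h | h <;> positivity
  obtain ⟨-, hc, hs⟩ := mem_imCl_iff.1 hq
  set g := a • q.q₂.sinFun - b • q.q₂.cosFun with hg
  have hsq : ∀ θ, g θ ^ 2 = a ^ 2 + b ^ 2 := fun θ => by
    have h1 : (q.q₂ θ).cos ^ 2 + (q.q₂ θ).sin ^ 2 = 1 := Real.Angle.cos_sq_add_sin_sq _
    have h2 : a * (q.q₂ θ).cos + b * (q.q₂ θ).sin = 0 := by
      have := congrArg (fun f : SmoothFun => f θ) h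
      simpa using this
    simp only [hg, sub_apply, smul_apply, SmoothAngleFun.cosFun_apply,
      SmoothAngleFun.sinFun_apply]
    linear_combination (a ^ 2 + b ^ 2) * h1 - (a * (q.q₂ θ).cos + b * (q.q₂ θ).sin) * h2
  have hne : ∀ θ, g θ ≠ 0 := fun θ h0 => by
    have := hsq θ
    rw [h0] at this
    norm_num at this
    linarith
  have hint : integral (q.q₁ ^ 2 * g) = 0 := by
    rw [hg, mul_sub, mul_smul_comm, mul_smul_comm, map_sub, map_smul, map_smul, hc, hs]
    simp
  have hq1 : ∀ θ, 0 < (q.q₁ ^ 2) θ := pow_pos_of_pos q.pos 2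
  have hzero : ∃ θ, g θ = 0 := by
    by_contra! hno
    rcases lt_or_gt_of_ne (hne 0) with h0 | h0
    · have hneg : ∀ θ, g θ < 0 := fun θ => by
        by_contra! hge
        obtain ⟨z, hz⟩ := mem_range_of_exists_le_of_exists_ge g.continuous ⟨0, h0.le⟩ ⟨θ, hge⟩
        exact hne z hz
      have := integral_pos (f := -(q.q₁ ^ 2 * g)) fun θ => by
        rw [neg_apply, mul_apply]
        exact neg_pos.2 (mul_neg_of_pos_of_neg (hq1 θ) (hneg θ))
      rw [map_neg, hint, neg_zero] at this
      exact lt_irrefl _ this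
    · have hp : ∀ θ, 0 < g θ := fun θ => by
        by_contra! hge
        obtain ⟨z, hz⟩ := mem_range_of_exists_le_of_exists_ge g.continuous ⟨θ, hge⟩ ⟨0, h0.le⟩
        exact hne z hz
      have := integral_pos (f := q.q₁ ^ 2 * g) fun θ => mul_pos (hq1 θ) (hp θ)
      rw [hint] at this
      exact lt_irrefl _ this
  obtain ⟨θ, hθ⟩ := hzero
  exact hne θ hθ

/-- At zero displacement this is the L² Gram determinant of cos q₂ and sin q₂, which are
independent. -/
theorem closeDet_zero_ne {q : Maps} (hq : q ∈ imCl) : closeDet q 0 ≠ 0 := by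
  rw [closeDet, cosAdd_zero, sinAdd_zero]
  intro h
  set C := q.q₂.cosFun
  set S := q.q₂.sinFun
  rw [mul_comm S C] at h
  have key : ∀ a b : ℝ, a ^ 2 * integral (C * C) + 2 * a * b * integral (C * S) +
      b ^ 2 * integral (S * S) = 0 → a = 0 ∧ b = 0 := by
    intro a b hab
    refine not_lincomb_eq_zero hq ?_
    have h1 : (a • C + b • S) * (a • C + b • S) = 0 := by
      refine eq_zero_of_integral_eq_zero (fun θ => mul_self_nonneg _) ?_
      rw [← hab]
      have : (a • C + b • S) * (a • C + b • S) =
          (a ^ 2) • (C * C) + (2 * a * b) • (C * S) + (b ^ 2) • (S * S) := by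
        ext θ
        simp only [mul_apply, add_apply, smul_apply]
        ring
      rw [this]
      simp
    ext θ
    have := congrArg (fun f : SmoothFun => f θ) h1
    exact mul_self_eq_zero.1 this
  by_cases hC : integral (C * C) = 0
  · exact one_ne_zero (key 1 0 (by rw [hC]; ring)).1
  -- The Gram form takes the value ∫C² times the determinant on this vector, hence zero.
  · have := (key (integral (C * S)) (-integral (C * C)) (by
      linear_combination integral (C * C) * h)).2
    exact hC (neg_eq_zero.1 this)

/-! ### The tangent spaces -/

theorem tangentSet_mono {M N : Set Maps} (h : M ⊆ N) (q : Maps) : tangentSet M q ⊆ tangentSet N q :=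
  fun _ ⟨γ, h1, h2, h3, h4⟩ => ⟨γ, h1, fun t => h (h2 t), h3, h4⟩

theorem tangentSet_imOp_subset (q : Maps) : tangentSet imOp q ⊆ tangentOp q := by
  rintro h ⟨γ, -, hmem, rfl, hv⟩
  refine mem_tangentOp.2 (SmoothFun.ext fun θ => ?_)
  have h1 := hv.q₃ θ
  have h2 := ((hv.q₁ θ).pow 2).mul (hv.derivFun θ)
  have e : ∀ t, (γ t).q₃ θ = (γ t).q₁ θ ^ 2 * (γ t).q₂.derivFun θ := fun t => by
    rw [mem_imOp_iff.1 (hmem t), mul_apply, pow_apply]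
  simp only [e] at h1
  rw [h1.unique h2]
  simp only [linThird, add_apply, smul_apply, mul_apply, pow_apply, Pi.pow_apply]
  norm_num
  ring

theorem tangentSet_imCl_subset (q : Maps) : tangentSet imCl q ⊆ tangentCl q := by
  intro h hh
  have key : ∀ i, GL2 q (gradHcl q i) h = 0 := fun i => by
    obtain ⟨γ, hγ, hmem, h0, hv⟩ := hh
    have h1 := isGradientAt_HclComp q i γ h hγ h0 hv
    refine h1.unique ((hasDerivAt_const (0 : ℝ) (0 : ℝ)).congr_of_eventuallyEq
      (Filter.Eventually.of_forall fun t => ?_))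
    simp only [HclComp, (hmem t).2]
    fin_cases i <;> rfl
  exact mem_tangentCl.2
    ⟨tangentSet_imOp_subset q (tangentSet_mono (fun _ h => h.1) q hh), key 0, key 1⟩

theorem isSmoothCurveInMaps_shift {q : Maps} {c : ℝ → Model} (hc : IsSmoothCurve c)
    (hpos : ∀ t θ, 0 < q.q₁ θ + (c t).1 θ) :
    IsSmoothCurveInMaps fun t => q.shift (c t) (hpos t) := by
  intro t₀
  refine ⟨fun t => c t - c t₀, hc.sub_model (isSmoothCurve_const _),
    Filter.Eventually.of_forall fun t θ => ⟨?_, ?_, ?_⟩⟩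
  · change q.q₁ θ + (c t).1 θ = q.q₁ θ + (c t₀).1 θ + ((c t).1 θ - (c t₀).1 θ)
    ring
  · change q.q₂ θ + (((c t).2.1 θ : ℝ) : Real.Angle) = q.q₂ θ + (((c t₀).2.1 θ : ℝ) : Real.Angle) +
      (((c t).2.1 θ - (c t₀).2.1 θ : ℝ) : Real.Angle)
    rw [Real.Angle.coe_sub]
    abel
  · change q.q₃ θ + (c t).2.2 θ = q.q₃ θ + (c t₀).2.2 θ + ((c t).2.2 θ - (c t₀).2.2 θ)
    ring

theorem Maps.shift_eq_self {q : Maps} {h : Model} (hh : h = 0) (hp : ∀ θ, 0 < q.q₁ θ + h.1 θ) :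
    q.shift h hp = q := by
  subst hh
  refine Maps.ext_fun (fun θ => add_zero _) (fun θ => ?_) (fun θ => add_zero _)
  change q.q₂ θ + (((0 : ℝ) : ℝ) : Real.Angle) = q.q₂ θ
  rw [Real.Angle.coe_zero, add_zero]

theorem hasVelocity_shift {q : Maps} {c : ℝ → Model} (hc : IsSmoothCurve c)
    (hpos : ∀ t θ, 0 < q.q₁ θ + (c t).1 θ) (h0 : c 0 = 0) {h : Model} (hd : HasCurveDeriv c h 0) :
    HasVelocity (fun t => q.shift (c t) (hpos t)) 0 h := by
  refine ⟨c, hc, Filter.Eventually.of_forall fun t => ?_, hd⟩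
  simp only [Maps.shift_eq_self h0]
  exact shift_shift q (c t) (hpos t)

/-- The third component of a curve in the solution set of `q₂' = q₁⁻² q₃`, as a displacement. -/
def thirdDisp (q : Maps) (c₁ c₂ : SmoothFun) : SmoothFun :=
  (q.q₁ + c₁) ^ 2 * (q.q₂.derivFun + D c₂) - q.q₃

theorem shift_mem_imOp_iff {q : Maps} {h : Model} (hp : ∀ θ, 0 < q.q₁ θ + h.1 θ) :
    q.shift h hp ∈ imOp ↔ h.2.2 = thirdDisp q h.1 h.2.1 := by
  have H := shift_shift q h hp
  rw [mem_imOp_iff, H.derivFun, H.q₁, H.q₃, thirdDisp, eq_sub_iff_add_eq']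

theorem shift_mem_imCl_iff {q : Maps} {h : Model} (hp : ∀ θ, 0 < q.q₁ θ + h.1 θ) :
    q.shift h hp ∈ imCl ↔ h.2.2 = thirdDisp q h.1 h.2.1 ∧
      integral ((q.q₁ + h.1) ^ 2 * cosAdd q h.2.1) = 0 ∧
      integral ((q.q₁ + h.1) ^ 2 * sinAdd q h.2.1) = 0 := by
  have H := shift_shift q h hp
  rw [mem_imCl_iff, shift_mem_imOp_iff, H.q₁, H.cosFun, H.sinFun]
  rfl

section Curves

variable {q : Maps} {c₁ c₂ : ℝ → SmoothFun}

theorem isSmoothCurve_thirdDisp (h₁ : IsSmoothCurve c₁) (h₂ : IsSmoothCurve c₂) :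
    IsSmoothCurve (fun t => (c₁ t, c₂ t, thirdDisp q (c₁ t) (c₂ t))) :=
  h₁.prodMk (h₂.prodMk (((((isSmoothCurve_const _).add h₁).pow 2).mul
    ((isSmoothCurve_const _).add h₂.D)).sub (isSmoothCurve_const _)))

/-- The first two components are a free choice; the third displacement is dictated by the
constraint, and its velocity is then the linearized expression that tangency of h prescribes. -/
theorem mem_tangentSet_of_curve {N : Set Maps} (hq : q ∈ imOp) (h₁ : IsSmoothCurve c₁)
    (h₂ : IsSmoothCurve c₂) (z₁ : c₁ 0 = 0) (z₂ : c₂ 0 = 0) {h : Model} (hh : h ∈ tangentOp q)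
    (d₁ : ∀ θ, HasDerivAt (fun t => c₁ t θ) (h.1 θ) 0)
    (d₂ : ∀ θ, HasDerivAt (fun t => c₂ t θ) (h.2.1 θ) 0) (hpos : ∀ t θ, 0 < q.q₁ θ + c₁ t θ)
    (hN : ∀ t, q.shift (c₁ t, c₂ t, thirdDisp q (c₁ t) (c₂ t)) (hpos t) ∈ N) :
    h ∈ tangentSet N q := by
  have hsm := isSmoothCurve_thirdDisp (q := q) h₁ h₂
  have hd₁ := h₁.hasCurveDeriv_of_pointwise d₁
  have hd₂ := h₂.hasCurveDeriv_of_pointwise d₂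
  have h0 : (c₁ 0, c₂ 0, thirdDisp q (c₁ 0) (c₂ 0)) = (0 : Model) := by
    rw [z₁, z₂, thirdDisp, mem_imOp_iff.1 hq, map_zero, add_zero, add_zero, sub_self]
    rfl
  refine ⟨_, isSmoothCurveInMaps_shift hsm hpos, hN, Maps.shift_eq_self h0 _,
    hasVelocity_shift hsm hpos h0 ?_⟩
  refine hd₁.prodMk (hd₂.prodMk (hsm.snd.snd.hasCurveDeriv_of_pointwise fun θ => ?_))
  have e := ((((hd₁.hasDerivAt_apply θ).const_add (q.q₁ θ)).pow 2).mul
    ((hd₂.hasDerivAt_D_apply θ).const_add (q.q₂.derivFun θ))).sub_const (q.q₃ θ)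
  refine e.congr_deriv ?_
  rw [mem_tangentOp.1 hh]
  simp only [linThird, add_apply, smul_apply, mul_apply, pow_apply, map_zero, zero_apply,
    Pi.pow_apply, z₁, z₂]
  norm_num
  ring

end Curves

/-- The curve q₁ exp(t h₁/q₁) has velocity h₁ and, unlike q₁ + t h₁, remains positive for all times.
-/
theorem tangentOp_subset {q : Maps} (hq : q ∈ imOp) :
    (tangentOp q : Set Model) ⊆ tangentSet imOp q := by
  intro h hh
  have hid : ContDiff ℝ ∞ (fun t : ℝ => t) := contDiff_id
  have h₁ : IsSmoothCurve fun t : ℝ => q.q₁ * expF (t • (h.1 * invF q.q₁ q.pos)) - q.q₁ :=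
    ((isSmoothCurve_const _).mul (IsSmoothCurve.smul hid (isSmoothCurve_const _)).expF).sub
      (isSmoothCurve_const _)
  have h₂ : IsSmoothCurve fun t : ℝ => t • h.2.1 := IsSmoothCurve.smul hid (isSmoothCurve_const _)
  refine mem_tangentSet_of_curve hq h₁ h₂ ?_ (zero_smul _ _) hh (fun θ => ?_) (fun θ => ?_)
    (fun t θ => ?_) (fun t => ?_)
  · ext θ
    simp
  · have hne : q.q₁ θ ≠ 0 := (q.pos θ).ne'
    have := ((((hasDerivAt_id (0 : ℝ)).mul_const (h.1 θ * (q.q₁ θ)⁻¹)).exp).const_mul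
      (q.q₁ θ)).sub_const (q.q₁ θ)
    refine this.congr_deriv ?_
    simp
    field_simp
  · exact ((hasDerivAt_id (0 : ℝ)).mul_const (h.2.1 θ)).congr_deriv (one_mul _)
  · simp only [sub_apply, mul_apply, add_sub_cancel]
    exact mul_pos (q.pos θ) (Real.exp_pos _)
  · exact (shift_mem_imOp_iff _).2 rfl

/-- A smooth curve of corrected speeds starting at `q₁²`, with prescribed velocity. -/
theorem exists_closing_curve {q : Maps} (hq : q ∈ imCl) {h : Model} (hh : h ∈ tangentCl q) :
    ∃ (U : ℝ → SmoothFun) (τ : ℝ → ℝ), IsSmoothCurve U ∧ ContDiff ℝ ∞ τ ∧ τ 0 = 0 ∧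
      HasDerivAt τ 1 0 ∧ U 0 = q.q₁ ^ 2 ∧ (∀ t θ, 0 < U t θ) ∧
      (∀ θ, HasDerivAt (fun t => U t θ) (2 * q.q₁ θ * h.1 θ) 0) ∧
      ∀ t, integral (U t * cosAdd q (τ t • h.2.1)) = 0 ∧
        integral (U t * sinAdd q (τ t • h.2.1)) = 0 := by
  obtain ⟨-, hc, hs⟩ := mem_imCl_iff.1 hq
  obtain ⟨-, hg₀, hg₁⟩ := mem_tangentCl.1 hh
  have hdet := closeDet_zero_ne hq
  -- The first-order path of (q₁², q₂) in the direction h, with target value 0 for the closing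
  -- integral; the correction makes it close exactly.
  let L : ℝ → SmoothFun × SmoothFun × ℝ × ℝ := fun τ =>
    (q.q₁ ^ 2 + (2 * τ) • (q.q₁ * h.1), τ • h.2.1, 0, 0)
  have hL : Continuous L := by
    refine Continuous.prodMk ?_ (Continuous.prodMk ?_ continuous_const)
    · exact continuous_const.add ((continuous_const.mul continuous_id).smul continuous_const)
    · exact continuous_id.smul continuous_const
  have hL0 : L 0 = (q.q₁ ^ 2, 0, 0, 0) := by simp [L]
  have hcorr0 : closeCorr q (L 0) = q.q₁ ^ 2 := by
    rw [hL0]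
    refine closeCorr_eq_of_integral q hdet 0 0 (by simp) ?_ ?_
    · rwa [cosAdd_zero]
    · rwa [sinAdd_zero]
  have hreg0 : L 0 ∈ closeRegular q := by
    refine ⟨by rw [hL0]; exact hdet, ?_⟩
    rw [hcorr0]
    exact pow_pos_of_pos q.pos 2
  obtain ⟨ε, hε, hball⟩ := Metric.mem_nhds_iff.1
    (hL.continuousAt.preimage_mem_nhds ((isOpen_closeRegular q).mem_nhds hreg0))
  -- Tangent curves must be defined for all times, but the correction is regular only for small
  -- parameters. This reparametrization has unit velocity at 0 and stays within ε/2.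
  let τ : ℝ → ℝ := fun t => ε / 2 * Real.sin (t / (ε / 2))
  have hτ : ContDiff ℝ ∞ τ :=
    contDiff_const.mul (Real.contDiff_sin.comp (contDiff_id.div_const _))
  have hτ0 : τ 0 = 0 := by simp [τ]
  have hτ1 : HasDerivAt τ 1 0 := by
    have := (((hasDerivAt_id (0 : ℝ)).div_const (ε / 2)).sin).const_mul (ε / 2)
    refine this.congr_deriv ?_
    simp
    field_simp
  have hreg : ∀ t, L (τ t) ∈ closeRegular q := fun t => by
    refine hball ?_
    rw [Metric.mem_ball, dist_zero_right, Real.norm_eq_abs, abs_mul, abs_of_pos (half_pos hε)]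
    have := Real.abs_sin_le_one (t / (ε / 2))
    nlinarith
  have hLs : IsSmoothCurve fun t => L (τ t) :=
    ((isSmoothCurve_const _).add (IsSmoothCurve.smul (contDiff_const.mul hτ)
      (isSmoothCurve_const _))).prodMk ((IsSmoothCurve.smul hτ (isSmoothCurve_const _)).prodMk
        (isSmoothCurve_const _))
  have hne := fun t => (hreg t).1
  have hint := fun t => integral_closeCorr q (hne t)
  have hU := isSmoothCurve_closeCorr q hLs hne
  have hU0 : closeCorr q (L (τ 0)) = q.q₁ ^ 2 := by rw [hτ0, hcorr0]
  refine ⟨fun t => closeCorr q (L (τ t)), τ, hU, hτ, hτ0, hτ1, hU0, fun t => (hreg t).2, ?_,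
    hint⟩
  have hb₁ := ((contDiff_closeB₁ q hLs hne).differentiable (by simp) 0).hasDerivAt
  have hb₂ := ((contDiff_closeB₂ q hLs hne).differentiable (by simp) 0).hasDerivAt
  set β₁ := deriv (fun t => closeB₁ q (L (τ t))) 0
  set β₂ := deriv (fun t => closeB₂ q (L (τ t))) 0
  -- The velocity contributed by the correction; it must vanish for the curve to have velocity
  -- exactly h.
  set V : SmoothFun := β₁ • q.q₂.cosFun + β₂ • q.q₂.sinFun with hV
  have hd : ∀ θ, HasDerivAt (fun t => closeCorr q (L (τ t)) θ) (2 * q.q₁ θ * h.1 θ + V θ) 0 := by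
    intro θ
    have := ((((hτ1.const_mul 2).mul_const (q.q₁ θ * h.1 θ)).const_add (q.q₁ θ ^ 2))).add
      ((hb₁.mul_const (q.q₂.cosFun θ)).add (hb₂.mul_const (q.q₂.sinFun θ)))
    refine (this.congr_deriv ?_).congr_of_eventuallyEq (Filter.Eventually.of_forall fun t => ?_)
    · simp only [hV, SmoothFun.add_apply, SmoothFun.smul_apply]
      ring
    · simp only [closeCorr, L, SmoothFun.add_apply, SmoothFun.smul_apply, SmoothFun.pow_apply,
        SmoothFun.mul_apply, Pi.add_apply]
  have hf : ∀ θ, HasDerivAt (fun t => τ t * h.2.1 θ) (h.2.1 θ) 0 := fun θ =>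
    (hτ1.mul_const (h.2.1 θ)).congr_deriv (one_mul _)
  have hfs : IsSmoothCurve fun t => τ t • h.2.1 := IsSmoothCurve.smul hτ (isSmoothCurve_const _)
  -- Differentiating the identically zero closing integral leaves the pairing of h with the
  -- gradient, which vanishes by tangency, plus this term.
  have hI₁ : integral (V * q.q₂.cosFun) = 0 := by
    have hcd : HasCurveDeriv (fun t => closeCorr q (L (τ t)) * cosAdd q (τ t • h.2.1))
        ((2 : ℝ) • (q.q₁ * h.1 * q.q₂.cosFun) - q.q₁ ^ 2 * (q.q₂.sinFun * h.2.1) +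
          V * q.q₂.cosFun) 0 := by
      refine (hU.mul (hfs.cosAdd q)).hasCurveDeriv_of_pointwise fun θ => ?_
      have := (hd θ).mul (((hf θ).cos.const_mul (q.q₂.cosFun θ)).sub
        ((hf θ).sin.const_mul (q.q₂.sinFun θ)))
      refine this.congr_deriv ?_
      rw [hU0]
      simp only [Pi.sub_apply, hτ0, zero_mul, Real.cos_zero, Real.sin_zero,
        SmoothFun.add_apply, SmoothFun.sub_apply, SmoothFun.mul_apply,
        SmoothFun.smul_apply, SmoothFun.pow_apply]
      ring
    have h1 := hcd.integral
    rw [map_add, ← GL2_gradHcl_zero, hg₀, zero_add] at h1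
    refine h1.unique ((hasDerivAt_const (0 : ℝ) (0 : ℝ)).congr_of_eventuallyEq
      (Filter.Eventually.of_forall fun t => ?_))
    exact (hint t).1
  have hI₂ : integral (V * q.q₂.sinFun) = 0 := by
    have hcd : HasCurveDeriv (fun t => closeCorr q (L (τ t)) * sinAdd q (τ t • h.2.1))
        ((2 : ℝ) • (q.q₁ * h.1 * q.q₂.sinFun) + q.q₁ ^ 2 * (q.q₂.cosFun * h.2.1) +
          V * q.q₂.sinFun) 0 := by
      refine (hU.mul (hfs.sinAdd q)).hasCurveDeriv_of_pointwise fun θ => ?_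
      have := (hd θ).mul (((hf θ).cos.const_mul (q.q₂.sinFun θ)).add
        ((hf θ).sin.const_mul (q.q₂.cosFun θ)))
      refine this.congr_deriv ?_
      rw [hU0]
      simp only [Pi.add_apply, hτ0, zero_mul, Real.cos_zero, Real.sin_zero,
        SmoothFun.add_apply, SmoothFun.mul_apply,
        SmoothFun.smul_apply, SmoothFun.pow_apply]
      ring
    have h1 := hcd.integral
    rw [map_add, ← GL2_gradHcl_one, hg₁, zero_add] at h1
    refine h1.unique ((hasDerivAt_const (0 : ℝ) (0 : ℝ)).congr_of_eventuallyEq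
      (Filter.Eventually.of_forall fun t => ?_))
    exact (hint t).2
  -- V and 0 are both the correction of 0 with zero target, since V lies in the span of cos q₂ and
  -- sin q₂ and is orthogonal to both.
  have hV0 : V = 0 := by
    have e1 : closeCorr q (0, 0, 0, 0) = V := closeCorr_eq_of_integral q hdet β₁ β₂
      (by rw [hV]; exact (zero_add _).symm) (by rwa [cosAdd_zero]) (by rwa [sinAdd_zero])
    have e2 : closeCorr q (0, 0, 0, 0) = 0 := closeCorr_eq_of_integral q hdet 0 0
      (by simp) (by simp) (by simp)
    rw [← e1, e2]
  intro θ
  refine (hd θ).congr_deriv ?_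
  rw [hV0, SmoothFun.zero_apply, add_zero]

theorem tangentCl_subset {q : Maps} (hq : q ∈ imCl) :
    (tangentCl q : Set Model) ⊆ tangentSet imCl q := by
  intro h hh
  obtain ⟨U, τ, hU, hτ, hτ0, hτ1, hU0, hUpos, hUd, hint⟩ := exists_closing_curve hq hh
  have h₁ : IsSmoothCurve fun t => sqrtF (U t) (hUpos t) - q.q₁ :=
    (hU.sqrtF hUpos).sub (isSmoothCurve_const _)
  have h₂ : IsSmoothCurve fun t => τ t • h.2.1 := IsSmoothCurve.smul hτ (isSmoothCurve_const _)
  refine mem_tangentSet_of_curve hq.1 h₁ h₂ ?_ (by rw [hτ0, zero_smul]) (mem_tangentCl.1 hh).1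
    (fun θ => ?_) (fun θ => ?_) (fun t θ => ?_) (fun t => ?_)
  · ext θ
    simp only [sub_apply, sqrtF_apply, hU0, pow_apply, Real.sqrt_sq (q.pos θ).le, sub_self,
      zero_apply]
  · have hne : q.q₁ θ ≠ 0 := (q.pos θ).ne'
    have := ((hUd θ).sqrt (hUpos 0 θ).ne').sub_const (q.q₁ θ)
    refine this.congr_deriv ?_
    rw [hU0, pow_apply, Real.sqrt_sq (q.pos θ).le]
    field_simp
  · exact (hτ1.mul_const (h.2.1 θ)).congr_deriv (one_mul _)
  · simp only [sub_apply, add_sub_cancel, sqrtF_apply]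
    exact Real.sqrt_pos.2 (hUpos t θ)
  · have e : (q.q₁ + (sqrtF (U t) (hUpos t) - q.q₁)) ^ 2 = U t := by
      rw [add_sub_cancel]
      ext θ
      rw [pow_apply, sqrtF_apply, Real.sq_sqrt (hUpos t θ).le]
    refine (shift_mem_imCl_iff _).2 ⟨rfl, ?_⟩
    simp only [e]
    exact hint t

theorem tangentSet_imOp {q : Maps} (hq : q ∈ imOp) :
    (tangentOp q : Set Model) = tangentSet imOp q :=
  (tangentOp_subset hq).antisymm (tangentSet_imOp_subset q)

theorem tangentSet_imCl {q : Maps} (hq : q ∈ imCl) :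
    (tangentCl q : Set Model) = tangentSet imCl q :=
  (tangentCl_subset hq).antisymm (tangentSet_imCl_subset q)

/-! ### Submanifold charts -/

/-- The square root of a positive function, and zero for all other functions. -/
def sqrtT (f : SmoothFun) : SmoothFun :=
  open Classical in if h : ∀ θ, 0 < f θ then sqrtF f h else 0

theorem sqrtT_of_pos {f : SmoothFun} (h : ∀ θ, 0 < f θ) : sqrtT f = sqrtF f h := dif_pos h

theorem sqrtT_pos {f : SmoothFun} (h : ∀ θ, 0 < f θ) (θ : ℝ) : 0 < sqrtT f θ := by
  rw [sqrtT_of_pos h]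
  exact Real.sqrt_pos.2 (h θ)

theorem sqrtT_sq {f : SmoothFun} (h : ∀ θ, 0 < f θ) : sqrtT f ^ 2 = f := by
  ext θ
  rw [sqrtT_of_pos h, pow_apply, sqrtF_apply, Real.sq_sqrt (h θ).le]

theorem sqrtT_pow_two {f : SmoothFun} (h : ∀ θ, 0 < f θ) : sqrtT (f ^ 2) = f := by
  ext θ
  rw [sqrtT_of_pos (pow_pos_of_pos h 2), sqrtF_apply, pow_apply, Real.sqrt_sq (h θ).le]

section Chart

variable (p : Maps)

/-- The square of the first component, corrected so that its integral against `exp(ip₂)` is the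
closing defect of `p + h`. -/
def chartSpeed (h : Model) : SmoothFun :=
  closeCorr p ((p.q₁ + h.1) ^ 2, 0, integral ((p.q₁ + h.1) ^ 2 * cosAdd p h.2.1),
    integral ((p.q₁ + h.1) ^ 2 * sinAdd p h.2.1))

/-- The change of coordinates that straightens the image of the `R`-transform at `p`. -/
def chartMap (h : Model) : Model :=
  (chartSpeed p h - p.q₁ ^ 2, h.2.1, h.2.2 - thirdDisp p h.1 h.2.1)

/-- The data of the correction that inverts `chartSpeed`. -/
def invData (k : Model) : SmoothFun × SmoothFun × ℝ × ℝ :=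
  (p.q₁ ^ 2 + k.1, k.2.1, integral (k.1 * p.q₂.cosFun), integral (k.1 * p.q₂.sinFun))

/-- The inverse of `chartMap`. -/
def chartInv (k : Model) : Model :=
  (sqrtT (closeCorr p (invData p k)) - p.q₁, k.2.1,
    k.2.2 + thirdDisp p (sqrtT (closeCorr p (invData p k)) - p.q₁) k.2.1)

/-- The source of the chart. -/
def chartSource : Set Model := {h ∈ chartDomain p | closeDet p h.2.1 ≠ 0}

/-- The target of the chart. -/
def chartTarget : Set Model := {k | (∀ θ, |k.2.1 θ| < Real.pi) ∧ invData p k ∈ closeRegular p}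

variable {p}

/-- In the first chart coordinate the nonlinear closing condition becomes two linear equations with
coefficients fixed at p. -/
theorem integral_chartSpeed (hp : p ∈ imCl) (h : Model) :
    integral ((chartSpeed p h - p.q₁ ^ 2) * p.q₂.cosFun) =
        integral ((p.q₁ + h.1) ^ 2 * cosAdd p h.2.1) ∧
      integral ((chartSpeed p h - p.q₁ ^ 2) * p.q₂.sinFun) =
        integral ((p.q₁ + h.1) ^ 2 * sinAdd p h.2.1) := by
  obtain ⟨-, hc, hs⟩ := mem_imCl_iff.1 hp
  have := integral_closeCorr p (x := ((p.q₁ + h.1) ^ 2, 0,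
    integral ((p.q₁ + h.1) ^ 2 * cosAdd p h.2.1),
    integral ((p.q₁ + h.1) ^ 2 * sinAdd p h.2.1))) (closeDet_zero_ne hp)
  simp only [cosAdd_zero, sinAdd_zero] at this
  rw [sub_mul, sub_mul, map_sub, map_sub, hc, hs, sub_zero, sub_zero]
  exact this

/-- Both corrections move along the same plane spanned by cos p₂ and sin p₂, one relative to p₂ and
one relative to p₂ + h₂, so uniqueness makes the second undo the first. -/
theorem closeCorr_invData_chartMap (hp : p ∈ imCl) {h : Model} (hh : h ∈ chartSource p) :
    closeCorr p (invData p (chartMap p h)) = (p.q₁ + h.1) ^ 2 := by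
  obtain ⟨e1, e2⟩ := integral_chartSpeed hp h
  set x : SmoothFun × SmoothFun × ℝ × ℝ := ((p.q₁ + h.1) ^ 2, 0,
    integral ((p.q₁ + h.1) ^ 2 * cosAdd p h.2.1),
    integral ((p.q₁ + h.1) ^ 2 * sinAdd p h.2.1)) with hx
  refine closeCorr_eq_of_integral p hh.2 (-closeB₁ p x) (-closeB₂ p x) ?_ e1.symm e2.symm
  rw [chartMap, chartSpeed, ← hx, closeCorr, add_sub_cancel, neg_smul, neg_smul]
  have hx1 : x.1 = (p.q₁ + h.1) ^ 2 := rfl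
  rw [hx1, ← neg_add, add_neg_cancel_right]

theorem chartMap_mem (hp : p ∈ imCl) {h : Model} (hh : h ∈ chartSource p) :
    chartMap p h ∈ chartTarget p := by
  refine ⟨fun θ => (hh.1 θ).2, hh.2, ?_⟩
  rw [closeCorr_invData_chartMap hp hh]
  exact pow_pos_of_pos (fun θ => (hh.1 θ).1) 2

theorem chartInv_mem {k : Model} (hk : k ∈ chartTarget p) : chartInv p k ∈ chartSource p := by
  refine ⟨fun θ => ⟨?_, hk.1 θ⟩, hk.2.1⟩
  have := sqrtT_pos hk.2.2 θ
  simp only [chartInv, sub_apply]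
  linarith

theorem chartInv_chartMap (hp : p ∈ imCl) {h : Model} (hh : h ∈ chartSource p) :
    chartInv p (chartMap p h) = h := by
  have e := closeCorr_invData_chartMap hp hh
  rw [chartInv, e, sqrtT_pow_two (fun θ => (hh.1 θ).1), add_sub_cancel_left]
  simp only [chartMap, sub_add_cancel]

theorem chartMap_chartInv (hp : p ∈ imCl) {k : Model} (hk : k ∈ chartTarget p) :
    chartMap p (chartInv p k) = k := by
  obtain ⟨-, hc, hs⟩ := mem_imCl_iff.1 hp
  set U := closeCorr p (invData p k) with hU
  have hsq : (p.q₁ + (chartInv p k).1) ^ 2 = U := by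
    rw [chartInv, add_sub_cancel, sqrtT_sq hk.2.2]
  obtain ⟨e1, e2⟩ := integral_closeCorr p hk.2.1
  have e : chartSpeed p (chartInv p k) = p.q₁ ^ 2 + k.1 := by
    rw [chartSpeed, hsq]
    refine closeCorr_eq_of_integral p (closeDet_zero_ne hp) (-closeB₁ p (invData p k))
      (-closeB₂ p (invData p k)) ?_ ?_ ?_
    · rw [hU, closeCorr, neg_smul, neg_smul, invData]
      rw [← neg_add, add_neg_cancel_right]
    · rw [cosAdd_zero, add_mul, map_add, hc, zero_add]
      exact e1.symm
    · rw [sinAdd_zero, add_mul, map_add, hs, zero_add]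
      exact e2.symm
  rw [chartMap, e, add_sub_cancel_left]
  simp only [chartInv, add_sub_cancel_right]

/-- The submanifold chart at a point of the image, as a partial equivalence of the model space. -/
def chartEquiv (hp : p ∈ imCl) : PartialEquiv Model Model where
  toFun := chartMap p
  invFun := chartInv p
  source := chartSource p
  target := chartTarget p
  map_source' := fun _ => chartMap_mem hp
  map_target' := fun _ => chartInv_mem
  left_inv' := fun _ => chartInv_chartMap hp
  right_inv' := fun _ => chartMap_chartInv hp

theorem isOpen_abs_lt_pi : IsOpen {f : SmoothFun | ∀ θ, |f θ| < Real.pi} := by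
  have e : {f : SmoothFun | ∀ θ, |f θ| < Real.pi} =
      (fun f => const Real.pi - f) ⁻¹' {f | ∀ θ, 0 < f θ} ∩
        (fun f => const Real.pi + f) ⁻¹' {f | ∀ θ, 0 < f θ} := by
    ext f
    simp only [Set.mem_ofPred_eq, Set.mem_inter_iff, Set.mem_preimage, sub_apply, add_apply,
      const_apply, abs_lt, ← forall_and]
    refine forall_congr' fun θ => ⟨fun h => ⟨?_, ?_⟩, fun h => ⟨?_, ?_⟩⟩ <;> linarith [h.1, h.2]
  rw [e]
  exact (isOpen_pos.preimage (continuous_const.sub continuous_id)).inter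
    (isOpen_pos.preimage (continuous_const.add continuous_id))

theorem isOpen_chartSource (p : Maps) : IsOpen (chartSource p) := by
  have e : chartSource p = (fun h : Model => p.q₁ + h.1) ⁻¹' {f | ∀ θ, 0 < f θ} ∩
      (fun h : Model => h.2.1) ⁻¹' {f | ∀ θ, |f θ| < Real.pi} ∩
      (fun h : Model => closeDet p h.2.1) ⁻¹' {x | x ≠ 0} := by
    ext h
    simp only [chartSource, chartDomain, forall_and]
    rfl
  rw [e]
  exact ((isOpen_pos.preimage (continuous_const.add continuous_fst)).inter
    (isOpen_abs_lt_pi.preimage continuous_snd.fst)).inter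
    (isOpen_ne.preimage ((continuous_closeDet p).comp continuous_snd.fst))

theorem isOpen_chartTarget (p : Maps) : IsOpen (chartTarget p) := by
  have h3 := SmoothFun.integral.continuous
  have hc : Continuous (invData p) := by
    unfold invData
    fun_prop
  exact (isOpen_abs_lt_pi.preimage continuous_snd.fst).inter
    ((isOpen_closeRegular p).preimage hc)

theorem convSmoothOn_chartMap (hp : p ∈ imCl) : ConvSmoothOn (chartMap p) (chartSource p) := by
  intro c hc _
  have h1 := (isSmoothCurve_const p.q₁).add hc.fst
  have h2 := h1.pow 2
  have hd := isSmoothCurve_thirdDisp (q := p) hc.fst hc.snd.fst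
  refine ((isSmoothCurve_closeCorr p (h2.prodMk ((isSmoothCurve_const _).prodMk
    ((isSmoothCurve_real.2 (h2.integral_mul_cosAdd p hc.snd.fst)).prodMk
      (isSmoothCurve_real.2 (h2.integral_mul_sinAdd p hc.snd.fst)))))
      fun _ => closeDet_zero_ne hp).sub (isSmoothCurve_const _)).prodMk
    (hc.snd.fst.prodMk (hc.snd.snd.sub hd.snd.snd))

theorem convSmoothOn_chartInv (p : Maps) : ConvSmoothOn (chartInv p) (chartTarget p) := by
  intro c hc hmem
  have hU : IsSmoothCurve fun t => closeCorr p (invData p (c t)) :=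
    isSmoothCurve_closeCorr p (((isSmoothCurve_const _).add hc.fst).prodMk (hc.snd.fst.prodMk
      ((isSmoothCurve_real.2 (hc.fst.mul (isSmoothCurve_const _)).integral).prodMk
        (isSmoothCurve_real.2 (hc.fst.mul (isSmoothCurve_const _)).integral))))
      fun t => (hmem t).2.1
  have hs : IsSmoothCurve fun t => sqrtT (closeCorr p (invData p (c t))) - p.q₁ := by
    have := (hU.sqrtF fun t => (hmem t).2.2).sub (isSmoothCurve_const p.q₁)
    simpa only [sqrtT_of_pos (hmem _).2.2] using this
  have hd := isSmoothCurve_thirdDisp (q := p) hs hc.snd.fst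
  exact hs.prodMk (hc.snd.fst.prodMk (hc.snd.snd.add hd.snd.snd))

variable (p) in
/-- The linear subspace of the model space onto which the image is straightened at `p`. -/
def chartSubspace : Submodule ℝ Model where
  carrier := {k | integral (k.1 * p.q₂.cosFun) = 0 ∧ integral (k.1 * p.q₂.sinFun) = 0 ∧ k.2.2 = 0}
  add_mem' := fun {a b} ha hb => by
    refine ⟨?_, ?_, ?_⟩
    · rw [Prod.fst_add, add_mul, map_add, ha.1, hb.1, add_zero]
    · rw [Prod.fst_add, add_mul, map_add, ha.2.1, hb.2.1, add_zero]
    · rw [Prod.snd_add, Prod.snd_add, ha.2.2, hb.2.2, add_zero]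
  zero_mem' := by simp
  smul_mem' := fun r a ha => by
    refine ⟨?_, ?_, ?_⟩
    · rw [Prod.smul_fst, smul_mul_assoc, map_smul, ha.1, smul_zero]
    · rw [Prod.smul_fst, smul_mul_assoc, map_smul, ha.2.1, smul_zero]
    · rw [Prod.smul_snd, Prod.smul_snd, ha.2.2, smul_zero]

theorem mem_chartSubspace {k : Model} : k ∈ chartSubspace p ↔
    integral (k.1 * p.q₂.cosFun) = 0 ∧ integral (k.1 * p.q₂.sinFun) = 0 ∧ k.2.2 = 0 := Iff.rfl

theorem isClosed_chartSubspace (p : Maps) : IsClosed (chartSubspace p : Set Model) := by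
  have h3 := SmoothFun.integral.continuous
  exact (isClosed_eq (by fun_prop) continuous_const).inter
    ((isClosed_eq (by fun_prop) continuous_const).inter
      (isClosed_eq continuous_snd.snd continuous_const))

theorem continuous_closeCorr_zero (hp : p ∈ imCl) :
    Continuous fun u => closeCorr p (u, 0, 0, 0) :=
  (continuousOn_closeCorr p).comp_continuous
    (continuous_id.prodMk continuous_const) fun _ => closeDet_zero_ne hp

/-- The correction of a function to one that is orthogonal to `cos p₂` and `sin p₂`. -/
def closeProj (hp : p ∈ imCl) : SmoothFun →L[ℝ] SmoothFun where
  toFun := fun u => closeCorr p (u, 0, 0, 0)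
  map_add' := fun u v => by
    ext θ
    simp only [closeCorr, closeB₁, closeB₂, add_apply, smul_apply, add_mul, map_add]
    ring
  map_smul' := fun r u => by
    ext θ
    simp only [closeCorr, closeB₁, closeB₂, add_apply, smul_apply, smul_mul_assoc, map_smul,
      smul_eq_mul, RingHom.id_apply]
    ring
  cont := continuous_closeCorr_zero hp

theorem integral_closeProj (hp : p ∈ imCl) (u : SmoothFun) :
    integral (closeProj hp u * p.q₂.cosFun) = 0 ∧ integral (closeProj hp u * p.q₂.sinFun) = 0 := by
  have := integral_closeCorr p (x := (u, 0, 0, 0)) (closeDet_zero_ne hp)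
  simp only [cosAdd_zero, sinAdd_zero] at this
  exact this

theorem closeProj_eq_self (hp : p ∈ imCl) {u : SmoothFun} (hc : integral (u * p.q₂.cosFun) = 0)
    (hs : integral (u * p.q₂.sinFun) = 0) : closeProj hp u = u :=
  closeCorr_eq_of_integral p (closeDet_zero_ne hp) 0 0 (by simp) (by rwa [cosAdd_zero])
    (by rwa [sinAdd_zero])

/-- The continuous projection corrects the first coordinate to be orthogonal to cos p₂ and sin p₂,
keeps the second and drops the third. -/
theorem closedComplemented_chartSubspace (hp : p ∈ imCl) :
    (chartSubspace p).ClosedComplemented := by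
  refine ⟨(((closeProj hp).comp (ContinuousLinearMap.fst ℝ _ _)).prod
    ((((ContinuousLinearMap.fst ℝ _ _).comp (ContinuousLinearMap.snd ℝ _ _))).prod
      (0 : Model →L[ℝ] SmoothFun))).codRestrict (chartSubspace p) fun k => ?_, ?_⟩
  · exact ⟨(integral_closeProj hp k.1).1, (integral_closeProj hp k.1).2, rfl⟩
  · rintro ⟨⟨k₁, k₂, k₃⟩, h1, h2, h3⟩
    exact Subtype.ext (Prod.ext (closeProj_eq_self hp h1 h2) (Prod.ext rfl h3.symm))

theorem mem_chartTrace_iff (hp : p ∈ imCl) {h : Model} (hh : h ∈ chartSource p) :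
    h ∈ chartTrace imCl p ↔ chartMap p h ∈ chartSubspace p := by
  have hpos := fun θ => (hh.1 θ).1
  have h1 : h ∈ chartTrace imCl p ↔ p.shift h hpos ∈ imCl := by
    constructor
    · rintro ⟨q, hq, hs⟩
      rwa [← hs.eq_shift hpos]
    · exact fun H => ⟨_, H, shift_shift p h hpos⟩
  obtain ⟨e1, e2⟩ := integral_chartSpeed hp h
  rw [h1, shift_mem_imCl_iff, mem_chartSubspace, ← e1, ← e2, chartMap, sub_eq_zero]
  tauto

theorem isSplittingChart_chartEquiv (hp : p ∈ imCl) :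
    IsSplittingChart imCl p (chartEquiv hp) (chartSubspace p) where
  open_source := isOpen_chartSource p
  open_target := isOpen_chartTarget p
  zero_mem := by
    refine ⟨fun θ => ⟨?_, ?_⟩, closeDet_zero_ne hp⟩
    · change 0 < p.q₁ θ + 0
      rw [add_zero]
      exact p.pos θ
    · change |(0 : ℝ)| < Real.pi
      rw [abs_zero]
      exact Real.pi_pos
  source_subset := fun _ h => h.1
  smooth := convSmoothOn_chartMap hp
  smooth_symm := convSmoothOn_chartInv p
  closed := isClosed_chartSubspace p
  complemented := closedComplemented_chartSubspace hp
  image_eq := by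
    ext k
    constructor
    · rintro ⟨h, ⟨hs, ht⟩, rfl⟩
      exact ⟨chartMap_mem hp hs, (mem_chartTrace_iff hp hs).1 ht⟩
    · rintro ⟨ht, hF⟩
      have hs := chartInv_mem ht
      have e := chartMap_chartInv hp ht
      exact ⟨chartInv p k, ⟨hs, (mem_chartTrace_iff hp hs).2 (by rwa [e])⟩, e⟩

end Chart

/-! ### Infinite codimension -/

/-- Polynomials in sin θ embed the polynomial ring: a polynomial killed by this map vanishes on all
of [-1, 1]. -/
theorem not_finite_smoothFun : ¬ Module.Finite ℝ SmoothFun := by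
  intro hfin
  let s : SmoothFun := SmoothFun.mk Real.sin Real.contDiff_sin Real.sin_periodic
  have hs : ∀ (P : Polynomial ℝ) θ, Polynomial.aeval s P θ = P.eval (Real.sin θ) := fun P θ => by
    induction P using Polynomial.induction_on' with
    | add P Q hP hQ => rw [map_add, add_apply, hP, hQ, Polynomial.eval_add]
    | monomial n a =>
      rw [Polynomial.aeval_monomial, ← Algebra.smul_def, smul_apply, pow_apply,
        Polynomial.eval_monomial]
      rfl
  have hinj : Function.Injective (Polynomial.aeval s : Polynomial ℝ →ₐ[ℝ] SmoothFun).toLinearMap := by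
    rw [← LinearMap.ker_eq_bot, LinearMap.ker_eq_bot']
    intro P hP
    refine Polynomial.eq_zero_of_infinite_isRoot P
      ((Set.Icc_infinite (neg_lt_self one_pos)).mono fun x hx => ?_)
    have := hs P (Real.arcsin x)
    rw [Real.sin_arcsin hx.1 hx.2] at this
    exact this.symm.trans (congrArg (fun f : SmoothFun => f (Real.arcsin x)) hP)
  exact Polynomial.not_finite (R := ℝ) (Module.Finite.of_injective _ hinj)

/-- The third coordinate descends to the quotient and maps it onto C^∞(S¹, ℝ). -/
theorem not_finiteDimensional_quotient {F : Submodule ℝ Model} (hF : ∀ k ∈ F, k.2.2 = 0) :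
    ¬ FiniteDimensional ℝ (Model ⧸ F) := by
  intro hfin
  let π : Model →ₗ[ℝ] SmoothFun := LinearMap.snd ℝ _ _ ∘ₗ LinearMap.snd ℝ _ _
  have hle : F ≤ LinearMap.ker π := fun k hk => LinearMap.mem_ker.2 (hF k hk)
  have hsurj : Function.Surjective (F.liftQ π hle) := fun f =>
    ⟨F.mkQ (0, 0, f), F.liftQ_apply π _⟩
  exact not_finite_smoothFun (Module.Finite.of_surjective _ hsurj)

theorem isSplittingSubmanifold_imCl : IsSplittingSubmanifoldOfInfiniteCodim imCl := fun p hp =>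
  ⟨chartEquiv hp, chartSubspace p, isSplittingChart_chartEquiv hp,
    not_finiteDimensional_quotient fun _ hk => hk.2.2⟩

end RTransform

end

theorem RTransform.linearIndependent_Pop_gradHcl {q : Maps} (hq : q ∈ imOp) :
    LinearIndependent ℝ (fun i : Fin 2 => Pop q (gradHcl q i)) := by
  rw [Fintype.linearIndependent_iff]
  intro g hg
  rw [Fin.sum_univ_two] at hg
  obtain ⟨h0, h1⟩ := linearIndependent_Pop_grad hq _ _ hg
  exact Fin.forall_fin_two.2 ⟨h0, h1⟩

theorem mainTheorem8 :
    -- the image of closed curves modulo translations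
    Set.range R = imCl ∧
    -- the inverse of the transform
    (∀ q ∈ imCl, ∃ c : Imm,
      (∀ θ : ℝ, c θ = ∫ σ in (0 : ℝ)..θ, ((q.q₁ σ : ℝ) : ℂ) ^ 2 * ((q.q₂ σ).toCircle : ℂ)) ∧
      ∀ x : ImmModTra, R x = q ↔ x = Quotient.mk Imm.translationSetoid c) ∧
    -- the image is a splitting submanifold of infinite codimension
    IsSplittingSubmanifoldOfInfiniteCodim imCl ∧
    -- the gradients of the two components of the closing condition
    (∀ (q : Maps) (i : Fin 2), IsGradientAt (HclComp i) q (gradHcl q i)) ∧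
    ∃ (Sop S : Maps → Submodule ℝ Model) (Pop T P : Maps → Model →ₗ[ℝ] Model),
      -- the tangent spaces are linear subspaces
      (∀ q ∈ imOp, (Sop q : Set Model) = tangentSet imOp q) ∧
      (∀ q ∈ imCl, (S q : Set Model) = tangentSet imCl q) ∧
      -- the orthogonal projection without the closing condition, by the elliptic equation
      (∀ q ∈ imOp, ∀ h : Model,
        IsOrthProj q (Sop q) h (Pop q h) ∧ IsGivenByElliptic q h (Pop q h)) ∧
      IsSmoothBundleMapOn Pop imOp ∧
      -- projecting off the two linearly independent vectors
      (∀ q ∈ imCl, LinearIndependent ℝ (fun i : Fin 2 => Pop q (gradHcl q i)) ∧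
        ∀ h : Model, IsProjToComplement q (fun i : Fin 2 => Pop q (gradHcl q i)) h (T q h)) ∧
      -- the orthogonal projection to the tangent space of the image, and its smoothness
      (∀ q ∈ imCl, (∀ h : Model, IsOrthProj q (S q) h (P q h)) ∧ P q = T q ∘ₗ Pop q) ∧
      IsSmoothBundleMapOn P imCl := by
  refine ⟨range_R, fun q hq => ⟨curveOf q hq.2, fun _ => rfl, R_eq_iff hq⟩,
    isSplittingSubmanifold_imCl, isGradientAt_HclComp, tangentOp, tangentCl, Pop, projT,
    fun q => projT q ∘ₗ Pop q, fun q hq => tangentSet_imOp hq,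
    fun q hq => tangentSet_imCl hq,
    fun q hq h => ⟨isOrthProj_Pop hq h, isGivenByElliptic_Pop q h⟩, isSmoothBundleMapOn_Pop,
    fun q hq => ⟨?_, isProjToComplement_projT hq.1⟩,
    fun q hq => ⟨isOrthProj_projT_Pop hq.1, rfl⟩, isSmoothBundleMapOn_projT_Pop⟩
  exact linearIndependent_Pop_gradHcl hq.1
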